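/- Fix $0<q<1$, integers $N_1,N_2\ge 0$ and real numbers $\alpha_0,\alpha_1,\alpha_2$. Put $\sinh_q(x)=q^x-q^{-x}$, $\cosh_q(x)=q^x+q^{-x}$, $A_0=\sinh_q(\alpha_0)$, $A_1=\sinh_q(\alpha_1)$, $A_2=\cosh_q(\alpha_2)$, $A_{N_i}=\cosh_q(-N_i-1)$, $\sigma=\sinh_q(1)^2$, $\lambda_x=\sinh_q(2x+\alpha_0)$, $\mu_x=\sinh_q(2x+\alpha_1)$. For elements of a complex algebra write $\mathcal{AW}(K,L\mid B_0,\dots,B_5)=0$ if $$\cosh_q(2)KLK-K^2L-LK^2=\sinh_q(1)^2(B_0B_1-B_2B_3)K-\cosh_q(1)^2B_5L+\cosh_q(1)\big(B_1B_3B_5+\sinh_q(1)^2B_0B_2\big),$$ $$\cosh_q(2)LKL-L^2K-KL^2=\sinh_q(1)^2(B_0B_1-B_2B_3)L-\cosh_q(1)^2B_4K+\cosh_q(1)\big(B_0B_3B_4+\sinh_q(1)^2B_1B_2\big).$$ Let $\mathrm{AW}(A_{N_i})$ be the algebra with generators $K_1,L_1$ and relation $\mathcal{AW}(K_1,L_1\mid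 A_0,A_1,A_2,A_{N_i},\sigma,\sigma)=0$. Let $\mathrm{AW}_2$ be the unital complex algebra generated by $\mathrm{AW}(A_{N_1})\otimes\mathrm{AW}(A_{N_2})$ and $K_2,L_2,M_2$ subject to $$\mathcal{AW}(K_2,L_2\mid A_0,A_1,A_2,M_2,\sigma,\sigma)=0,\qquad \mathcal{AW}(1\otimes K_1,L_2\mid A_0,L_1\otimes1,A_2,A_{N_2},\sigma,\sigma)=0,$$ $$\mathcal{AW}(K_2,L_1\otimes1\mid 1\otimes K_1,A_1,A_2,A_{N_1},\sigma,\sigma)=0,\qquad \mathcal{AW}(1\otimes K_1,M_2\mid A_0,A_{N_1},-K_2,A_{N_2},-\sigma,\sigma)=0,$$ $$\mathcal{AW}(M_2,L_1\otimes1\mid A_{N_2},A_1,-L_2,A_{N_1},\sigma,-\sigma)=0,$$ where in each relation the structure parameters commute with each other and with the two generators of that relation. Let $V_1,V_2$ be complex inner product spaces of dimensions $N_1+1,N_2+1$. Let $\mathrm{AW}(A_{N_i})$ act on $V_i$ such that $L_1$ on $V_1$ has eigenvalues $\mu_{j-N_1/2}$ $(0\le j\le N_1)$ and $K_1$ on $V_2$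 has eigenvalues $\lambda_{k-N_2/2}$ $(0\le k\le N_2)$. Let a representation of $\mathrm{AW}_2$ on $V_1\otimes V_2$ be given which extends the tensor product of these two representations and in which $1\otimes K_1$, $L_1\otimes 1$, $K_2$, $L_2$, $M_2$ are self-adjoint. For $\boldsymbol\alpha=(\alpha_0,\alpha_1,\alpha_2,\alpha_3)\in\mathbb R^4$ (a generic argument here) let $p_0=\alpha_0+\alpha_3$, $p_1=\alpha_0-\alpha_3$, $p_2=\alpha_1+\alpha_2$, $p_3=\alpha_1-\alpha_2$ and $$a_n^2(\boldsymbol\alpha)=\frac{-\prod_{k=0}^3(\sinh_q(2n+\alpha_0-1)-\sinh_q(p_k))}{\cosh_q(2n+\alpha_0-1)^2\cosh_q(2n+\alpha_0)\cosh_q(2n+\alpha_0-2)},\qquad \tilde a_n^2(\boldsymbol\alpha)=-a_n^2(\alpha_0,-\alpha_2,\alpha_1,\alpha_3),$$ $$\beta_n(B_0,B_1,B_2,B_3)=\frac{(B_0B_1-B_2B_3)\sinh_q(2n+\alpha_0)+\cosh_q(1)(B_1B_3+B_0B_2)}{\cosh_q(2n+\alpha_0-1)\cosh_q(2n+\alpha_0+1)},$$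 $b_n(\boldsymbol\alpha)=\beta_n(\sinh_q\alpha_0,\sinh_q\alpha_1,\cosh_q\alpha_2,\cosh_q\alpha_3)$, $\tilde b_n(\boldsymbol\alpha)=\beta_n(\sinh_q\alpha_0,\cosh_q\alpha_1,\sinh_q\alpha_2,\cosh_q\alpha_3)$; $a_n$ and $\tilde a_n$ are the nonnegative square roots (where these squares are nonnegative). Returning to the fixed $\alpha_0,\alpha_1,\alpha_2$, put $\boldsymbol\alpha_{L_1}^{n_2}=(\alpha_0+2n_2,\alpha_1,\alpha_2,-N_1-1)$, $\boldsymbol\alpha_{M_2}^{n_1}=(\alpha_0,-N_1-1,-\alpha_0-2n_1,-N_2-1)$, and $$a^{L}_{n_1,n_2}=a_{n_1-n_2}(\boldsymbol\alpha_{L_1}^{n_2}),\quad b^{L}_{n_1,n_2}=b_{n_1-n_2}(\boldsymbol\alpha_{L_1}^{n_2}),\quad \tilde a^{M}_{n_1,n_2}=\tilde a_{n_2}(\boldsymbol\alpha_{M_2}^{n_1}),\quad \tilde b^{M}_{n_1,n_2}=\tilde b_{n_2}(\boldsymbol\alpha_{M_2}^{n_1}).$$ Let $n_2$ run through $\{-\frac{N_2}2,-\frac{N_2}2+1,\dots,\frac{N_2}2\}$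 and $n_1$ through $\{n_2-\frac{N_1}2,\dots,n_2+\frac{N_1}2\}$. A normalized joint eigenbasis consists of an orthonormal basis $(\psi_{n_2})$ of $V_2$ and, for each $n_2$, an orthonormal basis $(\psi_{n_1}^{n_2})_{n_1}$ of $V_1$ with $$(1\otimes K_1)(\psi_{n_1}^{n_2}\otimes\psi_{n_2})=\lambda_{n_2}\,\psi_{n_1}^{n_2}\otimes\psi_{n_2},\qquad K_2(\psi_{n_1}^{n_2}\otimes\psi_{n_2})=\lambda_{n_1}\,\psi_{n_1}^{n_2}\otimes\psi_{n_2},$$ and with phases chosen such that all numbers $\langle\psi_{n_1-1}^{n_2}\otimes\psi_{n_2},(L_1\otimes1)(\psi_{n_1}^{n_2}\otimes\psi_{n_2})\rangle$ and $\langle\psi_{n_1}^{n_2-1}\otimes\psi_{n_2-1},M_2(\psi_{n_1}^{n_2}\otimes\psi_{n_2})\rangle$ are nonnegative. Write $\Psi_{n_1,n_2}=\psi_{n_1}^{n_2}\otimes\psi_{n_2}$, with $\Psi_{n_1,n_2}=0$ if the labels are out of range. **Theorem.** A normalized joint eigenbasis exists, and on every normalized joint eigenbasis $L_2$ acts as the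 9-term operator $$\begin{aligned}L_2\Psi_{n_1,n_2}={}&a_{n_1,n_2}\Psi_{n_1-1,n_2-1}+b_{n_1,n_2}\Psi_{n_1-1,n_2}+c_{n_1,n_2}\Psi_{n_1-1,n_2+1}\\&+d_{n_1,n_2}\Psi_{n_1,n_2-1}+e_{n_1,n_2}\Psi_{n_1,n_2}+d_{n_1,n_2+1}\Psi_{n_1,n_2+1}\\&+\overline{c_{n_1+1,n_2-1}}\,\Psi_{n_1+1,n_2-1}+b_{n_1+1,n_2}\Psi_{n_1+1,n_2}+\overline{a_{n_1+1,n_2+1}}\,\Psi_{n_1+1,n_2+1}\end{aligned}$$ with coefficients $$a_{n_1,n_2}=\frac{a^L_{n_1,n_2}d_{n_1-1,n_2}-a^L_{n_1,n_2-1}d_{n_1,n_2}}{b^L_{n_1-1,n_2-1}-b^L_{n_1,n_2}},\qquad c_{n_1,n_2}=\frac{a^L_{n_1,n_2}d_{n_1-1,n_2+1}-a^L_{n_1,n_2+1}d_{n_1,n_2+1}}{b^L_{n_1-1,n_2+1}-b^L_{n_1,n_2}}$$ (each whenever its denominator is nonzero; these numbers are real, so the conjugation bars then have no effect), and $$b_{n_1,n_2}=\frac{a^L_{n_1,n_2}\big(A_0\lambda_{n_2}+\cosh_q(1)A_{N_2}\big)}{\cosh_q(2n_2+\alpha_0-1)\cosh_q(2n_2+\alpha_0+1)},\qquad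 d_{n_1,n_2}=\frac{\tilde a^M_{n_1,n_2}\big(\cosh_q(1)A_1-A_2\lambda_{n_1}\big)}{\cosh_q(2n_1+\alpha_0-1)\cosh_q(2n_1+\alpha_0+1)},$$ $$e_{n_1,n_2}=\frac{\tilde b^M_{n_1,n_2}\big(\cosh_q(1)A_1-A_2\lambda_{n_1}\big)+A_0\big(A_1\lambda_{n_1}+\cosh_q(1)A_2\big)}{\cosh_q(2n_1+\alpha_0-1)\cosh_q(2n_1+\alpha_0+1)}.$$ -/

import Mathlib

open scoped TensorProduct ComplexOrder

noncomputable section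

namespace AskeyWilson

/-- `sinh_q(x) = q^x - q^{-x}`. -/
def sinhq (q x : ℝ) : ℝ := q ^ x - q ^ (-x)

/-- `cosh_q(x) = q^x + q^{-x}`. -/
def coshq (q x : ℝ) : ℝ := q ^ x + q ^ (-x)

/-- The map `𝒜𝒲(K, L ∣ A₀, A₁, A₂, A₃, A₄, A₅)`. The pair `K, L` satisfies the Askey--Wilson
relations with structure parameters `A₀, …, A₅` iff both components vanish. -/
def awMap (q : ℝ) {A : Type*} [Ring A] [Algebra ℂ A] (K L A₀ A₁ A₂ A₃ A₄ A₅ : A) : A × A :=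
  ( ((coshq q 2 : ℂ) • (K * L * K) - K ^ 2 * L - L * K ^ 2)
      - (((sinhq q 1 ^ 2 : ℝ) : ℂ) • ((A₀ * A₁ - A₂ * A₃) * K)
          - ((coshq q 1 ^ 2 : ℝ) : ℂ) • (A₅ * L)
          + (coshq q 1 : ℂ) • (A₁ * A₃ * A₅ + ((sinhq q 1 ^ 2 : ℝ) : ℂ) • (A₀ * A₂))),
    ((coshq q 2 : ℂ) • (L * K * L) - L ^ 2 * K - K * L ^ 2)
      - (((sinhq q 1 ^ 2 : ℝ) : ℂ) • ((A₀ * A₁ - A₂ * A₃) * L)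
          - ((coshq q 1 ^ 2 : ℝ) : ℂ) • (A₄ * K)
          + (coshq q 1 : ℂ) • (A₀ * A₃ * A₄ + ((sinhq q 1 ^ 2 : ℝ) : ℂ) • (A₁ * A₂))) )

/-- A real structure constant, viewed in a complex algebra. -/
def const (A : Type*) [Ring A] [Algebra ℂ A] (r : ℝ) : A := algebraMap ℂ A (r : ℂ)

/-! ### The rank one algebra -/

inductive AW3Gen : Type
  | K
  | L

/-- Defining relations of the rank one algebra: `𝒜𝒲(K, L ∣ A₀, …, A₅) = 0`. -/
inductive AW3Rel (q A₀ A₁ A₂ A₃ A₄ A₅ : ℝ) :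
    FreeAlgebra ℂ AW3Gen → FreeAlgebra ℂ AW3Gen → Prop
  | fst : AW3Rel q A₀ A₁ A₂ A₃ A₄ A₅
      (awMap q (FreeAlgebra.ι ℂ AW3Gen.K) (FreeAlgebra.ι ℂ AW3Gen.L)
        (const _ A₀) (const _ A₁) (const _ A₂) (const _ A₃) (const _ A₄) (const _ A₅)).1 0
  | snd : AW3Rel q A₀ A₁ A₂ A₃ A₄ A₅
      (awMap q (FreeAlgebra.ι ℂ AW3Gen.K) (FreeAlgebra.ι ℂ AW3Gen.L)
        (const _ A₀) (const _ A₁) (const _ A₂) (const _ A₃) (const _ A₄) (const _ A₅)).2 0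

/-- The Askey--Wilson algebra with structure constants `A₀, …, A₅`. -/
abbrev AW3 (q A₀ A₁ A₂ A₃ A₄ A₅ : ℝ) : Type := RingQuot (AW3Rel q A₀ A₁ A₂ A₃ A₄ A₅)

/-- The generators of the rank one algebra. -/
def AW3.gen (q A₀ A₁ A₂ A₃ A₄ A₅ : ℝ) (g : AW3Gen) : AW3 q A₀ A₁ A₂ A₃ A₄ A₅ :=
  RingQuot.mkAlgHom ℂ (AW3Rel q A₀ A₁ A₂ A₃ A₄ A₅) (FreeAlgebra.ι ℂ g)

/-! ### The rank two algebra -/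

/-- Generators: `K1l = K₁ ⊗ 1`, `L1l = L₁ ⊗ 1`, `K1r = 1 ⊗ K₁`, `L1r = 1 ⊗ L₁`, and
`K₂, L₂, M₂`. -/
inductive AW2Gen : Type
  | K1l
  | L1l
  | K1r
  | L1r
  | K2
  | L2
  | M2

namespace AW2Gen

/-- A generator as an element of the free algebra. -/
def x (g : AW2Gen) : FreeAlgebra ℂ AW2Gen := FreeAlgebra.ι ℂ g

end AW2Gen

/-- The real number `r` as an element of the free algebra. -/
def cst (r : ℝ) : FreeAlgebra ℂ AW2Gen := const (FreeAlgebra ℂ AW2Gen) r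

open AW2Gen in
/-- The pairs `(K, L ∣ A₀, …, A₅)` which satisfy the Askey--Wilson relations in the rank two
algebra. The first two, with the commutation of the two factors, present the tensor product of the
two rank one algebras; the third presents the algebra generated by `K₂, L₂, M₂`. -/
inductive AW2Rows (A₀ A₁ A₂ AN₁ AN₂ σL σK s : ℝ) :
    (K L B₀ B₁ B₂ B₃ B₄ B₅ : FreeAlgebra ℂ AW2Gen) → Prop
  | left : AW2Rows A₀ A₁ A₂ AN₁ AN₂ σL σK s
      (x K1l) (x L1l) (cst A₀) (cst A₁) (cst A₂) (cst AN₁) (cst σL) (cst σK)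
  | right : AW2Rows A₀ A₁ A₂ AN₁ AN₂ σL σK s
      (x K1r) (x L1r) (cst A₀) (cst A₁) (cst A₂) (cst AN₂) (cst σL) (cst σK)
  | K2_L2 : AW2Rows A₀ A₁ A₂ AN₁ AN₂ σL σK s
      (x K2) (x L2) (cst A₀) (cst A₁) (cst A₂) (x M2) (cst σL) (cst σK)
  | K1r_L2 : AW2Rows A₀ A₁ A₂ AN₁ AN₂ σL σK s
      (x K1r) (x L2) (cst A₀) (x L1l) (cst A₂) (cst AN₂) (cst σL) (cst σK)
  | K2_L1l : AW2Rows A₀ A₁ A₂ AN₁ AN₂ σL σK s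
      (x K2) (x L1l) (x K1r) (cst A₁) (cst A₂) (cst AN₁) (cst σL) (cst σK)
  | K1r_M2 : AW2Rows A₀ A₁ A₂ AN₁ AN₂ σL σK s
      (x K1r) (x M2) (cst A₀) (cst AN₁) (-x K2) (cst AN₂) (cst (-s)) (cst σK)
  | M2_L1l : AW2Rows A₀ A₁ A₂ AN₁ AN₂ σL σK s
      (x M2) (x L1l) (cst AN₂) (cst A₁) (-x L2) (cst AN₁) (cst σL) (cst (-s))

open AW2Gen in
/-- Pairs of commuting generators: the two tensor factors commute, and the structure parameters
of each Askey--Wilson relation commute with the generators of that relation (those relations have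
at most one structure parameter that is not a constant). -/
inductive AW2Comm : AW2Gen → AW2Gen → Prop
  | K1l_K1r : AW2Comm K1l K1r
  | K1l_L1r : AW2Comm K1l L1r
  | L1l_K1r : AW2Comm L1l K1r
  | L1l_L1r : AW2Comm L1l L1r
  | M2_K2 : AW2Comm M2 K2
  | M2_L2 : AW2Comm M2 L2
  | L1l_L2 : AW2Comm L1l L2
  | K1r_K2 : AW2Comm K1r K2

/-- Defining relations of the rank two algebra. -/
inductive AW2Rel (q A₀ A₁ A₂ AN₁ AN₂ σL σK : ℝ) :
    FreeAlgebra ℂ AW2Gen → FreeAlgebra ℂ AW2Gen → Prop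
  | fst (K L B₀ B₁ B₂ B₃ B₄ B₅ : FreeAlgebra ℂ AW2Gen)
      (h : AW2Rows A₀ A₁ A₂ AN₁ AN₂ σL σK (sinhq q 1 ^ 2) K L B₀ B₁ B₂ B₃ B₄ B₅) :
      AW2Rel q A₀ A₁ A₂ AN₁ AN₂ σL σK (awMap q K L B₀ B₁ B₂ B₃ B₄ B₅).1 0
  | snd (K L B₀ B₁ B₂ B₃ B₄ B₅ : FreeAlgebra ℂ AW2Gen)
      (h : AW2Rows A₀ A₁ A₂ AN₁ AN₂ σL σK (sinhq q 1 ^ 2) K L B₀ B₁ B₂ B₃ B₄ B₅) :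
      AW2Rel q A₀ A₁ A₂ AN₁ AN₂ σL σK (awMap q K L B₀ B₁ B₂ B₃ B₄ B₅).2 0
  | comm (g h : AW2Gen) (hc : AW2Comm g h) :
      AW2Rel q A₀ A₁ A₂ AN₁ AN₂ σL σK (g.x * h.x) (h.x * g.x)

/-- The rank two Askey--Wilson algebra. -/
abbrev AW2 (q A₀ A₁ A₂ AN₁ AN₂ σL σK : ℝ) : Type :=
  RingQuot (AW2Rel q A₀ A₁ A₂ AN₁ AN₂ σL σK)

/-- The generators of the rank two algebra. -/
def AW2.gen (q A₀ A₁ A₂ AN₁ AN₂ σL σK : ℝ) (g : AW2Gen) : AW2 q A₀ A₁ A₂ AN₁ AN₂ σL σK :=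
  RingQuot.mkAlgHom ℂ (AW2Rel q A₀ A₁ A₂ AN₁ AN₂ σL σK) g.x

/-! ### The structure constants in terms of `α₀, α₁, α₂` and the dimensions -/

/-- The rank one algebra with `A₀ = sinh_q α₀`, `A₁ = sinh_q α₁`, `A₂ = cosh_q α₂`,
`A₃ = cosh_q (-N-1)`, `A₄ = A₅ = (sinh_q 1)²`. -/
abbrev AW3p (q α₀ α₁ α₂ : ℝ) (N : ℕ) : Type :=
  AW3 q (sinhq q α₀) (sinhq q α₁) (coshq q α₂) (coshq q (-(N : ℝ) - 1))
    (sinhq q 1 ^ 2) (sinhq q 1 ^ 2)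

/-- Generators of `AW3p`. -/
abbrev AW3p.gen (q α₀ α₁ α₂ : ℝ) (N : ℕ) (g : AW3Gen) : AW3p q α₀ α₁ α₂ N :=
  AW3.gen q (sinhq q α₀) (sinhq q α₁) (coshq q α₂) (coshq q (-(N : ℝ) - 1))
    (sinhq q 1 ^ 2) (sinhq q 1 ^ 2) g

/-- The rank two algebra with `A₀ = sinh_q α₀`, `A₁ = sinh_q α₁`, `A₂ = cosh_q α₂`,
`A_{N_i} = cosh_q (-N_i-1)`, `σ_L = σ_K = (sinh_q 1)²`. -/
abbrev AW2p (q α₀ α₁ α₂ : ℝ) (N₁ N₂ : ℕ) : Type :=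
  AW2 q (sinhq q α₀) (sinhq q α₁) (coshq q α₂) (coshq q (-(N₁ : ℝ) - 1)) (coshq q (-(N₂ : ℝ) - 1))
    (sinhq q 1 ^ 2) (sinhq q 1 ^ 2)

/-- Generators of `AW2p`. -/
abbrev AW2p.gen (q α₀ α₁ α₂ : ℝ) (N₁ N₂ : ℕ) (g : AW2Gen) : AW2p q α₀ α₁ α₂ N₁ N₂ :=
  AW2.gen q (sinhq q α₀) (sinhq q α₁) (coshq q α₂) (coshq q (-(N₁ : ℝ) - 1))
    (coshq q (-(N₂ : ℝ) - 1)) (sinhq q 1 ^ 2) (sinhq q 1 ^ 2) g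

/-! ### Spectra and univariate coefficients -/

/-- `λ_x = sinh_q(2x + α₀)`; the eigenvalue `μ_x` is the same expression with `α₁`. -/
def eig (q α₀ x : ℝ) : ℝ := sinhq q (2 * x + α₀)

/-- `p₀ = α₀ + α₃`, `p₁ = α₀ - α₃`, `p₂ = α₁ + α₂`, `p₃ = α₁ - α₂`. -/
def pRoot (α : Fin 4 → ℝ) : Fin 4 → ℝ :=
  ![α 0 + α 3, α 0 - α 3, α 1 + α 2, α 1 - α 2]

/-- `a_n²(α)`. -/
def aSq (q : ℝ) (α : Fin 4 → ℝ) (n : ℝ) : ℝ :=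
  -(∏ k : Fin 4, (sinhq q (2 * n + α 0 - 1) - sinhq q (pRoot α k))) /
    (coshq q (2 * n + α 0 - 1) ^ 2 * coshq q (2 * n + α 0) * coshq q (2 * n + α 0 - 2))

/-- `a_n(α)`, the nonnegative square root. -/
def aCoef (q : ℝ) (α : Fin 4 → ℝ) (n : ℝ) : ℝ := Real.sqrt (aSq q α n)

/-- The common shape of `b_n` and `b̃_n`. -/
def bForm (q α₀ A₀ A₁ A₂ A₃ n : ℝ) : ℝ :=
  ((A₀ * A₁ - A₂ * A₃) * eig q α₀ n + coshq q 1 * (A₁ * A₃ + A₀ * A₂)) /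
    (coshq q (2 * n + α₀ - 1) * coshq q (2 * n + α₀ + 1))

/-- `b_n(α)`. -/
def bCoef (q : ℝ) (α : Fin 4 → ℝ) (n : ℝ) : ℝ :=
  bForm q (α 0) (sinhq q (α 0)) (sinhq q (α 1)) (coshq q (α 2)) (coshq q (α 3)) n

/-- `ã_n²(α) = -a_n²(α₀, -α₂, α₁, α₃)`. -/
def aTildeSq (q : ℝ) (α : Fin 4 → ℝ) (n : ℝ) : ℝ := -aSq q ![α 0, -α 2, α 1, α 3] n

/-- `ã_n(α)`, the nonnegative square root. -/
def aTilde (q : ℝ) (α : Fin 4 → ℝ) (n : ℝ) : ℝ := Real.sqrt (aTildeSq q α n)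

/-- `b̃_n(α)`. -/
def bTilde (q : ℝ) (α : Fin 4 → ℝ) (n : ℝ) : ℝ :=
  bForm q (α 0) (sinhq q (α 0)) (coshq q (α 1)) (sinhq q (α 2)) (coshq q (α 3)) n

/-- `α_{L₁}^{n₂} = (α₀ + 2n₂, α₁, α₂, -N₁ - 1)`. -/
def alphaL (N₁ : ℕ) (α₀ α₁ α₂ n₂ : ℝ) : Fin 4 → ℝ := ![α₀ + 2 * n₂, α₁, α₂, -(N₁ : ℝ) - 1]

/-- `α_{M₂}^{n₁} = (α₀, -N₁ - 1, -α₀ - 2n₁, -N₂ - 1)`. -/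
def alphaM (N₁ N₂ : ℕ) (α₀ n₁ : ℝ) : Fin 4 → ℝ :=
  ![α₀, -(N₁ : ℝ) - 1, -α₀ - 2 * n₁, -(N₂ : ℝ) - 1]

/-- `a_{n₁}(α_{L₁}^{n₂})`. The first parameter is shifted by `2n₂`, so the index of the univariate
coefficient is `n₁ - n₂`, which keeps the spectral argument equal to `2n₁ + α₀`. -/
def aL (q : ℝ) (N₁ : ℕ) (α₀ α₁ α₂ n₁ n₂ : ℝ) : ℝ :=
  aCoef q (alphaL N₁ α₀ α₁ α₂ n₂) (n₁ - n₂)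

/-- `b_{n₁}(α_{L₁}^{n₂})`, with the same convention on the index. -/
def bL (q : ℝ) (N₁ : ℕ) (α₀ α₁ α₂ n₁ n₂ : ℝ) : ℝ :=
  bCoef q (alphaL N₁ α₀ α₁ α₂ n₂) (n₁ - n₂)

/-- `ã_{n₂}(α_{M₂}^{n₁})`. -/
def aM (q : ℝ) (N₁ N₂ : ℕ) (α₀ n₁ n₂ : ℝ) : ℝ := aTilde q (alphaM N₁ N₂ α₀ n₁) n₂

/-- `b̃_{n₂}(α_{M₂}^{n₁})`. -/
def bM (q : ℝ) (N₁ N₂ : ℕ) (α₀ n₁ n₂ : ℝ) : ℝ := bTilde q (alphaM N₁ N₂ α₀ n₁) n₂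

/-! ### The coefficients of `L₂` -/

/-- `b_{n₁,n₂}`. -/
def coefB (q : ℝ) (N₁ N₂ : ℕ) (α₀ α₁ α₂ n₁ n₂ : ℝ) : ℝ :=
  aL q N₁ α₀ α₁ α₂ n₁ n₂ *
      (sinhq q α₀ * eig q α₀ n₂ + coshq q 1 * coshq q (-(N₂ : ℝ) - 1)) /
    (coshq q (2 * n₂ + α₀ - 1) * coshq q (2 * n₂ + α₀ + 1))

/-- `d_{n₁,n₂}`. -/
def coefD (q : ℝ) (N₁ N₂ : ℕ) (α₀ α₁ α₂ n₁ n₂ : ℝ) : ℝ :=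
  aM q N₁ N₂ α₀ n₁ n₂ * (coshq q 1 * sinhq q α₁ - coshq q α₂ * eig q α₀ n₁) /
    (coshq q (2 * n₁ + α₀ - 1) * coshq q (2 * n₁ + α₀ + 1))

/-- `e_{n₁,n₂}`. -/
def coefE (q : ℝ) (N₁ N₂ : ℕ) (α₀ α₁ α₂ n₁ n₂ : ℝ) : ℝ :=
  (bM q N₁ N₂ α₀ n₁ n₂ * (coshq q 1 * sinhq q α₁ - coshq q α₂ * eig q α₀ n₁)
      + sinhq q α₀ * (sinhq q α₁ * eig q α₀ n₁ + coshq q 1 * coshq q α₂)) /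
    (coshq q (2 * n₁ + α₀ - 1) * coshq q (2 * n₁ + α₀ + 1))

/-- The denominator of `a_{n₁,n₂}`. -/
def denA (q : ℝ) (N₁ : ℕ) (α₀ α₁ α₂ n₁ n₂ : ℝ) : ℝ :=
  bL q N₁ α₀ α₁ α₂ (n₁ - 1) (n₂ - 1) - bL q N₁ α₀ α₁ α₂ n₁ n₂

/-- `a_{n₁,n₂}`, meaningful if `denA` does not vanish. -/
def coefA (q : ℝ) (N₁ N₂ : ℕ) (α₀ α₁ α₂ n₁ n₂ : ℝ) : ℝ :=
  (aL q N₁ α₀ α₁ α₂ n₁ n₂ * coefD q N₁ N₂ α₀ α₁ α₂ (n₁ - 1) n₂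
      - aL q N₁ α₀ α₁ α₂ n₁ (n₂ - 1) * coefD q N₁ N₂ α₀ α₁ α₂ n₁ n₂) /
    denA q N₁ α₀ α₁ α₂ n₁ n₂

/-- The denominator of `c_{n₁,n₂}`. -/
def denC (q : ℝ) (N₁ : ℕ) (α₀ α₁ α₂ n₁ n₂ : ℝ) : ℝ :=
  bL q N₁ α₀ α₁ α₂ (n₁ - 1) (n₂ + 1) - bL q N₁ α₀ α₁ α₂ n₁ n₂

/-- `c_{n₁,n₂}`, meaningful if `denC` does not vanish. -/
def coefC (q : ℝ) (N₁ N₂ : ℕ) (α₀ α₁ α₂ n₁ n₂ : ℝ) : ℝ :=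
  (aL q N₁ α₀ α₁ α₂ n₁ n₂ * coefD q N₁ N₂ α₀ α₁ α₂ (n₁ - 1) (n₂ + 1)
      - aL q N₁ α₀ α₁ α₂ n₁ (n₂ + 1) * coefD q N₁ N₂ α₀ α₁ α₂ n₁ (n₂ + 1)) /
    denC q N₁ α₀ α₁ α₂ n₁ n₂

/-! ### The joint eigenbasis

The labels `n₁, n₂` are encoded by integers `i, j` through `n₂ = j - N₂/2` and
`n₁ = i - (N₁ + N₂)/2`, so that `n₁ = (i - j) + n₂ - N₁/2`. -/

/-- `n₁` as a function of `i`. -/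
def lab₁ (N₁ N₂ : ℕ) (i : ℤ) : ℝ := (i : ℝ) - ((N₁ : ℝ) + (N₂ : ℝ)) / 2

/-- `n₂` as a function of `j`. -/
def lab₂ (N₂ : ℕ) (j : ℤ) : ℝ := (j : ℝ) - (N₂ : ℝ) / 2

/-- `-N₂/2 ≤ n₂ ≤ N₂/2` and `n₂ - N₁/2 ≤ n₁ ≤ n₂ + N₁/2`. -/
abbrev InRange (N₁ N₂ : ℕ) (i j : ℤ) : Prop :=
  (0 ≤ j ∧ j ≤ N₂) ∧ (0 ≤ i - j ∧ i - j ≤ N₁)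

section

variable {V₁ V₂ : Type*} [NormedAddCommGroup V₁] [InnerProductSpace ℂ V₁]
  [NormedAddCommGroup V₂] [InnerProductSpace ℂ V₂] {N₁ N₂ : ℕ}

/-- The vector `ψ_{n₁}^{n₂} ⊗ ψ_{n₂}`, understood as `0` when the labels are out of range. -/
def jointVec (ψ₂ : OrthonormalBasis (Fin (N₂ + 1)) ℂ V₂)
    (ψ₁ : Fin (N₂ + 1) → OrthonormalBasis (Fin (N₁ + 1)) ℂ V₁) (i j : ℤ) : V₁ ⊗[ℂ] V₂ :=
  if h : InRange N₁ N₂ i j then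
    ψ₁ ⟨j.toNat, by omega⟩ ⟨(i - j).toNat, by omega⟩ ⊗ₜ[ℂ] ψ₂ ⟨j.toNat, by omega⟩
  else 0

/-- `ψ_{n₁}^{n₂} ⊗ ψ_{n₂}` is an eigenvector of `1 ⊗ K₁` with eigenvalue `λ_{n₂}` and of `K₂` with
eigenvalue `λ_{n₁}`; the phases are chosen such that the matrix elements of `L₁ ⊗ 1` between
`(n₁, n₂)` and `(n₁ - 1, n₂)`, and those of `M₂` between `(n₁, n₂)` and `(n₁, n₂ - 1)`, are
nonnegative. -/
structure IsJointEigenbasis (q α₀ : ℝ) (k1 l1 k2 m2 : Module.End ℂ (V₁ ⊗[ℂ] V₂))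
    (ψ₂ : OrthonormalBasis (Fin (N₂ + 1)) ℂ V₂)
    (ψ₁ : Fin (N₂ + 1) → OrthonormalBasis (Fin (N₁ + 1)) ℂ V₁) : Prop where
  eigen_k1 : ∀ i j : ℤ, k1 (jointVec ψ₂ ψ₁ i j) =
    (eig q α₀ (lab₂ N₂ j) : ℂ) • jointVec ψ₂ ψ₁ i j
  eigen_k2 : ∀ i j : ℤ, k2 (jointVec ψ₂ ψ₁ i j) =
    (eig q α₀ (lab₁ N₁ N₂ i) : ℂ) • jointVec ψ₂ ψ₁ i j
  phase_l1 : ∀ i j : ℤ, 0 ≤ inner ℂ (jointVec ψ₂ ψ₁ (i - 1) j) (l1 (jointVec ψ₂ ψ₁ i j))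
  phase_m2 : ∀ i j : ℤ, 0 ≤ inner ℂ (jointVec ψ₂ ψ₁ i (j - 1)) (m2 (jointVec ψ₂ ψ₁ i j))

end

end AskeyWilson

end

/-!
The proof works with the five commuting or Askey--Wilson related operators `k₁ = 1 ⊗ K₁`,
`l₁ = L₁ ⊗ 1`, `k₂ = K₂`, `l₂ = L₂`, `m₂ = M₂` on `V₁ ⊗ V₂` and with their matrix entries.

If `K` is symmetric and `K x = sinh_q(a) x`, `K y = sinh_q(b) y`, then pairing the first
Askey--Wilson relation for `(K, L)` with `x` and `y` multiplies `⟪x, L y⟫` by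
`-(sinh_q a - sinh_q (b + 2)) (sinh_q a - sinh_q (b - 2))` (`band_entry`, `sinhq_band`). Hence `L`
is tridiagonal in an eigenbasis of `K` whose eigenvalues are `sinh_q(2n + ω)`, its diagonal is
explicit, and the second relation becomes a first order recurrence for the squared moduli of the
off-diagonal entries (`AWChain.normSq_entry`).

*Existence.* On `V₁ ⊗ ψ_{n₂}` the operator `k₂` is a Jacobi matrix in the eigenbasis of `l₁`. Its
off-diagonal products and its diagonal factor as in the theory of `q`-Racah polynomials, so that it
is triangular, with explicit eigenvalues, in a basis of nodal products (`nodal_gauge`,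
`AWChain.exists_eigenvector`). This gives joint eigenvectors of `k₁` and `k₂`
(`Pentagon.exists_jointGrid`). They form a grid on which `l₁` acts along rows and `m₂` along
columns.

*Phases.* The phase conditions can be met if the phases of the entries of `l₁` and `m₂` around each
unit square of the grid cancel. Comparing the entries of `l₁ l₂ = l₂ l₁` and `m₂ l₂ = l₂ m₂` at the
corners of a square gives two linear relations between the two products along the paths of the
square and the corner entry of `l₂`. Consider the deviations of the two products from explicit
positive multiples of minus the corner entry. If suitable coefficients do not vanish, the relations
force the two deviations to vanish together, and a third relation transports their vanishing along
a row, starting from the boundary of the grid (`JointGrid.defects_eq_zero_of_left`,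
`JointGrid.defects_eq_zero_of_right`). For parameters at which some coefficients or entries vanish,
the nonnegativity of `|⟪Ψ, l₁ Ψ'⟫|²` shows that at least one of the two sides of the grid can be
used as a starting point (`JointGrid.defects_eq_zero`). The outcome is
`JointGrid.exists_plaquette`.

*The action of `l₂`.* The relations for `(k₁, l₂)` and `(k₂, l₂)` show that `l₂` moves each label
by at most one, and express its entries within a row through `l₁` and within a column through `m₂`.
The corner entries are obtained from `l₁ l₂ = l₂ l₁` (`JointGrid.l₂_corner_l₁`).
-/

noncomputable section

namespace AskeyWilson

/-! ### Trigonometric identities for `sinh_q` and `cosh_q` -/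

theorem coshq_pos {q : ℝ} (hq : 0 < q) (x : ℝ) : 0 < coshq q x := by
  unfold coshq; positivity

theorem sinhq_neg (q x : ℝ) : sinhq q (-x) = -sinhq q x := by
  simp [sinhq]

theorem coshq_neg (q x : ℝ) : coshq q (-x) = coshq q x := by
  simp [coshq, add_comm]

theorem sinhq_strictAnti {q : ℝ} (hq0 : 0 < q) (hq1 : q < 1) : StrictAnti (sinhq q) := by
  intro x y h
  have h1 := Real.rpow_lt_rpow_of_exponent_gt hq0 hq1 h
  have h2 := Real.rpow_lt_rpow_of_exponent_gt hq0 hq1 (neg_lt_neg h)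
  unfold sinhq; linarith

theorem sinhq_ne_zero {q : ℝ} (hq0 : 0 < q) (hq1 : q < 1) {x : ℝ} (hx : x ≠ 0) :
    sinhq q x ≠ 0 := by
  have h0 : sinhq q 0 = 0 := by simp [sinhq]
  intro h
  exact hx ((sinhq_strictAnti hq0 hq1).injective (h.trans h0.symm))

theorem sinhq_mul_coshq {q : ℝ} (hq : 0 < q) (x y : ℝ) :
    sinhq q x * coshq q y = sinhq q (x + y) + sinhq q (x - y) := by
  simp only [sinhq, coshq, Real.rpow_add hq, Real.rpow_sub hq, neg_add, neg_sub,
    Real.rpow_neg hq.le]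
  field_simp; ring

theorem sinhq_mul_sinhq {q : ℝ} (hq : 0 < q) (x y : ℝ) :
    sinhq q x * sinhq q y = coshq q (x + y) - coshq q (x - y) := by
  simp only [sinhq, coshq, Real.rpow_add hq, Real.rpow_sub hq, neg_add, neg_sub,
    Real.rpow_neg hq.le]
  field_simp; ring

/-- The factor which multiplies `⟪x, L y⟫` in the first Askey--Wilson relation, for eigenvectors
`x`, `y` of `K` with eigenvalues `sinh_q a`, `sinh_q b`: it vanishes exactly for neighbours,
`a = b ± 2`, if both are in `2ℤ + ω`. -/
theorem sinhq_band {q : ℝ} (hq : 0 < q) (a b : ℝ) :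
    coshq q 2 * sinhq q a * sinhq q b - sinhq q a ^ 2 - sinhq q b ^ 2
      + coshq q 1 ^ 2 * sinhq q 1 ^ 2 =
    -((sinhq q a - sinhq q (b + 2)) * (sinhq q a - sinhq q (b - 2))) := by
  simp only [sinhq, coshq, Real.rpow_add hq, Real.rpow_sub hq, neg_add, neg_sub,
    Real.rpow_neg hq.le, Real.rpow_one, Real.rpow_two]
  field_simp; ring

theorem sinhq_band_diag {q : ℝ} (hq : 0 < q) (a : ℝ) :
    coshq q 2 * sinhq q a * sinhq q a - sinhq q a ^ 2 - sinhq q a ^ 2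
      + coshq q 1 ^ 2 * sinhq q 1 ^ 2 =
    sinhq q 1 ^ 2 * (coshq q (a - 1) * coshq q (a + 1)) := by
  simp only [sinhq, coshq, Real.rpow_add hq, Real.rpow_sub hq, neg_add, neg_sub,
    Real.rpow_neg hq.le, Real.rpow_one, Real.rpow_two]
  field_simp; ring

theorem sinhq_add_two {q : ℝ} (hq : 0 < q) (y : ℝ) :
    coshq q 2 * sinhq q (y + 2) - 2 * sinhq q y = sinhq q 2 * coshq q (y + 2) := by
  simp only [sinhq, coshq, Real.rpow_add hq, Real.rpow_sub hq, neg_add, neg_sub,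
    Real.rpow_neg hq.le, Real.rpow_one, Real.rpow_two]
  field_simp; ring

theorem sinhq_sub_two {q : ℝ} (hq : 0 < q) (y : ℝ) :
    coshq q 2 * sinhq q (y - 2) - 2 * sinhq q y = -(sinhq q 2 * coshq q (y - 2)) := by
  simp only [sinhq, coshq, Real.rpow_add hq, Real.rpow_sub hq, neg_add, neg_sub,
    Real.rpow_neg hq.le, Real.rpow_one, Real.rpow_two]
  field_simp; ring

/-- The diagonal entry of `L` at an eigenvector of `K` with eigenvalue `sinh_q y`, where `(K, L)`
satisfies the Askey--Wilson relations with parameters `B₀, …, B₃`. -/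
def diagEntry (q B₀ B₁ B₂ B₃ y : ℝ) : ℝ :=
  ((B₀ * B₁ - B₂ * B₃) * sinhq q y + coshq q 1 * (B₁ * B₃ + B₀ * B₂)) /
    (coshq q (y - 1) * coshq q (y + 1))

/-- The squared modulus of the entry of `L` between the eigenvectors of `K` with eigenvalues
`sinh_q (y - 2)` and `sinh_q y`, for Askey--Wilson parameters `B₀, …, B₃`, `B₄ = ε sinh_q(1)²` and
`B₅ = sinh_q(1)²`, `ε = ±1`. -/
def offDiagSq (q ε B₀ B₁ B₂ B₃ y : ℝ) : ℝ :=
  -ε * ((sinhq q (y - 1) ^ 2 - B₀ * B₃ * sinhq q (y - 1) + B₀ ^ 2 - B₃ ^ 2 + 4) *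
      (sinhq q (y - 1) ^ 2 - ε * (B₁ * B₂) * sinhq q (y - 1) + ε * (B₁ ^ 2 - B₂ ^ 2) + 4)) /
    (coshq q (y - 1) ^ 2 * coshq q y * coshq q (y - 2))

/-- The second Askey--Wilson relation for the tridiagonal matrix with entries `diagEntry` and
`offDiagSq`, read off on the diagonal. -/
theorem offDiagSq_recurrence {q : ℝ} (hq : 0 < q) {ε : ℝ} (hε : ε ^ 2 = 1) (B₀ B₁ B₂ B₃ y : ℝ) :
    sinhq q 2 * (coshq q (y + 2) * offDiagSq q ε B₀ B₁ B₂ B₃ (y + 2)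
        - coshq q (y - 2) * offDiagSq q ε B₀ B₁ B₂ B₃ y)
      + (coshq q 2 - 2) * sinhq q y * diagEntry q B₀ B₁ B₂ B₃ y ^ 2 =
    sinhq q 1 ^ 2 * (B₀ * B₁ - B₂ * B₃) * diagEntry q B₀ B₁ B₂ B₃ y
      - coshq q 1 ^ 2 * (ε * sinhq q 1 ^ 2) * sinhq q y
      + coshq q 1 * (B₀ * B₃ * (ε * sinhq q 1 ^ 2) + sinhq q 1 ^ 2 * (B₁ * B₂)) := by
  have hu : 0 < q ^ y := Real.rpow_pos_of_pos hq y
  have e : ∀ x, coshq q x ≠ 0 := fun x => (coshq_pos hq x).ne'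
  have h1 := e (y - 1)
  have h2 := e (y + 1)
  have h3 := e y
  have key1 : coshq q (y + 2) * offDiagSq q ε B₀ B₁ B₂ B₃ (y + 2) =
      -ε * ((sinhq q (y + 1) ^ 2 - B₀ * B₃ * sinhq q (y + 1) + B₀ ^ 2 - B₃ ^ 2 + 4) *
      (sinhq q (y + 1) ^ 2 - ε * (B₁ * B₂) * sinhq q (y + 1) + ε * (B₁ ^ 2 - B₂ ^ 2) + 4)) /
      (coshq q (y + 1) ^ 2 * coshq q y) := by
    have := e (y + 2)
    rw [offDiagSq, show y + 2 - 1 = y + 1 by ring, show y + 2 - 2 = y by ring]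
    field_simp
  have key2 : coshq q (y - 2) * offDiagSq q ε B₀ B₁ B₂ B₃ y =
      -ε * ((sinhq q (y - 1) ^ 2 - B₀ * B₃ * sinhq q (y - 1) + B₀ ^ 2 - B₃ ^ 2 + 4) *
      (sinhq q (y - 1) ^ 2 - ε * (B₁ * B₂) * sinhq q (y - 1) + ε * (B₁ ^ 2 - B₂ ^ 2) + 4)) /
      (coshq q (y - 1) ^ 2 * coshq q y) := by
    have := e (y - 2)
    rw [offDiagSq]
    field_simp
  rw [key1, key2, diagEntry]
  simp only [sinhq, coshq, Real.rpow_add hq, Real.rpow_sub hq, neg_add, neg_sub,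
    Real.rpow_neg hq.le, Real.rpow_one, Real.rpow_two]
  generalize q ^ y = u at hu
  have n1 : u ^ 2 + q ^ 2 ≠ 0 := by positivity
  have n2 : u ^ 2 * q ^ 2 + 1 ≠ 0 := by positivity
  have n3 : u ^ 2 + 1 ≠ 0 := by positivity
  rcases sq_eq_one_iff.mp hε with rfl | rfl
  all_goals
    field_simp
    ring

/-! ### Factorization of the Jacobi matrix -/

/-- The coefficient of `f (n + 1)` in the `q`-Racah difference operator, which is not symmetric in
this form. -/
def gaugeUp (q : ℝ) (N : ℝ) (m a b n : ℝ) : ℝ :=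
  -(coshq q (n + m) * sinhq q (n - N) * (coshq q (2 * n + m + 1 - a) - coshq q b)) /
    (coshq q (2 * n + m + 1) * coshq q (2 * n + m))

/-- The coefficient of `f (n - 1)` in the `q`-Racah difference operator. -/
def gaugeDown (q : ℝ) (N : ℝ) (m a b n : ℝ) : ℝ :=
  (sinhq q n * coshq q (n + m + N) * (coshq q (2 * n + m - 1 + a) + coshq q b)) /
    (coshq q (2 * n + m - 1) * coshq q (2 * n + m))

theorem gaugeUp_mul_gaugeDown {q : ℝ} (hq : 0 < q) (N m a b n : ℝ) :
    gaugeUp q N m a b (n - 1) * gaugeDown q N m a b n =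
      offDiagSq q 1 (sinhq q (m + N)) (sinhq q a) (coshq q b) (coshq q (N + 1)) (2 * n + m) := by
  have e : ∀ x, coshq q x ≠ 0 := fun x => (coshq_pos hq x).ne'
  have f1 : sinhq q (2 * n + m - 1) ^ 2
      - sinhq q (m + N) * coshq q (N + 1) * sinhq q (2 * n + m - 1)
      + sinhq q (m + N) ^ 2 - coshq q (N + 1) ^ 2 + 4 =
      coshq q (n + m - 1) * sinhq q (n - 1 - N) * (sinhq q n * coshq q (n + m + N)) := by
    simp only [sinhq, coshq, two_mul, Real.rpow_add hq, Real.rpow_sub hq, neg_add, neg_sub,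
      Real.rpow_neg hq.le, Real.rpow_one]
    field_simp; ring
  have f2 : sinhq q (2 * n + m - 1) ^ 2
      - 1 * (sinhq q a * coshq q b) * sinhq q (2 * n + m - 1)
      + 1 * (sinhq q a ^ 2 - coshq q b ^ 2) + 4 =
      (coshq q (2 * n + m - 1 - a) - coshq q b) * (coshq q (2 * n + m - 1 + a) + coshq q b) := by
    simp only [sinhq, coshq, two_mul, Real.rpow_add hq, Real.rpow_sub hq, neg_add, neg_sub,
      Real.rpow_neg hq.le, Real.rpow_one]
    field_simp; ring
  rw [offDiagSq, f1, f2, gaugeUp, gaugeDown, show 2 * (n - 1) + m + 1 - a = 2 * n + m - 1 -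
    a by ring, show 2 * (n - 1) + m + 1 = 2 * n + m - 1 by ring, show 2 * (n - 1) + m =
    2 * n + m - 2 by ring, show n - 1 + m = n + m - 1 by ring]
  have h1 := e (2 * n + m - 1)
  have h2 := e (2 * n + m)
  have h3 := e (2 * n + m - 2)
  field_simp

theorem gauge_diag {q : ℝ} (hq : 0 < q) (N m a b n : ℝ) :
    sinhq q (a + N) - gaugeUp q N m a b n - gaugeDown q N m a b n =
      diagEntry q (sinhq q (m + N)) (sinhq q a) (coshq q b) (coshq q (N + 1)) (2 * n + m) := by
  rw [diagEntry, gaugeUp, gaugeDown]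
  generalize coshq q b = z
  simp only [sinhq, coshq, two_mul, Real.rpow_add hq, Real.rpow_sub hq, neg_add, neg_sub,
      Real.rpow_neg hq.le, Real.rpow_one]
  have hn : 0 < q ^ n := Real.rpow_pos_of_pos hq n
  have hm : 0 < q ^ m := Real.rpow_pos_of_pos hq m
  have ha : 0 < q ^ a := Real.rpow_pos_of_pos hq a
  have hN : 0 < q ^ N := Real.rpow_pos_of_pos hq N
  generalize q ^ n = x at *
  generalize q ^ m = y at *
  generalize q ^ a = u at *
  generalize q ^ N = v at *
  have n1 : x ^ 4 * y ^ 2 + q ^ 2 ≠ 0 := by positivity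
  have n2 : x ^ 4 * y ^ 2 * q ^ 2 + 1 ≠ 0 := by positivity
  have n3 : x ^ 4 * y ^ 2 + 1 ≠ 0 := by positivity
  field_simp
  ring

/-- The product vanishing at the nodes `0, …, j - 1`, in which the `q`-Racah difference operator is
triangular. -/
def nodal (q m : ℝ) (j : ℕ) (n : ℝ) : ℝ :=
  ∏ i ∈ Finset.range j, (sinhq q (n - i) * coshq q (n + i + m))

theorem nodal_succ (q m : ℝ) (j : ℕ) (n : ℝ) :
    nodal q m (j + 1) n = nodal q m j n * (sinhq q (n - j) * coshq q (n + j + m)) :=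
  Finset.prod_range_succ _ _

theorem nodal_up {q : ℝ} (m : ℝ) (j : ℕ) (n : ℝ) :
    coshq q (n + m) * nodal q m (j + 1) (n + 1) =
      nodal q m j n * (sinhq q (n + 1) * coshq q (n + m + j) * coshq q (n + m + j + 1)) := by
  induction j with
  | zero => simp [nodal]; ring_nf
  | succ j ih =>
    rw [nodal_succ, ← mul_assoc, ih, nodal_succ]
    push_cast
    rw [show n + 1 - ((j : ℝ) + 1) = n - j by ring, show n + 1 + ((j : ℝ) + 1) + m =
      n + m + (j + 1) + 1 by ring, show n + j + m = n + m + j by ring, show n + m + ((j : ℝ) + 1) =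
      n + m + j + 1 by ring]
    ring

theorem nodal_down {q : ℝ} (m : ℝ) (j : ℕ) (n : ℝ) :
    sinhq q n * nodal q m (j + 1) (n - 1) =
      nodal q m j n * (sinhq q (n - j) * sinhq q (n - j - 1) * coshq q (n + m - 1)) := by
  induction j with
  | zero => simp [nodal]; ring_nf
  | succ j ih =>
    rw [nodal_succ, ← mul_assoc, ih, nodal_succ]
    push_cast
    rw [show n - 1 - ((j : ℝ) + 1) = n - (j + 1) - 1 by ring, show n - 1 + ((j : ℝ) + 1) + m =
      n + j + m by ring, show n - (j : ℝ) - 1 = n - (j + 1) by ring]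
    ring

/-- The difference operator with coefficients `gaugeUp`, `gaugeDown` maps the nodal product of
degree `j + 1` to a multiple of itself plus a multiple of the one of degree `j`. -/
theorem nodal_gauge {q : ℝ} (hq : 0 < q) (N m a b n : ℝ) (j : ℕ) :
    gaugeUp q N m a b n * nodal q m (j + 1) (n + 1)
      + gaugeDown q N m a b n * nodal q m (j + 1) (n - 1)
      + (sinhq q (a + N) - gaugeUp q N m a b n - gaugeDown q N m a b n) * nodal q m (j + 1) n =
    sinhq q (a + N - 2 * (j + 1)) * nodal q m (j + 1) n
      - sinhq q (j + 1) * sinhq q (j - N) * (coshq q (2 * j + m + 1 - a) - coshq q b) *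
        nodal q m j n := by
  have e : ∀ x, coshq q x ≠ 0 := fun x => (coshq_pos hq x).ne'
  have h1 := e (2 * n + m - 1)
  have h2 := e (2 * n + m)
  have h3 := e (2 * n + m + 1)
  have d1 : sinhq q (n + 1) * coshq q (n + m + j + 1) - coshq q (n + m) * sinhq q (n - j)
      = sinhq q (j + 1) * coshq q (2 * n + m + 1) := by
    simp only [sinhq, coshq, two_mul, Real.rpow_add hq, Real.rpow_sub hq, neg_add, neg_sub,
      Real.rpow_neg hq.le, Real.rpow_one]
    field_simp; ring
  have d2 : sinhq q (n - j - 1) * coshq q (n + m - 1) - sinhq q n * coshq q (n + m + j)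
      = -(sinhq q (j + 1) * coshq q (2 * n + m - 1)) := by
    simp only [sinhq, coshq, two_mul, Real.rpow_add hq, Real.rpow_sub hq, neg_add, neg_sub,
      Real.rpow_neg hq.le, Real.rpow_one]
    field_simp; ring
  -- After division by `nodal q m j n`, the claim is an identity of Laurent polynomials.
  have key : -sinhq q (n - N) * (coshq q (2 * n + m + 1 - a) - coshq q b) * coshq q (n + m + j) *
    sinhq q (j + 1)
      - coshq q (n + m + N) * (coshq q (2 * n + m - 1 + a) + coshq q b) * sinhq q (n - j) *
        sinhq q (j + 1)
      = coshq q (2 * n + m) * ((sinhq q (a + N - 2 * (j + 1)) - sinhq q (a + N)) *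
        (sinhq q (n - j) * coshq q (n + m + j))
        - sinhq q (j + 1) * sinhq q (j - N) * (coshq q (2 * j + m + 1 - a) - coshq q b)) := by
    generalize coshq q b = z
    simp only [sinhq, coshq, two_mul, Real.rpow_add hq, Real.rpow_sub hq, neg_add, neg_sub,
      Real.rpow_neg hq.le, Real.rpow_one]
    field_simp; ring
  have hu : gaugeUp q N m a b n * (nodal q m (j + 1) (n + 1) - nodal q m (j + 1) n) =
      nodal q m j n * (-sinhq q (n - N) * (coshq q (2 * n + m + 1 - a) - coshq q b) *
        coshq q (n + m + j) * sinhq q (j + 1))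
        / coshq q (2 * n + m) := by
    rw [gaugeUp, div_mul_eq_mul_div, div_eq_div_iff (mul_ne_zero h3 h2) h2]
    have := nodal_up (q := q) m j n
    have h4 := nodal_succ q m j n
    rw [show n + j + m = n + m + j by ring] at h4
    linear_combination (-sinhq q (n - N) * (coshq q (2 * n + m + 1 - a) - coshq q b)
        * coshq q (2 * n + m)) * (this
      - coshq q (n + m) * h4) - coshq q (2 * n + m) * nodal q m j n * sinhq q (n - N) *
        (coshq q (2 * n + m + 1 - a) - coshq q b)
        * coshq q (n + m + j) * d1
  have hd : gaugeDown q N m a b n * (nodal q m (j + 1) (n - 1) - nodal q m (j + 1) n) =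
      nodal q m j n * (- coshq q (n + m + N) * (coshq q (2 * n + m - 1 + a) + coshq q b) *
        sinhq q (n - j) * sinhq q (j + 1))
        / coshq q (2 * n + m) := by
    rw [gaugeDown, div_mul_eq_mul_div, div_eq_div_iff (mul_ne_zero h1 h2) h2]
    have := nodal_down (q := q) m j n
    have h4 := nodal_succ q m j n
    rw [show n + j + m = n + m + j by ring] at h4
    linear_combination (coshq q (n + m + N) * (coshq q (2 * n + m - 1 + a) + coshq q b)
        * coshq q (2 * n + m)) * (this
      - sinhq q n * h4) + coshq q (2 * n + m) * nodal q m j n * coshq q (n + m + N) *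
        (coshq q (2 * n + m - 1 + a) + coshq q b)
        * sinhq q (n - j) * d2
  have h4 := nodal_succ q m j n
  rw [show n + j + m = n + m + j by ring] at h4
  have : gaugeUp q N m a b n * (nodal q m (j + 1) (n + 1) - nodal q m (j + 1) n) +
    gaugeDown q N m a b n * (nodal q m (j + 1) (n - 1) - nodal q m (j + 1) n) =
      (sinhq q (a + N - 2 * (j + 1)) - sinhq q (a + N)) * nodal q m (j + 1) n
       - sinhq q (j + 1) * sinhq q (j - N) * (coshq q (2 * j + m + 1 - a) - coshq q b) *
         nodal q m j n := by
    rw [hu, hd, h4, ← add_div, div_eq_iff h2]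
    linear_combination nodal q m j n * key
  linear_combination this

/-! ### Differences of diagonal entries -/

/-- The ratio of the entries of `L₂` and `L₁ ⊗ 1` between different joint eigenvectors in the same
row, where `1 ⊗ K₁` has the eigenvalue `sinh_q y`. -/
def facB (q A₀ A y : ℝ) : ℝ := (A₀ * sinhq q y + coshq q 1 * A) / (coshq q (y - 1) *
    coshq q (y + 1))

/-- The ratio of the entries of `L₂` and `M₂` between different joint eigenvectors in the same
column, where `K₂` has the eigenvalue `sinh_q x`. -/
def facD (q A₁ A₂ x : ℝ) : ℝ := (coshq q 1 * A₁ - A₂ * sinhq q x) / (coshq q (x - 1) *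
    coshq q (x + 1))

/-- The difference of two diagonal entries of `M₂` at diagonally opposite points, in terms of
`facB`. -/
theorem diag_m2_diff {q : ℝ} (hq : 0 < q) (A₀ A B x y : ℝ) :
    diagEntry q A₀ B (-sinhq q (x - 2)) A (y - 2) - diagEntry q A₀ B (-sinhq q x) A y =
    -(facB q A₀ A (y - 2) * (coshq q (x - y + 1) - B) - facB q A₀ A y * (coshq q (x - y - 1) -
      B)) := by
  have e : ∀ x, coshq q x ≠ 0 := fun x => (coshq_pos hq x).ne'
  have h1 := e (y - 1)
  have h2 := e (y - 3)
  have h3 := e (y + 1)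
  rw [diagEntry, diagEntry, facB, facB, show y - 2 - 1 = y - 3 by ring, show y - 2 + 1 =
    y - 1 by ring]
  simp only [show y - 3 = y - 1 - 2 by ring, sinhq, coshq, Real.rpow_add hq, Real.rpow_sub hq,
    neg_add, neg_sub, Real.rpow_neg hq.le, Real.rpow_one, Real.rpow_two]
  have hn : 0 < q ^ x := Real.rpow_pos_of_pos hq x
  have hm : 0 < q ^ y := Real.rpow_pos_of_pos hq y
  generalize q ^ x = x at *
  generalize q ^ y = y at *
  have n1 : y ^ 2 + q ^ 2 ≠ 0 := by positivity
  have n2 : y ^ 2 * q ^ 2 + 1 ≠ 0 := by positivity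
  have n3 : y ^ 2 + (q * q ^ 2) ^ 2 ≠ 0 := by positivity
  field_simp
  ring

/-- The difference of two diagonal entries of `L₁ ⊗ 1` at diagonally opposite points, in terms of
`facD`. -/
theorem diag_l1_diff {q : ℝ} (hq : 0 < q) (A₁ A₂ B x y : ℝ) :
    diagEntry q (sinhq q (y - 2)) A₁ A₂ B (x - 2) - diagEntry q (sinhq q y) A₁ A₂ B x =
    -(facD q A₁ A₂ (x - 2) * (coshq q (x - y - 1) - B) - facD q A₁ A₂ x * (coshq q (x - y + 1) -
      B)) := by
  have e : ∀ x, coshq q x ≠ 0 := fun x => (coshq_pos hq x).ne'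
  rw [diagEntry, diagEntry, facD, facD, show x - 2 - 1 = x - 3 by ring, show x - 2 + 1 =
    x - 1 by ring]
  simp only [show x - 3 = x - 1 - 2 by ring, sinhq, coshq, Real.rpow_add hq, Real.rpow_sub hq,
    neg_add, neg_sub, Real.rpow_neg hq.le, Real.rpow_one, Real.rpow_two]
  have hn : 0 < q ^ x := Real.rpow_pos_of_pos hq x
  have hm : 0 < q ^ y := Real.rpow_pos_of_pos hq y
  generalize q ^ x = x at *
  generalize q ^ y = y at *
  have n1 : x ^ 2 + q ^ 2 ≠ 0 := by positivity
  have n2 : x ^ 2 * q ^ 2 + 1 ≠ 0 := by positivity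
  have n3 : x ^ 2 + (q * q ^ 2) ^ 2 ≠ 0 := by positivity
  field_simp
  ring

/-! ### Eigenvalues of the Jacobi matrix -/

/-- The entries of the tridiagonal matrix with superdiagonal `α`, diagonal `β` and subdiagonal `γ`,
each indexed by the row. -/
def tridiag (α β γ : ℕ → ℝ) (r c : ℕ) : ℝ :=
  (if c = r + 1 then α r else 0) + (if c = r then β r else 0) + (if r = c + 1 then γ r else 0)

theorem sum_tridiag_mul (N : ℕ) (α β γ f : ℕ → ℝ) {r : ℕ} (hr : r ≤ N) :
    ∑ c ∈ Finset.range (N + 1), tridiag α β γ r c * f c =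
      (if r < N then α r * f (r + 1) else 0) + β r * f r +
        (if 0 < r then γ r * f (r - 1) else 0) := by
  simp only [tridiag, add_mul, Finset.sum_add_distrib, ite_mul, zero_mul]
  congr 1
  · congr 1
    · simp
    · simp; omega
  · rcases r with _ | r
    · simp
    · simp; omega

theorem sum_mul_tridiag (N : ℕ) (α β γ f : ℕ → ℝ) {c : ℕ} (hc : c ≤ N) :
    ∑ r ∈ Finset.range (N + 1), f r * tridiag α β γ r c =
      (if 0 < c then f (c - 1) * α (c - 1) else 0) + f c * β c +
        (if c < N then f (c + 1) * γ (c + 1) else 0) := by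
  simp only [tridiag, mul_add, Finset.sum_add_distrib, mul_ite, mul_zero]
  congr 1
  · congr 1
    · rcases c with _ | c
      · simp
      · simp; omega
    · simp; omega
  · simp

theorem nodal_eq_zero (q m : ℝ) {j n : ℕ} (h : n < j) : nodal q m j n = 0 := by
  refine Finset.prod_eq_zero (i := n) (Finset.mem_range.2 h) ?_
  simp [sinhq]

theorem nodal_self_ne_zero {q : ℝ} (hq0 : 0 < q) (hq1 : q < 1) (m : ℝ) (n : ℕ) :
    nodal q m n n ≠ 0 := by
  refine Finset.prod_ne_zero_iff.2 fun i hi => mul_ne_zero ?_ (coshq_pos hq0 _).ne'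
  apply sinhq_ne_zero hq0 hq1
  have : i < n := Finset.mem_range.1 hi
  have : (i : ℝ) < n := by exact_mod_cast this
  linarith

/-- Every `sinh_q (a + N - 2k)` with `k ≤ N` is an eigenvalue of the tridiagonal matrix built from
`gaugeUp` and `gaugeDown`: the matrix of nodal products is invertible and conjugates it to a
triangular matrix with these diagonal entries. The eigenvector is a left one. -/
theorem gauge_left_null_nat {q : ℝ} (hq0 : 0 < q) (hq1 : q < 1) (N : ℕ) (m a b : ℝ) {k : ℕ}
    (hk : k ≤ N) :
    ∃ x : ℕ → ℝ, (∃ n, x n ≠ 0) ∧ (∀ n, N < n → x n = 0) ∧ ∀ n ≤ N,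
      (if 0 < n then gaugeUp q N m a b ((n : ℝ) - 1) * x (n - 1) else 0) +
      (sinhq q (a + N) - gaugeUp q N m a b n - gaugeDown q N m a b n) * x n +
      gaugeDown q N m a b ((n : ℝ) + 1) * x (n + 1) = sinhq q (a + N - 2 * k) * x n := by
  set A : ℕ → ℝ := fun n => gaugeUp q N m a b n with hA
  set D : ℕ → ℝ := fun n => gaugeDown q N m a b n with hD
  set g : ℕ → ℝ := fun n => sinhq q (a + N) - A n - D n with hg
  set θ : ℕ → ℝ := fun j => sinhq q (a + N - 2 * j) with hθ
  set η : ℕ → ℝ := fun j => - sinhq q (j + 1) * sinhq q (j - N) * (coshq q (2 * j + m + 1 - a) -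
    coshq q b) with hη
  let T : Matrix (Fin (N + 1)) (Fin (N + 1)) ℝ := Matrix.of fun r c => tridiag A g D r c
  let Φ : Matrix (Fin (N + 1)) (Fin (N + 1)) ℝ := Matrix.of fun r c => nodal q m c r
  let U : Matrix (Fin (N + 1)) (Fin (N + 1)) ℝ := Matrix.of fun r c => tridiag η θ 0 r c
  have hAN : A N = 0 := by simp [hA, gaugeUp, sinhq]
  have hD0 : D 0 = 0 := by simp [hD, gaugeDown, sinhq]
  -- The columns of `Φ` are the nodal products, on which the matrix `T` acts as `U`.
  have hTU : T * Φ = Φ * U := by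
    ext ⟨r, hr⟩ ⟨j, hj⟩
    have hr' : r ≤ N := by omega
    have hj' : j ≤ N := by omega
    simp only [Matrix.mul_apply, T, Φ, U, Matrix.of_apply]
    rw [Fin.sum_univ_eq_sum_range (fun c => tridiag A g D r c * nodal q m j c),
      Fin.sum_univ_eq_sum_range (fun c => nodal q m c r * tridiag η θ 0 c j),
      sum_tridiag_mul N A g D (fun c => nodal q m j c) hr',
      sum_mul_tridiag N η θ 0 (fun c => nodal q m c r) hj']
    have e1 : (if r < N then A r * nodal q m j ((r + 1 : ℕ) : ℝ) else 0) =
      A r * nodal q m j ((r : ℝ) + 1) := by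
      split_ifs with h
      · push_cast; rfl
      · have : r = N := by omega
        subst this; rw [hAN]; ring
    have e2 : (if 0 < r then D r * nodal q m j ((r - 1 : ℕ) : ℝ) else 0) =
      D r * nodal q m j ((r : ℝ) - 1) := by
      split_ifs with h
      · rw [Nat.cast_sub h]; simp
      · have : r = 0 := by omega
        subst this; rw [hD0]; ring
    rw [e1, e2]
    rcases j with _ | j
    · simp [nodal, hg, hθ]
      ring
    · have := nodal_gauge hq0 N m a b r j
      simp only [hg, hθ, hη, hA, hD, Nat.succ_pos, if_true, Nat.add_sub_cancel, Pi.zero_apply,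
        mul_zero, ite_self]
      push_cast
      linear_combination this
  have hΦ : Φ.det ≠ 0 := by
    rw [Matrix.det_of_isLowerTriangular Φ]
    · exact Finset.prod_ne_zero_iff.2 fun i _ => nodal_self_ne_zero hq0 hq1 m i
    · intro i j hij
      exact nodal_eq_zero q m (by exact hij)
  -- `U` is triangular, with the eigenvalues `θ` on its diagonal.
  have hU : (U - θ k • (1 : Matrix (Fin (N + 1)) (Fin (N + 1)) ℝ)).det = 0 := by
    rw [Matrix.det_of_isUpperTriangular]
    · refine Finset.prod_eq_zero (Finset.mem_univ (⟨k, by omega⟩ : Fin (N + 1))) ?_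
      simp [U, tridiag]
    · intro i j hij
      have hij' : (j : ℕ) < i := hij
      have h1 : i ≠ j := by rintro rfl; exact lt_irrefl _ hij
      have h2 : (j : ℕ) ≠ i + 1 := by omega
      have h3 : (j : ℕ) ≠ i := by omega
      simp [U, tridiag, Matrix.one_apply_ne h1, h2, h3]
  have hT : (T - θ k • (1 : Matrix (Fin (N + 1)) (Fin (N + 1)) ℝ)).det = 0 := by
    have : (T - θ k • (1 : Matrix (Fin (N + 1)) (Fin (N + 1)) ℝ)) * Φ =
        Φ * (U - θ k • (1 : Matrix (Fin (N + 1)) (Fin (N + 1)) ℝ)) := by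
      rw [sub_mul, mul_sub, hTU]; simp
    have h := congrArg Matrix.det this
    rw [Matrix.det_mul, Matrix.det_mul, hU, mul_zero] at h
    exact (mul_eq_zero.1 h).resolve_right hΦ
  obtain ⟨v, hv0, hv⟩ := Matrix.exists_vecMul_eq_zero_iff.2 hT
  let x : ℕ → ℝ := fun n => if h : n < N + 1 then v ⟨n, h⟩ else 0
  have hxN : ∀ n, N < n → x n = 0 := fun n hn => dif_neg (by omega)
  refine ⟨x, ?_, hxN, ?_⟩
  · obtain ⟨i, hi⟩ := Function.ne_iff.1 hv0
    refine ⟨i, ?_⟩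
    simp only [x, i.2, dif_pos]
    exact hi
  · intro n hn
    have h := congrFun hv ⟨n, by omega⟩
    rw [Matrix.vecMul_sub, Pi.sub_apply, Pi.zero_apply, sub_eq_zero, Matrix.vecMul_smul,
      Matrix.vecMul_one] at h
    have hx : ∀ i : Fin (N + 1), v i = x i := fun i => by simp only [x]; rw [dif_pos i.2]
    simp only [Matrix.vecMul, dotProduct, hx, T, Matrix.of_apply, Pi.smul_apply, smul_eq_mul] at h
    rw [Fin.sum_univ_eq_sum_range (fun c => x c * tridiag A g D c n), sum_mul_tridiag N A g D x hn]
      at h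
    have e1 : (if 0 < n then x (n - 1) * A (n - 1) else 0) =
        (if 0 < n then gaugeUp q N m a b ((n : ℝ) - 1) * x (n - 1) else 0) := by
      split_ifs with h0
      · simp only [hA]; rw [Nat.cast_sub h0]; push_cast; ring
      · rfl
    have e2 : (if n < N then x (n + 1) * D (n + 1) else 0) = gaugeDown q N m a b ((n : ℝ) + 1) *
      x (n + 1) := by
      split_ifs with h0
      · simp only [hD]; push_cast; ring
      · rw [hxN (n + 1) (by omega)]; ring
    rw [e1, e2] at h
    rw [← h]; ring

/-- `gauge_left_null_nat` with the indices extended by zero to the integers. -/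
theorem gauge_left_null {q : ℝ} (hq0 : 0 < q) (hq1 : q < 1) (N : ℕ) (m a b : ℝ) {k : ℕ}
    (hk : k ≤ N) :
    ∃ x : ℤ → ℝ, (∃ n, x n ≠ 0) ∧ (∀ n : ℤ, ¬ (0 ≤ n ∧ n ≤ N) → x n = 0) ∧ ∀ n : ℤ, 0 ≤ n → n ≤ N →
      gaugeUp q N m a b ((n : ℝ) - 1) * x (n - 1) +
      (sinhq q (a + N) - gaugeUp q N m a b n - gaugeDown q N m a b n) * x n +
      gaugeDown q N m a b ((n : ℝ) + 1) * x (n + 1) = sinhq q (a + N - 2 * k) * x n := by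
  obtain ⟨x, ⟨n₀, hn₀⟩, hx, hrec⟩ := gauge_left_null_nat hq0 hq1 N m a b hk
  refine ⟨fun n => if 0 ≤ n then x n.toNat else 0, ⟨n₀, by simpa using hn₀⟩, ?_, ?_⟩
  · intro n hn
    by_cases h0 : 0 ≤ n
    · simp only [h0, if_true]
      exact hx _ (by omega)
    · simp [h0]
  · intro n h0 hn
    obtain ⟨n, rfl⟩ := Int.eq_ofNat_of_zero_le h0
    beta_reduce
    have h1 : (0 : ℤ) ≤ (n : ℤ) + 1 := by omega
    have h2 : ((n : ℤ) + 1).toNat = n + 1 := by omega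
    have h3 : ((n : ℤ) - 1).toNat = n - 1 := by omega
    simp only [Int.natCast_nonneg, if_true, Int.toNat_natCast, h1, h2, h3, Int.cast_natCast]
    have h4 : (0 : ℤ) ≤ (n : ℤ) - 1 ↔ 0 < n := by omega
    simp only [h4, mul_ite, mul_zero]
    exact hrec n (by omega)

/-- A left eigenvector of a tridiagonal matrix with diagonal `g` and off-diagonal entries `A`, `D`
gives an eigenvector of every Hermitian matrix with the same diagonal and `|l n|² = A (n - 1) D n`.
The entries `l n` may vanish; rescaling by the ratios `l n / D n` is done below the last nonzero
index only. -/
theorem exists_jacobi_eigenvector (N : ℕ) (A D g x : ℤ → ℝ) (θ : ℝ) (l : ℤ → ℂ)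
    (hD : ∀ n : ℤ, 1 ≤ n → n ≤ N → D n ≠ 0)
    (hl : ∀ n : ℤ, 1 ≤ n → n ≤ N → l n * starRingEnd ℂ (l n) = ((A (n - 1) * D n : ℝ) : ℂ))
    (hx0 : ∃ n, x n ≠ 0) (hx : ∀ n : ℤ, ¬ (0 ≤ n ∧ n ≤ N) → x n = 0)
    (hrec : ∀ n : ℤ, 0 ≤ n → n ≤ N →
      A (n - 1) * x (n - 1) + g n * x n + D (n + 1) * x (n + 1) = θ * x n) :
    ∃ w : ℤ → ℂ, (∃ n, w n ≠ 0) ∧ (∀ n : ℤ, ¬ (0 ≤ n ∧ n ≤ N) → w n = 0) ∧ ∀ n : ℤ, 0 ≤ n → n ≤ N →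
      l (n + 1) * w (n + 1) + g n * w n + starRingEnd ℂ (l n) * w (n - 1) = θ * w n := by
  obtain ⟨M, hM, hmax⟩ : ∃ M : ℤ, x M ≠ 0 ∧ ∀ n, M < n → x n = 0 := by
    obtain ⟨n₀, hn₀⟩ := hx0
    obtain ⟨M, hM, h⟩ := Int.exists_greatest_of_bdd (P := fun n => x n ≠ 0)
      ⟨N, fun z hz => by by_contra h; exact hz (hx z (by omega))⟩ ⟨n₀, hn₀⟩
    exact ⟨M, hM, fun n hn => by by_contra hc; exact absurd (h n hc) (by omega)⟩
  have hMr : 0 ≤ M ∧ M ≤ N := by by_contra h; exact hM (hx M h)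
  -- The gauge factor which turns the products `A (n - 1) * D n` into `|l n|²`.
  let G : ℤ → ℂ := fun n => ∏ k ∈ Finset.Ioc n M, l k / D k
  have hG : ∀ n, n < M → G n = l (n + 1) / D (n + 1) * G (n + 1) := by
    intro n hn
    have : Finset.Ioc n M = insert (n + 1) (Finset.Ioc (n + 1) M) := by
      ext k; simp only [Finset.mem_Ioc, Finset.mem_insert]; omega
    simp only [G]
    rw [this, Finset.prod_insert (by simp)]
  have up : ∀ n : ℤ, 0 ≤ n → n ≤ M → l (n + 1) * (x (n + 1) * G (n + 1)) = D (n + 1) * x (n + 1) *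
    G n := by
    intro n h0 hn
    rcases hn.lt_or_eq with h | rfl
    · have hd : (D (n + 1) : ℂ) ≠ 0 := by exact_mod_cast hD (n + 1) (by omega) (by omega)
      rw [hG n h]; field_simp
    · rw [hmax (n + 1) (by omega)]; simp
  have down : ∀ n : ℤ, 0 ≤ n → n ≤ M → starRingEnd ℂ (l n) * (x (n - 1) * G (n - 1)) =
    A (n - 1) * x (n - 1) * G n := by
    intro n h0 hn
    rcases h0.lt_or_eq with h | rfl
    · have hd : (D n : ℂ) ≠ 0 := by exact_mod_cast hD n (by omega) (by omega)
      have h1 := hl n (by omega) (by omega)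
      push_cast at h1
      rw [hG (n - 1) (by omega), sub_add_cancel]
      field_simp
      linear_combination G n * x (n - 1) * h1
    · rw [hx (0 - 1) (by omega)]; simp
  refine ⟨fun n => x n * G n, ⟨M, ?_⟩, ?_, ?_⟩
  · simpa [G] using hM
  · intro n hn
    simp [hx n hn]
  · intro n h0 hn
    have hr : (A (n - 1) : ℂ) * x (n - 1) + g n * x n + D (n + 1) * x (n + 1) = θ * x n := by
      exact_mod_cast hrec n h0 hn
    rcases le_or_gt n M with h | h
    · rw [up n h0 h, down n h0 h]
      linear_combination G n * hr
    · simp only [hmax n h, hmax (n + 1) (by omega)]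
      rcases eq_or_ne n (M + 1) with rfl | h'
      -- The recurrence just above the last nonzero index `M` forces `A M = 0`,
      -- hence `l (M + 1) = 0`.
      · have hA : A M = 0 := by
          have := hrec (M + 1) h0 hn
          rw [hmax (M + 1) (by omega), hmax (M + 1 + 1) (by omega), add_sub_cancel_right] at this
          have : A M * x M = 0 := by linarith
          exact (mul_eq_zero.1 this).resolve_right hM
        have hl0 : l (M + 1) = 0 := by
          have := hl (M + 1) (by omega) hn
          rw [add_sub_cancel_right, hA] at this
          simpa using this
        simp [hl0]
      · rw [hmax (n - 1) (by omega)]; simp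

theorem gaugeDown_ne_zero {q : ℝ} (hq0 : 0 < q) (hq1 : q < 1) (N m a b : ℝ) {n : ℝ} (hn : n ≠ 0) :
    gaugeDown q N m a b n ≠ 0 := by
  have e : ∀ x, 0 < coshq q x := coshq_pos hq0
  refine div_ne_zero (mul_ne_zero (mul_ne_zero (sinhq_ne_zero hq0 hq1 hn) (e _).ne') ?_) ?_
  · exact (add_pos (e _) (e _)).ne'
  · exact mul_ne_zero (e _).ne' (e _).ne'

/-! ### Askey--Wilson relations on a chain of eigenvectors -/

theorem inner_apply_of_eigenvector {E : Type*} [NormedAddCommGroup E] [InnerProductSpace ℂ E]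
    {K : Module.End ℂ E} (hK : K.IsSymmetric) {x : E} {r : ℝ} (hx : K x = (r : ℂ) • x) (w : E) :
    inner ℂ x (K w) = r * inner ℂ x w := by
  rw [← hK x w, hx, inner_smul_left, Complex.conj_ofReal]

theorem eq_zero_of_mem_span_of_inner_eq_zero {E ι : Type*} [NormedAddCommGroup E]
    [InnerProductSpace ℂ E] {e : ι → E} {x : E} (hx : x ∈ Submodule.span ℂ (Set.range e))
    (h : ∀ i, inner ℂ (e i) x = 0) : x = 0 := by
  rw [← inner_self_eq_zero (𝕜 := ℂ)]
  have : ∀ y ∈ Submodule.span ℂ (Set.range e), inner ℂ y x = 0 := by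
    intro y hy
    induction hy using Submodule.span_induction with
    | mem y hy => obtain ⟨i, rfl⟩ := hy; exact h i
    | zero => simp
    | add y z _ _ hy hz => rw [inner_add_left, hy, hz, add_zero]
    | smul c y _ hy => rw [inner_smul_left, hy, mul_zero]
  exact this x hx

theorem inner_eq_zero_of_eigenvectors {E : Type*} [NormedAddCommGroup E] [InnerProductSpace ℂ E]
    {K : Module.End ℂ E} (hK : K.IsSymmetric) {x y : E} {r t : ℝ} (hrt : r ≠ t)
    (hx : K x = (r : ℂ) • x) (hy : K y = (t : ℂ) • y) : inner ℂ x y = 0 := by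
  have h := inner_apply_of_eigenvector hK hx y
  rw [hy, inner_smul_right] at h
  have h' : ((t : ℂ) - r) * inner ℂ x y = 0 := by linear_combination h
  refine (mul_eq_zero.1 h').resolve_left (sub_ne_zero.2 ?_)
  exact_mod_cast hrt.symm

/-- The first Askey--Wilson relation with `A₅ = sinh_q(1)²`, between two eigenvectors of `K`. -/
theorem band_entry {E : Type*} [NormedAddCommGroup E] [InnerProductSpace ℂ E] {q a b : ℝ}
    {K L : Module.End ℂ E} (hK : K.IsSymmetric) {x y z : E}
    (hx : K x = (sinhq q a : ℂ) • x) (hy : K y = (sinhq q b : ℂ) • y)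
    (h : (coshq q 2 : ℂ) • K (L (K y)) - K (K (L y)) - L (K (K y))
      + ((coshq q 1 ^ 2 * sinhq q 1 ^ 2 : ℝ) : ℂ) • L y = z) :
    ((coshq q 2 * sinhq q a * sinhq q b - sinhq q a ^ 2 - sinhq q b ^ 2
      + coshq q 1 ^ 2 * sinhq q 1 ^ 2 : ℝ) : ℂ) * inner ℂ x (L y) = inner ℂ x z := by
  rw [← h]
  simp only [inner_add_right, inner_sub_right, inner_smul_right, hy, map_smul,
    inner_apply_of_eigenvector hK hx]
  push_cast
  ring

theorem sinhq_band_ne_zero {q : ℝ} (hq0 : 0 < q) (hq1 : q < 1) (ω : ℝ) {m n : ℤ}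
    (h0 : m ≠ n) (h1 : m ≠ n - 1) (h2 : m ≠ n + 1) :
    coshq q 2 * sinhq q (2 * m + ω) * sinhq q (2 * n + ω) - sinhq q (2 * m + ω) ^ 2
      - sinhq q (2 * n + ω) ^ 2 + coshq q 1 ^ 2 * sinhq q 1 ^ 2 ≠ 0 := by
  have hinj := (sinhq_strictAnti hq0 hq1).injective
  rw [sinhq_band hq0]
  refine neg_ne_zero.2 (mul_ne_zero ?_ ?_) <;> rw [sub_ne_zero] <;> intro hc
  · have := hinj hc
    have : (m : ℝ) = (n + 1 : ℤ) := by push_cast; linarith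
    exact h2 (by exact_mod_cast this)
  · have := hinj hc
    have : (m : ℝ) = (n - 1 : ℤ) := by push_cast; linarith
    exact h1 (by exact_mod_cast this)

/-- An orthonormal family indexed by the integers in `[lo, hi]` and extended by zero. -/
structure IsChain {E : Type*} [NormedAddCommGroup E] [InnerProductSpace ℂ E]
    (e : ℤ → E) (lo hi : ℤ) : Prop where
  zero : ∀ n, ¬ (lo ≤ n ∧ n ≤ hi) → e n = 0
  norm : ∀ n, lo ≤ n → n ≤ hi → inner ℂ (e n) (e n) = (1 : ℂ)
  orth : ∀ m n, m ≠ n → inner ℂ (e m) (e n) = (0 : ℂ)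

/-- A chain of eigenvectors of `K`, with eigenvalues `sinh_q (2n + ω)`, on which `(K, L)` satisfies
the Askey--Wilson relations with `A₄ = ε sinh_q(1)²` and `A₅ = sinh_q(1)²`. The other parameters
may be operators; `B₀, …, B₃` are their eigenvalues on the chain, which need not span the whole
space. -/
structure AWChain {E : Type*} [NormedAddCommGroup E] [InnerProductSpace ℂ E]
    (q ω ε B₀ B₁ B₂ B₃ : ℝ) (K L : Module.End ℂ E) (e : ℤ → E) (lo hi : ℤ) : Prop
    extends IsChain e lo hi where
  symmK : K.IsSymmetric
  symmL : L.IsSymmetric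
  eigen : ∀ n : ℤ, K (e n) = (sinhq q (2 * n + ω) : ℂ) • e n
  span : ∀ n, L (e n) ∈ Submodule.span ℂ (Set.range e)
  rel₁ : ∀ n : ℤ, (coshq q 2 : ℂ) • K (L (K (e n))) - K (K (L (e n))) - L (K (K (e n)))
      + ((coshq q 1 ^ 2 * sinhq q 1 ^ 2 : ℝ) : ℂ) • L (e n) =
    ((sinhq q 1 ^ 2 * ((B₀ * B₁ - B₂ * B₃) * sinhq q (2 * n + ω)
      + coshq q 1 * (B₁ * B₃ + B₀ * B₂)) : ℝ) : ℂ) • e n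
  rel₂ : ∀ n : ℤ, (coshq q 2 : ℂ) • L (K (L (e n))) - L (L (K (e n))) - K (L (L (e n))) =
    ((sinhq q 1 ^ 2 * (B₀ * B₁ - B₂ * B₃) : ℝ) : ℂ) • L (e n)
      + ((- coshq q 1 ^ 2 * (ε * sinhq q 1 ^ 2) * sinhq q (2 * n + ω)
      + coshq q 1 * (B₀ * B₃ * (ε * sinhq q 1 ^ 2) + sinhq q 1 ^ 2 * (B₁ * B₂)) : ℝ) : ℂ) • e n

namespace AWChain

variable {E : Type*} [NormedAddCommGroup E] [InnerProductSpace ℂ E]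
  {q ω ε B₀ B₁ B₂ B₃ : ℝ} {K L : Module.End ℂ E} {e : ℤ → E} {lo hi : ℤ}

theorem entry_eq_zero (h : AWChain q ω ε B₀ B₁ B₂ B₃ K L e lo hi) (hq0 : 0 < q) (hq1 : q < 1)
    {m n : ℤ} (h0 : m ≠ n) (h1 : m ≠ n - 1) (h2 : m ≠ n + 1) : inner ℂ (e m) (L (e n)) = 0 := by
  have := band_entry h.symmK (h.eigen m) (h.eigen n) (h.rel₁ n)
  rw [inner_smul_right, h.orth m n h0, mul_zero] at this
  refine (mul_eq_zero.1 this).resolve_left ?_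
  exact Complex.ofReal_ne_zero.2 (sinhq_band_ne_zero hq0 hq1 ω h0 h1 h2)

theorem entry_diag (h : AWChain q ω ε B₀ B₁ B₂ B₃ K L e lo hi) (hq0 : 0 < q) (hq1 : q < 1) {n : ℤ}
    (h1 : lo ≤ n) (h2 : n ≤ hi) :
    inner ℂ (e n) (L (e n)) = (diagEntry q B₀ B₁ B₂ B₃ (2 * n + ω) : ℂ) := by
  have := band_entry h.symmK (h.eigen n) (h.eigen n) (h.rel₁ n)
  rw [inner_smul_right, h.norm n h1 h2, mul_one, sinhq_band_diag hq0] at this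
  have hs : (sinhq q 1 : ℂ) ≠ 0 := by exact_mod_cast sinhq_ne_zero hq0 hq1 one_ne_zero
  have e1 : (coshq q (2 * n + ω - 1) : ℂ) ≠ 0 := by exact_mod_cast (coshq_pos hq0 _).ne'
  have e2 : (coshq q (2 * n + ω + 1) : ℂ) ≠ 0 := by exact_mod_cast (coshq_pos hq0 _).ne'
  rw [diagEntry]
  push_cast at this ⊢
  rw [eq_div_iff (mul_ne_zero e1 e2)]
  apply mul_left_cancel₀ (pow_ne_zero 2 hs)
  linear_combination this

theorem entry_symm (h : AWChain q ω ε B₀ B₁ B₂ B₃ K L e lo hi) (m n : ℤ) :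
    inner ℂ (e m) (L (e n)) = starRingEnd ℂ (inner ℂ (e n) (L (e m))) := by
  rw [inner_conj_symm, h.symmL]

theorem apply_eq (h : AWChain q ω ε B₀ B₁ B₂ B₃ K L e lo hi) (hq0 : 0 < q) (hq1 : q < 1) (n : ℤ) :
    L (e n) = inner ℂ (e (n - 1)) (L (e n)) • e (n - 1)
      + (diagEntry q B₀ B₁ B₂ B₃ (2 * n + ω) : ℂ) • e n
      + starRingEnd ℂ (inner ℂ (e n) (L (e (n + 1)))) • e (n + 1) := by
  rw [← sub_eq_zero]
  refine eq_zero_of_mem_span_of_inner_eq_zero (e := e) ?_ fun m => ?_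
  · have hm : ∀ m, e m ∈ Submodule.span ℂ (Set.range e) := fun m => Submodule.subset_span ⟨m, rfl⟩
    exact sub_mem (h.span n) (add_mem (add_mem (Submodule.smul_mem _ _ (hm _))
      (Submodule.smul_mem _ _ (hm _))) (Submodule.smul_mem _ _ (hm _)))
  · by_cases hm : lo ≤ m ∧ m ≤ hi
    swap
    · rw [h.zero m hm, inner_zero_left]
    rw [inner_sub_right, inner_add_right, inner_add_right, inner_smul_right, inner_smul_right,
      inner_smul_right, ← h.entry_symm]
    have hn := h.norm m hm.1 hm.2
    rcases eq_or_ne m n with rfl | h0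
    · rw [hn, h.orth m (m - 1) (by omega), h.orth m (m + 1) (by omega),
        h.entry_diag hq0 hq1 hm.1 hm.2]
      ring
    rcases eq_or_ne m (n - 1) with rfl | h1
    · rw [hn, h.orth _ n (by omega), h.orth (n - 1) (n + 1) (by omega)]
      ring
    rcases eq_or_ne m (n + 1) with rfl | h2
    · rw [hn, h.orth _ n (by omega), h.orth (n + 1) (n - 1) (by omega)]
      ring
    rw [h.entry_eq_zero hq0 hq1 h0 h1 h2, h.orth _ _ h0, h.orth _ _ h1, h.orth _ _ h2]
    ring

/-- The diagonal entry of the second Askey--Wilson relation: a first order recurrence for the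
squared moduli of the off-diagonal entries of `L`. -/
theorem normSq_recurrence (h : AWChain q ω ε B₀ B₁ B₂ B₃ K L e lo hi) (hq0 : 0 < q)
    (hq1 : q < 1) {n : ℤ}
    (h1 : lo ≤ n) (h2 : n ≤ hi) :
    sinhq q 2 * (coshq q (2 * n + ω + 2) * Complex.normSq (inner ℂ (e n) (L (e (n + 1))))
        - coshq q (2 * n + ω - 2) * Complex.normSq (inner ℂ (e (n - 1)) (L (e n))))
      + (coshq q 2 - 2) * sinhq q (2 * n + ω) * diagEntry q B₀ B₁ B₂ B₃ (2 * n + ω) ^ 2 =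
    sinhq q 1 ^ 2 * (B₀ * B₁ - B₂ * B₃) * diagEntry q B₀ B₁ B₂ B₃ (2 * n + ω)
      - coshq q 1 ^ 2 * (ε * sinhq q 1 ^ 2) * sinhq q (2 * n + ω)
      + coshq q 1 * (B₀ * B₃ * (ε * sinhq q 1 ^ 2) + sinhq q 1 ^ 2 * (B₁ * B₂)) := by
  have hr := congrArg (inner ℂ (e n)) (h.rel₂ n)
  have hn := h.norm n h1 h2
  have key : inner ℂ (e n) ((coshq q 2 : ℂ) • L (K (L (e n))) - L (L (K (e n))) - K (L (L (e n)))) =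
      inner ℂ (L (e n)) ((coshq q 2 : ℂ) • K (L (e n)) - (2 * sinhq q (2 * n + ω) : ℂ) • L (e n))
        := by
    rw [inner_sub_right, inner_sub_right, inner_sub_right, inner_smul_right, inner_smul_right,
      inner_smul_right, inner_apply_of_eigenvector h.symmK (h.eigen n), h.eigen, map_smul, map_smul,
      inner_smul_right, h.symmL (e n), h.symmL (e n)]
    ring
  rw [key] at hr
  set a := inner ℂ (e (n - 1)) (L (e n)) with ha
  set b := inner ℂ (e n) (L (e (n + 1))) with hb
  set g := diagEntry q B₀ B₁ B₂ B₃ (2 * n + ω) with hg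
  have hdiag := h.entry_diag hq0 hq1 h1 h2
  rw [← hg] at hdiag
  have hexp := h.apply_eq hq0 hq1 n
  rw [← ha, ← hb] at hexp
  -- an entry vanishes together with either of its two vectors
  have na : a * inner ℂ (e (n - 1)) (e (n - 1)) = a := by
    by_cases hr : lo ≤ n - 1 ∧ n - 1 ≤ hi
    · rw [h.norm _ hr.1 hr.2, mul_one]
    · rw [ha, h.zero _ hr]; simp
  have nb : b * inner ℂ (e (n + 1)) (e (n + 1)) = b := by
    by_cases hr : lo ≤ n + 1 ∧ n + 1 ≤ hi
    · rw [h.norm _ hr.1 hr.2, mul_one]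
    · rw [hb, h.zero _ hr]; simp
  have lhs : inner ℂ (L (e n)) ((coshq q 2 : ℂ) • K (L (e n)) - (2 * sinhq q (2 * n + ω) :
    ℂ) • L (e n)) =
      (coshq q 2 * sinhq q (2 * n + ω - 2) - 2 * sinhq q (2 * n + ω)) * (starRingEnd ℂ a * a)
      + (coshq q 2 - 2) * sinhq q (2 * n + ω) * g ^ 2
      + (coshq q 2 * sinhq q (2 * n + ω + 2) - 2 * sinhq q (2 * n + ω)) *
        (b * starRingEnd ℂ b) := by
    rw [hexp]
    simp only [map_add, map_smul, h.eigen, inner_add_left, inner_add_right, inner_sub_right,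
      inner_smul_left, inner_smul_right, hn, h.orth n (n - 1) (by omega), h.orth n (n + 1)
        (by omega),
      h.orth (n - 1) n (by omega), h.orth (n + 1) n (by omega), h.orth (n - 1) (n + 1) (by omega),
      h.orth (n + 1) (n - 1) (by omega), Complex.conj_ofReal, Complex.conj_conj]
    rw [show 2 * ((n - 1 : ℤ) : ℝ) + ω = 2 * n + ω - 2 by push_cast; ring,
      show 2 * ((n + 1 : ℤ) : ℝ) + ω = 2 * n + ω + 2 by push_cast; ring]
    linear_combination ((coshq q 2 * sinhq q (2 * n + ω - 2) - 2 * sinhq q (2 * n + ω) : ℂ)) *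
      starRingEnd ℂ a * na
      + ((coshq q 2 * sinhq q (2 * n + ω + 2) - 2 * sinhq q (2 * n + ω) : ℂ)) * starRingEnd ℂ b * nb
  rw [lhs, inner_add_right, inner_smul_right, inner_smul_right, hn, hdiag,
    Complex.mul_conj, mul_comm (starRingEnd ℂ a), Complex.mul_conj] at hr
  have hr' : (coshq q 2 * sinhq q (2 * n + ω - 2) - 2 * sinhq q (2 * n + ω)) * Complex.normSq a
      + (coshq q 2 - 2) * sinhq q (2 * n + ω) * g ^ 2
      + (coshq q 2 * sinhq q (2 * n + ω + 2) - 2 * sinhq q (2 * n + ω)) * Complex.normSq b =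
    (sinhq q 1 ^ 2 * (B₀ * B₁ - B₂ * B₃)) * g + ((- coshq q 1 ^ 2 * (ε * sinhq q 1 ^ 2) *
      sinhq q (2 * n + ω)
      + coshq q 1 * (B₀ * B₃ * (ε * sinhq q 1 ^ 2) + sinhq q 1 ^ 2 * (B₁ * B₂)))) * 1 := by
    exact_mod_cast hr
  rw [sinhq_add_two hq0, sinhq_sub_two hq0] at hr'
  linear_combination hr'

/-- The off-diagonal entries of `L` up to a phase. The hypothesis `hlo` says that the formula
vanishes at the lower end of the chain, which starts the recurrence. The range includes
`n = hi + 1`, where the entry is zero. -/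
theorem normSq_entry (h : AWChain q ω ε B₀ B₁ B₂ B₃ K L e lo hi) (hq0 : 0 < q) (hq1 : q < 1)
    (hε : ε ^ 2 = 1) (hlo : offDiagSq q ε B₀ B₁ B₂ B₃ (2 * lo + ω) = 0) {n : ℤ} (h1 : lo ≤ n)
    (h2 : n ≤ hi + 1) :
    Complex.normSq (inner ℂ (e (n - 1)) (L (e n))) = offDiagSq q ε B₀ B₁ B₂ B₃ (2 * n + ω) := by
  induction n, h1 using Int.leInduction with
  | base =>
    rw [hlo, h.zero (lo - 1) (by omega), inner_zero_left, map_zero]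
  | succ n hn ih =>
    have ih := ih (by omega)
    have hr := h.normSq_recurrence hq0 hq1 hn (by omega)
    rw [← offDiagSq_recurrence hq0 hε, ih] at hr
    have hs : sinhq q 2 ≠ 0 := sinhq_ne_zero hq0 hq1 two_ne_zero
    have hc := (coshq_pos hq0 (2 * n + ω + 2)).ne'
    rw [add_sub_cancel_right, show 2 * ((n + 1 : ℤ) : ℝ) + ω = 2 * n + ω + 2 by push_cast; ring]
    apply mul_left_cancel₀ (mul_ne_zero hs hc)
    linear_combination hr

end AWChain

theorem IsChain.inner_lincomb {E : Type*} [NormedAddCommGroup E] [InnerProductSpace ℂ E]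
    {e : ℤ → E} {lo hi : ℤ} (h : IsChain e lo hi) {w : ℤ → ℂ}
    (hw : ∀ n, ¬ (lo ≤ n ∧ n ≤ hi) → w n = 0) (m : ℤ) :
    inner ℂ (e m) (∑ n ∈ Finset.Icc lo hi, w n • e n) = w m := by
  rw [inner_sum]
  by_cases hm : lo ≤ m ∧ m ≤ hi
  · rw [Finset.sum_eq_single m]
    · rw [inner_smul_right, h.norm m hm.1 hm.2, mul_one]
    · intro n _ hn
      rw [inner_smul_right, h.orth m n hn.symm, mul_zero]
    · intro hc; exact absurd (Finset.mem_Icc.2 hm) hc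
  · rw [h.zero m hm, hw m hm]; simp

/-- If the chain has `N + 1` elements and starts at `sinh_q (α - N)`, then `L` has the eigenvalues
`sinh_q (a + N - 2k)`, `0 ≤ k ≤ N`, on its span. -/
theorem AWChain.exists_eigenvector {E : Type*} [NormedAddCommGroup E] [InnerProductSpace ℂ E]
    {q ω α a b : ℝ} {N : ℕ} {K L : Module.End ℂ E} {e : ℤ → E} {lo : ℤ}
    (h : AWChain q ω 1 (sinhq q α) (sinhq q a) (coshq q b) (coshq q ((N : ℝ) + 1)) K L
      e lo (lo + N))
    (hq0 : 0 < q) (hq1 : q < 1) (hα : 2 * lo + ω = α - N) {k : ℕ} (hk : k ≤ N) :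
    ∃ w : ℤ → ℂ, ∑ n ∈ Finset.Icc lo (lo + N), w n • e n ≠ 0 ∧
      L (∑ n ∈ Finset.Icc lo (lo + N), w n • e n) =
        (sinhq q (a + N - 2 * k) : ℂ) • ∑ n ∈ Finset.Icc lo (lo + N), w n • e n := by
  obtain ⟨x, hx0, hxs, hx⟩ := gauge_left_null hq0 hq1 N (α - N) a b hk
  have hαN : sinhq q (α - N + N) = sinhq q α := by rw [sub_add_cancel]
  have hidx : ∀ n : ℤ, 2 * ((lo + n : ℤ) : ℝ) + ω = 2 * (n : ℝ) + (α - N) := fun n => by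
    push_cast; linarith
  have hmul : ∀ n : ℤ, gaugeUp q N (α - N) a b (((n - 1 : ℤ) : ℝ)) * gaugeDown q N (α - N) a b n =
      offDiagSq q 1 (sinhq q α) (sinhq q a) (coshq q b) (coshq q ((N : ℝ) + 1))
        (2 * ((lo + n : ℤ) : ℝ) + ω) := by
    intro n
    have := gaugeUp_mul_gaugeDown hq0 N (α - N) a b n
    rw [hαN] at this
    rw [hidx, ← this]; push_cast; rfl
  have hlo : offDiagSq q 1 (sinhq q α) (sinhq q a) (coshq q b) (coshq q ((N : ℝ) + 1))
    (2 * lo + ω) = 0 := by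
    have := hmul 0
    simp only [add_zero] at this
    rw [← this]
    simp [gaugeDown, sinhq]
  obtain ⟨w, ⟨n₀, hn₀⟩, hws, hw⟩ := exists_jacobi_eigenvector N
    (fun n => gaugeUp q N (α - N) a b n) (fun n => gaugeDown q N (α - N) a b n)
    (fun n => diagEntry q (sinhq q α) (sinhq q a) (coshq q b) (coshq q ((N : ℝ) + 1))
      (2 * ((lo + n : ℤ) : ℝ) + ω))
    x (sinhq q (a + N - 2 * k)) (fun n => inner ℂ (e (lo + n - 1)) (L (e (lo + n))))
    (fun n h1 _ => gaugeDown_ne_zero hq0 hq1 _ _ _ _ (by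
      have : (n : ℤ) ≠ 0 := by omega
      exact_mod_cast this))
    (fun n h1 h2 => by
      rw [Complex.mul_conj, hmul, h.normSq_entry hq0 hq1 (one_pow 2) hlo (by omega) (by omega)])
    hx0 hxs (fun n h1 h2 => by
      have := hx n h1 h2
      rw [gauge_diag hq0, hαN] at this
      rw [hidx]
      push_cast
      exact this)
  have hws' : ∀ n, ¬ (lo ≤ n ∧ n ≤ lo + N) → w (n - lo) = 0 := fun n hn => hws _ (by omega)
  refine ⟨fun n => w (n - lo), ?_, ?_⟩
  · intro h0
    have := h.toIsChain.inner_lincomb hws' (lo + n₀)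
    rw [h0, inner_zero_right, add_sub_cancel_left] at this
    exact hn₀ this.symm
  · have hmem : ∀ m, e m ∈ Submodule.span ℂ (Set.range e) := fun m => Submodule.subset_span ⟨m, rfl⟩
    rw [← sub_eq_zero]
    refine eq_zero_of_mem_span_of_inner_eq_zero (e := e) ?_ fun m => ?_
    · refine sub_mem ?_ (Submodule.smul_mem _ _ (sum_mem fun n _ => Submodule.smul_mem _ _
        (hmem n)))
      rw [map_sum]
      exact sum_mem fun n _ => by rw [map_smul]; exact Submodule.smul_mem _ _ (h.span n)
    · by_cases hm : lo ≤ m ∧ m ≤ lo + N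
      swap
      · rw [h.zero m hm, inner_zero_left]
      rw [inner_sub_right, inner_smul_right, ← h.symmL, h.apply_eq hq0 hq1 m]
      simp only [inner_add_left, inner_smul_left, h.toIsChain.inner_lincomb hws', Complex.conj_conj,
        Complex.conj_ofReal]
      have := hw (m - lo) (by omega) (by omega)
      simp only [show lo + (m - lo) = m by ring, show lo + (m - lo + 1) = m + 1 by ring,
        add_sub_cancel_right] at this
      rw [show m - 1 - lo = m - lo - 1 by ring, show m + 1 - lo = m - lo + 1 by ring]
      linear_combination this

/-! ### Orthonormal grids -/

/-- An orthonormal basis indexed by the labels in range, and extended by zero. A row is the set of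
labels with a fixed `j`, a column the set of those with a fixed `i`. -/
structure IsGrid {E : Type*} [NormedAddCommGroup E] [InnerProductSpace ℂ E] (N₁ N₂ : ℕ)
    (Ψ : ℤ → ℤ → E) : Prop where
  zero : ∀ i j, ¬ InRange N₁ N₂ i j → Ψ i j = 0
  norm : ∀ i j, InRange N₁ N₂ i j → inner ℂ (Ψ i j) (Ψ i j) = (1 : ℂ)
  orth : ∀ i j i' j', (i ≠ i' ∨ j ≠ j') → inner ℂ (Ψ i j) (Ψ i' j') = (0 : ℂ)
  span : ∀ v : E, v ∈ Submodule.span ℂ (Set.range fun p : ℤ × ℤ => Ψ p.1 p.2)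

namespace IsGrid
variable {E : Type*} [NormedAddCommGroup E] [InnerProductSpace ℂ E] {N₁ N₂ : ℕ}
  {Ψ : ℤ → ℤ → E}

theorem ext (h : IsGrid N₁ N₂ Ψ) {v w : E} (hvw : ∀ i j, InRange N₁ N₂ i j → inner ℂ (Ψ i j) v =
    inner ℂ (Ψ i j) w) :
    v = w := by
  rw [← sub_eq_zero]
  refine eq_zero_of_mem_span_of_inner_eq_zero (h.span _) fun p => ?_
  by_cases hp : InRange N₁ N₂ p.1 p.2
  · rw [inner_sub_right, hvw _ _ hp, sub_self]
  · simp only [h.zero _ _ hp, inner_zero_left]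

theorem inner_eq (h : IsGrid N₁ N₂ Ψ) {i j : ℤ} (hij : InRange N₁ N₂ i j) (i' j' : ℤ) :
    inner ℂ (Ψ i j) (Ψ i' j') = if i = i' ∧ j = j' then (1 : ℂ) else 0 := by
  split_ifs with hc
  · obtain ⟨rfl, rfl⟩ := hc; exact h.norm _ _ hij
  · exact h.orth _ _ _ _ (by by_contra hh; push Not at hh; exact hc hh)

theorem sum_repr (h : IsGrid N₁ N₂ Ψ) (v : E) :
    v = ∑ p ∈ Finset.Icc (0 : ℤ) (N₁ + N₂) ×ˢ Finset.Icc (0 : ℤ) N₂,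
      inner ℂ (Ψ p.1 p.2) v • Ψ p.1 p.2 := by
  refine h.ext fun i j hij => ?_
  rw [inner_sum, Finset.sum_eq_single (i, j)]
  · rw [inner_smul_right, h.norm _ _ hij, mul_one]
  · rintro ⟨i', j'⟩ _ hne
    rw [inner_smul_right, h.orth, mul_zero]
    by_contra hh; push Not at hh
    exact hne (by rw [hh.1, hh.2])
  · intro hc
    exact absurd (Finset.mem_product.2 ⟨Finset.mem_Icc.2 (by dsimp only; omega),
      Finset.mem_Icc.2 (by dsimp only; omega)⟩) hc

theorem mem_span_row (h : IsGrid N₁ N₂ Ψ) {v : E} {j : ℤ}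
    (hv : ∀ i' j', j' ≠ j → inner ℂ (Ψ i' j') v = 0) :
    v ∈ Submodule.span ℂ (Set.range fun i => Ψ i j) := by
  rw [h.sum_repr v]
  refine sum_mem fun p _ => ?_
  by_cases hp : p.2 = j
  · exact Submodule.smul_mem _ _ (Submodule.subset_span ⟨p.1, by simp [hp]⟩)
  · rw [hv _ _ hp, zero_smul]; exact zero_mem _

theorem mem_span_col (h : IsGrid N₁ N₂ Ψ) {v : E} {i : ℤ}
    (hv : ∀ i' j', i' ≠ i → inner ℂ (Ψ i' j') v = 0) :
    v ∈ Submodule.span ℂ (Set.range fun j => Ψ i j) := by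
  rw [h.sum_repr v]
  refine sum_mem fun p _ => ?_
  by_cases hp : p.1 = i
  · exact Submodule.smul_mem _ _ (Submodule.subset_span ⟨p.2, by simp [hp]⟩)
  · rw [hv _ _ hp, zero_smul]; exact zero_mem _

theorem row (h : IsGrid N₁ N₂ Ψ) {j : ℤ} (hj : 0 ≤ j ∧ j ≤ N₂) :
    IsChain (fun i => Ψ i j) j (j + N₁) where
  zero n hn := h.zero _ _ (by omega)
  norm n h1 h2 := h.norm _ _ (by omega)
  orth m n hmn := h.orth _ _ _ _ (Or.inl hmn)

theorem col (h : IsGrid N₁ N₂ Ψ) (i : ℤ) :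
    IsChain (fun j => Ψ i j) (max 0 (i - N₁)) (min N₂ i) where
  zero n hn := h.zero _ _ (by omega)
  norm n h1 h2 := h.norm _ _ (by omega)
  orth m n hmn := h.orth _ _ _ _ (Or.inr hmn)

end IsGrid

section
variable {V₁ V₂ : Type*} [NormedAddCommGroup V₁] [InnerProductSpace ℂ V₁]
  [NormedAddCommGroup V₂] [InnerProductSpace ℂ V₂] {N₁ N₂ : ℕ}

theorem jointVec_isGrid (ψ₂ : OrthonormalBasis (Fin (N₂ + 1)) ℂ V₂)
    (ψ₁ : Fin (N₂ + 1) → OrthonormalBasis (Fin (N₁ + 1)) ℂ V₁) :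
    IsGrid N₁ N₂ (jointVec ψ₂ ψ₁) where
  zero i j hij := dif_neg hij
  norm i j hij := by
    rw [jointVec, dif_pos hij, TensorProduct.inner_tmul]
    simp
  orth i j i' j' hne := by
    by_cases h : InRange N₁ N₂ i j
    swap
    · rw [jointVec, dif_neg h, inner_zero_left]
    by_cases h' : InRange N₁ N₂ i' j'
    swap
    · rw [jointVec, jointVec, dif_neg h', inner_zero_right]
    rw [jointVec, jointVec, dif_pos h, dif_pos h', TensorProduct.inner_tmul]
    by_cases hj : j = j'
    · subst hj
      rw [OrthonormalBasis.inner_eq_zero, zero_mul]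
      intro hc
      rw [Fin.mk.injEq] at hc
      omega
    · rw [OrthonormalBasis.inner_eq_zero ψ₂, mul_zero]
      intro hc
      rw [Fin.mk.injEq] at hc
      omega
  span v := by
    have key : ∀ (k : Fin (N₂ + 1)) (x : V₁), x ⊗ₜ[ℂ] ψ₂ k ∈
        Submodule.span ℂ (Set.range fun p : ℤ × ℤ => jointVec ψ₂ ψ₁ p.1 p.2) := by
      intro k x
      rw [← (ψ₁ k).sum_repr x, TensorProduct.sum_tmul]
      refine sum_mem fun i _ => ?_
      rw [← TensorProduct.smul_tmul']
      refine Submodule.smul_mem _ _ (Submodule.subset_span ⟨((i : ℤ) + k, (k : ℤ)), ?_⟩)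
      have hr : InRange N₁ N₂ ((i : ℤ) + k) k := by
        have := i.2; have := k.2; omega
      simp only [jointVec]
      rw [dif_pos hr]
      simp
    induction v using TensorProduct.induction_on with
    | zero => exact zero_mem _
    | add x y hx hy => exact add_mem hx hy
    | tmul x y =>
      rw [← ψ₂.sum_repr y, TensorProduct.tmul_sum]
      refine sum_mem fun k _ => ?_
      rw [TensorProduct.tmul_smul]
      exact Submodule.smul_mem _ _ (key k x)

end

/-! ### The operators on a joint eigenbasis -/

/-- The quadratic factors of `offDiagSq` in terms of their roots. -/
theorem quad_factor {q : ℝ} (hq : 0 < q) (a b t : ℝ) :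
    t ^ 2 - sinhq q a * coshq q b * t + sinhq q a ^ 2 - coshq q b ^ 2 + 4 =
      (t - sinhq q (a + b)) * (t - sinhq q (a - b)) := by
  simp only [sinhq, coshq, Real.rpow_add hq, Real.rpow_sub hq, neg_add, neg_sub,
    Real.rpow_neg hq.le]
  field_simp; ring

/-- The commutation relations and the Askey--Wilson relations between `k₁ = 1 ⊗ K₁`, `l₁ = L₁ ⊗ 1`,
`k₂ = K₂`, `l₂ = L₂` and `m₂ = M₂` that determine the action of `l₂`, written for vectors. A field
such as `k₂_l₂` is the relation cubic in `k₂` and `l₂` which is quadratic in `k₂`; it has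
`cosh_q(1)² sinh_q(1)² l₂` moved to its left-hand side. -/
structure Pentagon {E : Type*} [NormedAddCommGroup E] [InnerProductSpace ℂ E]
    (q A₀ A₁ A₂ AN₁ AN₂ : ℝ) (k₁ l₁ k₂ l₂ m₂ : Module.End ℂ E) : Prop where
  symm_k₁ : k₁.IsSymmetric
  symm_l₁ : l₁.IsSymmetric
  symm_k₂ : k₂.IsSymmetric
  symm_l₂ : l₂.IsSymmetric
  symm_m₂ : m₂.IsSymmetric
  comm_k₁_k₂ : ∀ v, k₁ (k₂ v) = k₂ (k₁ v)
  comm_k₁_l₁ : ∀ v, k₁ (l₁ v) = l₁ (k₁ v)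
  comm_k₂_m₂ : ∀ v, k₂ (m₂ v) = m₂ (k₂ v)
  comm_l₁_l₂ : ∀ v, l₁ (l₂ v) = l₂ (l₁ v)
  comm_m₂_l₂ : ∀ v, m₂ (l₂ v) = l₂ (m₂ v)
  k₂_l₂ : ∀ v, (coshq q 2 : ℂ) • k₂ (l₂ (k₂ v)) - k₂ (k₂ (l₂ v)) - l₂ (k₂ (k₂ v))
      + ((coshq q 1 ^ 2 * sinhq q 1 ^ 2 : ℝ) : ℂ) • l₂ v =
    ((sinhq q 1 ^ 2 : ℝ) : ℂ) • (((A₀ * A₁ : ℝ) : ℂ) • k₂ v - (A₂ : ℂ) • m₂ (k₂ v)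
      + (coshq q 1 : ℂ) • ((A₁ : ℂ) • m₂ v + ((A₀ * A₂ : ℝ) : ℂ) • v))
  k₁_l₂ : ∀ v, (coshq q 2 : ℂ) • k₁ (l₂ (k₁ v)) - k₁ (k₁ (l₂ v)) - l₂ (k₁ (k₁ v))
      + ((coshq q 1 ^ 2 * sinhq q 1 ^ 2 : ℝ) : ℂ) • l₂ v =
    ((sinhq q 1 ^ 2 : ℝ) : ℂ) • ((A₀ : ℂ) • l₁ (k₁ v) - ((A₂ * AN₂ : ℝ) : ℂ) • k₁ v
      + (coshq q 1 : ℂ) • ((AN₂ : ℂ) • l₁ v + ((A₀ * A₂ : ℝ) : ℂ) • v))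
  k₂_l₁ : ∀ v, (coshq q 2 : ℂ) • k₂ (l₁ (k₂ v)) - k₂ (k₂ (l₁ v)) - l₁ (k₂ (k₂ v))
      + ((coshq q 1 ^ 2 * sinhq q 1 ^ 2 : ℝ) : ℂ) • l₁ v =
    ((sinhq q 1 ^ 2 : ℝ) : ℂ) • ((A₁ : ℂ) • k₁ (k₂ v) - ((A₂ * AN₁ : ℝ) : ℂ) • k₂ v
      + (coshq q 1 : ℂ) • (((A₁ * AN₁ : ℝ) : ℂ) • v + (A₂ : ℂ) • k₁ v))
  l₁_k₂ : ∀ v, (coshq q 2 : ℂ) • l₁ (k₂ (l₁ v)) - l₁ (l₁ (k₂ v)) - k₂ (l₁ (l₁ v))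
      + ((coshq q 1 ^ 2 * sinhq q 1 ^ 2 : ℝ) : ℂ) • k₂ v =
    ((sinhq q 1 ^ 2 : ℝ) : ℂ) • ((A₁ : ℂ) • k₁ (l₁ v) - ((A₂ * AN₁ : ℝ) : ℂ) • l₁ v
      + (coshq q 1 : ℂ) • ((AN₁ : ℂ) • k₁ v + ((A₁ * A₂ : ℝ) : ℂ) • v))
  k₁_m₂ : ∀ v, (coshq q 2 : ℂ) • k₁ (m₂ (k₁ v)) - k₁ (k₁ (m₂ v)) - m₂ (k₁ (k₁ v))
      + ((coshq q 1 ^ 2 * sinhq q 1 ^ 2 : ℝ) : ℂ) • m₂ v =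
    ((sinhq q 1 ^ 2 : ℝ) : ℂ) • (((A₀ * AN₁ : ℝ) : ℂ) • k₁ v + (AN₂ : ℂ) • k₂ (k₁ v)
      + (coshq q 1 : ℂ) • (((AN₁ * AN₂ : ℝ) : ℂ) • v - (A₀ : ℂ) • k₂ v))
  m₂_k₁ : ∀ v, (coshq q 2 : ℂ) • m₂ (k₁ (m₂ v)) - m₂ (m₂ (k₁ v)) - k₁ (m₂ (m₂ v))
      - ((coshq q 1 ^ 2 * sinhq q 1 ^ 2 : ℝ) : ℂ) • k₁ v =
    ((sinhq q 1 ^ 2 : ℝ) : ℂ) • (((A₀ * AN₁ : ℝ) : ℂ) • m₂ v + (AN₂ : ℂ) • k₂ (m₂ v)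
      - (coshq q 1 : ℂ) • (((A₀ * AN₂ : ℝ) : ℂ) • v + (AN₁ : ℂ) • k₂ v))

/-- A grid of joint eigenvectors of `k₁` and `k₂`, without any condition on the phases. -/
structure JointGrid {E : Type*} [NormedAddCommGroup E] [InnerProductSpace ℂ E]
    (q α₀ A₁ A₂ : ℝ) (N₁ N₂ : ℕ) (k₁ l₁ k₂ l₂ m₂ : Module.End ℂ E) (Ψ : ℤ → ℤ → E) : Prop
    extends Pentagon q (sinhq q α₀) A₁ A₂ (coshq q (N₁ + 1)) (coshq q (N₂ + 1)) k₁ l₁ k₂ l₂ m₂,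
      IsGrid N₁ N₂ Ψ where
  eigen_k₁ : ∀ i j : ℤ, k₁ (Ψ i j) = (sinhq q (2 * j + (α₀ - N₂)) : ℂ) • Ψ i j
  eigen_k₂ : ∀ i j : ℤ, k₂ (Ψ i j) = (sinhq q (2 * i + (α₀ - N₁ - N₂)) : ℂ) • Ψ i j

namespace JointGrid
variable {E : Type*} [NormedAddCommGroup E] [InnerProductSpace ℂ E]
    {q α₀ A₁ A₂ : ℝ} {N₁ N₂ : ℕ} {k₁ l₁ k₂ l₂ m₂ : Module.End ℂ E} {Ψ : ℤ → ℤ → E}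

theorem eig_ne {q : ℝ} (hq0 : 0 < q) (hq1 : q < 1) (ω : ℝ) {m n : ℤ} (h : m ≠ n) :
    sinhq q (2 * m + ω) ≠ sinhq q (2 * n + ω) := by
  intro hc
  have := (sinhq_strictAnti hq0 hq1).injective hc
  exact h (by exact_mod_cast (by linarith : (m : ℝ) = n))

theorem l₁_entry_eq_zero (h : JointGrid q α₀ A₁ A₂ N₁ N₂ k₁ l₁ k₂ l₂ m₂ Ψ) (hq0 : 0 < q)
    (hq1 : q < 1) {i j i' j' : ℤ} (hj : j' ≠ j) : inner ℂ (Ψ i' j') (l₁ (Ψ i j)) = 0 :=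
  inner_eq_zero_of_eigenvectors h.symm_k₁ (eig_ne hq0 hq1 _ hj) (h.eigen_k₁ i' j')
    (by rw [h.comm_k₁_l₁, h.eigen_k₁, map_smul])

theorem m₂_entry_eq_zero (h : JointGrid q α₀ A₁ A₂ N₁ N₂ k₁ l₁ k₂ l₂ m₂ Ψ) (hq0 : 0 < q)
    (hq1 : q < 1) {i j i' j' : ℤ} (hi : i' ≠ i) : inner ℂ (Ψ i' j') (m₂ (Ψ i j)) = 0 :=
  inner_eq_zero_of_eigenvectors h.symm_k₂ (eig_ne hq0 hq1 _ hi) (h.eigen_k₂ i' j')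
    (by rw [h.comm_k₂_m₂, h.eigen_k₂, map_smul])

/-- In a row, `(k₂, l₁)` is an Askey--Wilson chain. -/
theorem row_chain (h : JointGrid q α₀ A₁ A₂ N₁ N₂ k₁ l₁ k₂ l₂ m₂ Ψ) (hq0 : 0 < q) (hq1 : q < 1)
    {j : ℤ} (hj : 0 ≤ j ∧ j ≤ N₂) :
    AWChain q (α₀ - N₁ - N₂) 1 (sinhq q (2 * j + (α₀ - N₂))) A₁ A₂ (coshq q (N₁ + 1)) k₂ l₁
      (fun i => Ψ i j) j (j + N₁) where
  toIsChain := h.toIsGrid.row hj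
  symmK := h.symm_k₂
  symmL := h.symm_l₁
  eigen n := h.eigen_k₂ n j
  span n := h.toIsGrid.mem_span_row fun i' j' hj => h.l₁_entry_eq_zero hq0 hq1 hj
  rel₁ n := by
    rw [h.k₂_l₁]
    simp only [h.eigen_k₁, h.eigen_k₂, map_smul]
    push_cast
    module
  rel₂ n := by
    have := h.l₁_k₂ (Ψ n j)
    rw [← eq_sub_iff_add_eq] at this
    rw [this, h.comm_k₁_l₁]
    simp only [h.eigen_k₁, h.eigen_k₂, map_smul]
    push_cast
    module

/-- In a column, `(k₁, m₂)` is an Askey--Wilson chain with `ε = -1`. -/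
theorem col_chain (h : JointGrid q α₀ A₁ A₂ N₁ N₂ k₁ l₁ k₂ l₂ m₂ Ψ) (hq0 : 0 < q) (hq1 : q < 1)
    (i : ℤ) :
    AWChain q (α₀ - N₂) (-1) (sinhq q α₀) (coshq q (N₁ + 1)) (-sinhq q (2 * i + (α₀ - N₁ - N₂)))
      (coshq q (N₂ + 1)) k₁ m₂ (fun j => Ψ i j) (max 0 (i - N₁)) (min (N₂ : ℤ) i) where
  toIsChain := h.toIsGrid.col i
  symmK := h.symm_k₁
  symmL := h.symm_m₂
  eigen n := h.eigen_k₁ i n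
  span n := h.toIsGrid.mem_span_col fun i' j' hj => h.m₂_entry_eq_zero hq0 hq1 hj
  rel₁ n := by
    rw [h.k₁_m₂]
    simp only [h.eigen_k₁, h.eigen_k₂, map_smul]
    push_cast
    module
  rel₂ n := by
    have := h.m₂_k₁ (Ψ i n)
    rw [sub_eq_iff_eq_add] at this
    rw [this, h.comm_k₂_m₂]
    simp only [h.eigen_k₁, h.eigen_k₂, map_smul]
    push_cast
    module

theorem l₁_apply (h : JointGrid q α₀ A₁ A₂ N₁ N₂ k₁ l₁ k₂ l₂ m₂ Ψ) (hq0 : 0 < q) (hq1 : q < 1)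
    (i j : ℤ) :
    l₁ (Ψ i j) = inner ℂ (Ψ (i - 1) j) (l₁ (Ψ i j)) • Ψ (i - 1) j
      + (diagEntry q (sinhq q (2 * j + (α₀ - N₂))) A₁ A₂ (coshq q (N₁ + 1))
        (2 * i + (α₀ - N₁ - N₂)) : ℂ) • Ψ i j
      + starRingEnd ℂ (inner ℂ (Ψ i j) (l₁ (Ψ (i + 1) j))) • Ψ (i + 1) j := by
  by_cases hj : 0 ≤ j ∧ j ≤ N₂
  · exact (h.row_chain hq0 hq1 hj).apply_eq hq0 hq1 i
  · have : ∀ i, Ψ i j = 0 := fun i => h.zero _ _ (by omega)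
    simp [this]

theorem m₂_apply (h : JointGrid q α₀ A₁ A₂ N₁ N₂ k₁ l₁ k₂ l₂ m₂ Ψ) (hq0 : 0 < q) (hq1 : q < 1)
    (i j : ℤ) :
    m₂ (Ψ i j) = inner ℂ (Ψ i (j - 1)) (m₂ (Ψ i j)) • Ψ i (j - 1)
      + (diagEntry q (sinhq q α₀) (coshq q (N₁ + 1)) (-sinhq q (2 * i + (α₀ - N₁ - N₂)))
      (coshq q (N₂ + 1)) (2 * j + (α₀ - N₂)) : ℂ) • Ψ i j
      + starRingEnd ℂ (inner ℂ (Ψ i j) (m₂ (Ψ i (j + 1)))) • Ψ i (j + 1) :=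
  (h.col_chain hq0 hq1 i).apply_eq hq0 hq1 j

/-- The range includes `i = j` and `i = j + N₁ + 1`, where one of the two vectors is zero and the
right-hand side vanishes as well. -/
theorem normSq_l₁ (h : JointGrid q α₀ A₁ A₂ N₁ N₂ k₁ l₁ k₂ l₂ m₂ Ψ) (hq0 : 0 < q) (hq1 : q < 1)
    {i j : ℤ} (hj : 0 ≤ j ∧ j ≤ N₂) (h1 : j ≤ i) (h2 : i ≤ j + N₁ + 1) :
    Complex.normSq (inner ℂ (Ψ (i - 1) j) (l₁ (Ψ i j))) =
      offDiagSq q 1 (sinhq q (2 * j + (α₀ - N₂))) A₁ A₂ (coshq q (N₁ + 1))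
        (2 * i + (α₀ - N₁ - N₂)) := by
  refine (h.row_chain hq0 hq1 hj).normSq_entry hq0 hq1 (one_pow 2) ?_ h1 h2
  rw [offDiagSq, quad_factor hq0, show (2 * j + (α₀ - N₁ - N₂) - 1 : ℝ) = 2 * j + (α₀ - N₂) -
    (N₁ + 1) by ring]
  simp

/-- The squared entries of `m₂` in terms of their zeros, which are the labels at the ends of a
column. -/
theorem offDiagSq_m₂ {q : ℝ} (hq0 : 0 < q) (a b c d y : ℝ) :
    offDiagSq q (-1) (sinhq q a) (coshq q d) (-sinhq q c) (coshq q b) y =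
      ((sinhq q (y - 1) - sinhq q (a + b)) * (sinhq q (y - 1) - sinhq q (a - b))) *
      ((sinhq q (y - 1) - sinhq q (c + d)) * (sinhq q (y - 1) - sinhq q (c - d))) /
      (coshq q (y - 1) ^ 2 * coshq q y * coshq q (y - 2)) := by
  rw [← quad_factor hq0, ← quad_factor hq0, offDiagSq]
  ring

/-- The range includes the two values of `j` for which exactly one of the two labels belongs to the
column; the right-hand side vanishes there. -/
theorem normSq_m₂ (h : JointGrid q α₀ A₁ A₂ N₁ N₂ k₁ l₁ k₂ l₂ m₂ Ψ) (hq0 : 0 < q) (hq1 : q < 1)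
    {i j : ℤ} (h1 : max 0 (i - N₁) ≤ j) (h2 : j ≤ min (N₂ : ℤ) i + 1) :
    Complex.normSq (inner ℂ (Ψ i (j - 1)) (m₂ (Ψ i j))) =
      offDiagSq q (-1) (sinhq q α₀) (coshq q (N₁ + 1)) (-sinhq q (2 * i + (α₀ - N₁ - N₂)))
      (coshq q (N₂ + 1)) (2 * j + (α₀ - N₂)) := by
  refine (h.col_chain hq0 hq1 i).normSq_entry hq0 hq1 (by norm_num) ?_ h1 h2
  rw [offDiagSq_m₂ hq0]
  rcases max_choice (0 : ℤ) (i - N₁) with hm | hm <;> rw [hm] <;> push_cast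
  · rw [show (2 * 0 + (α₀ - N₂) - 1 : ℝ) = α₀ - (N₂ + 1) by ring]
    simp
  · rw [show (2 * (i - N₁) + (α₀ - N₂) - 1 : ℝ) = 2 * i + (α₀ - N₁ - N₂) - (N₁ + 1) by ring]
    simp

/-- The zeros of the squared entry of `m₂` lie at the ends of the columns only, whatever the
parameters. -/
theorem m₂_entry_ne_zero (h : JointGrid q α₀ A₁ A₂ N₁ N₂ k₁ l₁ k₂ l₂ m₂ Ψ) (hq0 : 0 < q)
    (hq1 : q < 1) {i j : ℤ} (h1 : InRange N₁ N₂ i j) (h2 : InRange N₁ N₂ i (j - 1)) :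
    inner ℂ (Ψ i (j - 1)) (m₂ (Ψ i j)) ≠ 0 := by
  rw [← Complex.normSq_pos, h.normSq_m₂ hq0 hq1 (by omega) (by omega), offDiagSq_m₂ hq0]
  have hs := sinhq_strictAnti hq0 hq1
  have e : ∀ x, 0 < coshq q x := coshq_pos hq0
  have j1 : (1 : ℝ) ≤ j := by exact_mod_cast (by omega : 1 ≤ j)
  have j2 : (j : ℝ) ≤ N₂ := by exact_mod_cast h1.1.2
  have i1 : (j : ℝ) ≤ i := by exact_mod_cast (by omega : j ≤ i)
  have i2 : (i : ℝ) ≤ j - 1 + N₁ := by exact_mod_cast (by omega : i ≤ j - 1 + N₁)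
  refine div_pos (mul_pos_of_neg_of_neg (mul_neg_of_pos_of_neg ?_ ?_) (mul_neg_of_pos_of_neg ?_ ?_))
    (mul_pos (mul_pos (pow_pos (e _) 2) (e _)) (e _))
  · exact sub_pos.2 (hs (by linarith))
  · exact sub_neg.2 (hs (by linarith))
  · exact sub_pos.2 (hs (by linarith))
  · exact sub_neg.2 (hs (by linarith))

/-- Within a row, `l₂` is proportional to `l₁` up to a diagonal term. -/
theorem l₂_entry_row (h : JointGrid q α₀ A₁ A₂ N₁ N₂ k₁ l₁ k₂ l₂ m₂ Ψ) (hq0 : 0 < q) (hq1 : q < 1)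
    (i i' j : ℤ) : inner ℂ (Ψ i' j) (l₂ (Ψ i j)) =
      (facB q (sinhq q α₀) (coshq q (N₂ + 1)) (2 * j + (α₀ - N₂)) : ℂ) * inner ℂ (Ψ i' j)
        (l₁ (Ψ i j))
      + (facD q (sinhq q α₀) (coshq q (N₂ + 1)) (2 * j + (α₀ - N₂)) * A₂ : ℝ) * inner ℂ (Ψ i' j)
        (Ψ i j) := by
  have := band_entry h.symm_k₁ (h.eigen_k₁ i' j) (h.eigen_k₁ i j) (h.k₁_l₂ (Ψ i j))
  rw [sinhq_band_diag hq0] at this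
  simp only [h.eigen_k₁, map_smul, inner_add_right, inner_sub_right, inner_smul_right] at this
  rw [facB, facD]
  have hs : (sinhq q 1 : ℂ) ≠ 0 := by exact_mod_cast sinhq_ne_zero hq0 hq1 one_ne_zero
  have e1 : (coshq q (2 * j + (α₀ - N₂) - 1) : ℂ) ≠ 0 := by exact_mod_cast (coshq_pos hq0 _).ne'
  have e2 : (coshq q (2 * j + (α₀ - N₂) + 1) : ℂ) ≠ 0 := by exact_mod_cast (coshq_pos hq0 _).ne'
  push_cast at this ⊢
  apply mul_left_cancel₀ (mul_ne_zero (pow_ne_zero 2 hs) (mul_ne_zero e1 e2))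
  rw [this]
  field_simp
  ring

/-- Within a column, `l₂` is proportional to `m₂` up to a diagonal term. -/
theorem l₂_entry_col (h : JointGrid q α₀ A₁ A₂ N₁ N₂ k₁ l₁ k₂ l₂ m₂ Ψ) (hq0 : 0 < q) (hq1 : q < 1)
    (i j j' : ℤ) : inner ℂ (Ψ i j') (l₂ (Ψ i j)) =
      (facD q A₁ A₂ (2 * i + (α₀ - N₁ - N₂)) : ℂ) * inner ℂ (Ψ i j') (m₂ (Ψ i j))
      + (facB q A₁ A₂ (2 * i + (α₀ - N₁ - N₂)) * sinhq q α₀ : ℝ) * inner ℂ (Ψ i j') (Ψ i j) := by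
  have := band_entry h.symm_k₂ (h.eigen_k₂ i j') (h.eigen_k₂ i j) (h.k₂_l₂ (Ψ i j))
  rw [sinhq_band_diag hq0] at this
  simp only [h.eigen_k₂, map_smul, inner_add_right, inner_sub_right, inner_smul_right] at this
  rw [facB, facD]
  have hs : (sinhq q 1 : ℂ) ≠ 0 := by exact_mod_cast sinhq_ne_zero hq0 hq1 one_ne_zero
  have e1 : (coshq q (2 * i + (α₀ - N₁ - N₂) - 1) : ℂ) ≠ 0 :=
    by exact_mod_cast (coshq_pos hq0 _).ne'
  have e2 : (coshq q (2 * i + (α₀ - N₁ - N₂) + 1) : ℂ) ≠ 0 :=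
    by exact_mod_cast (coshq_pos hq0 _).ne'
  push_cast at this ⊢
  apply mul_left_cancel₀ (mul_ne_zero (pow_ne_zero 2 hs) (mul_ne_zero e1 e2))
  rw [this]
  field_simp
  ring

theorem l₂_entry_eq_zero (h : JointGrid q α₀ A₁ A₂ N₁ N₂ k₁ l₁ k₂ l₂ m₂ Ψ) (hq0 : 0 < q)
    (hq1 : q < 1) {i j i' j' : ℤ} (hne : (i' ≠ i ∧ i' ≠ i - 1 ∧ i' ≠ i + 1) ∨ (j' ≠ j ∧ j' ≠ j - 1 ∧
    j' ≠ j + 1)) :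
    inner ℂ (Ψ i' j') (l₂ (Ψ i j)) = 0 := by
  rcases hne with ⟨h0, h1, h2⟩ | ⟨h0, h1, h2⟩
  · have := band_entry h.symm_k₂ (h.eigen_k₂ i' j') (h.eigen_k₂ i j) (h.k₂_l₂ (Ψ i j))
    simp only [h.eigen_k₂, map_smul, inner_add_right, inner_sub_right, inner_smul_right,
      h.m₂_entry_eq_zero hq0 hq1 h0, h.orth i' j' i j (Or.inl h0), mul_zero, add_zero, sub_zero]
        at this
    exact (mul_eq_zero.1 this).resolve_left
      (Complex.ofReal_ne_zero.2 (sinhq_band_ne_zero hq0 hq1 _ h0 h1 h2))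
  · have := band_entry h.symm_k₁ (h.eigen_k₁ i' j') (h.eigen_k₁ i j) (h.k₁_l₂ (Ψ i j))
    simp only [h.eigen_k₁, map_smul, inner_add_right, inner_sub_right, inner_smul_right,
      h.l₁_entry_eq_zero hq0 hq1 h0, h.orth i' j' i j (Or.inr h0), mul_zero, add_zero, sub_zero]
        at this
    exact (mul_eq_zero.1 this).resolve_left
      (Complex.ofReal_ne_zero.2 (sinhq_band_ne_zero hq0 hq1 _ h0 h1 h2))

end JointGrid

/-! ### Corner entries of `L₂` -/

namespace JointGrid
variable {E : Type*} [NormedAddCommGroup E] [InnerProductSpace ℂ E]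
    {q α₀ A₁ A₂ : ℝ} {N₁ N₂ : ℕ} {k₁ l₁ k₂ l₂ m₂ : Module.End ℂ E} {Ψ : ℤ → ℤ → E}

/-- The matrix entries of `l₁ l₂ = l₂ l₁`. -/
theorem l₁_l₂_entry (h : JointGrid q α₀ A₁ A₂ N₁ N₂ k₁ l₁ k₂ l₂ m₂ Ψ) (hq0 : 0 < q) (hq1 : q < 1)
    (i j p r : ℤ) :
    starRingEnd ℂ (inner ℂ (Ψ (p - 1) r) (l₁ (Ψ p r))) * inner ℂ (Ψ (p - 1) r) (l₂ (Ψ i j))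
      + (diagEntry q (sinhq q (2 * r + (α₀ - N₂))) A₁ A₂ (coshq q (N₁ + 1))
          (2 * p + (α₀ - N₁ - N₂)) : ℂ) * inner ℂ (Ψ p r) (l₂ (Ψ i j))
      + inner ℂ (Ψ p r) (l₁ (Ψ (p + 1) r)) * inner ℂ (Ψ (p + 1) r) (l₂ (Ψ i j)) =
    inner ℂ (Ψ (i - 1) j) (l₁ (Ψ i j)) * inner ℂ (Ψ p r) (l₂ (Ψ (i - 1) j))
      + (diagEntry q (sinhq q (2 * j + (α₀ - N₂))) A₁ A₂ (coshq q (N₁ + 1))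
          (2 * i + (α₀ - N₁ - N₂)) : ℂ) * inner ℂ (Ψ p r) (l₂ (Ψ i j))
      + starRingEnd ℂ (inner ℂ (Ψ i j) (l₁ (Ψ (i + 1) j))) * inner ℂ (Ψ p r)
        (l₂ (Ψ (i + 1) j)) := by
  have hc := congrArg (inner ℂ (Ψ p r)) (h.comm_l₁_l₂ (Ψ i j))
  rw [← h.symm_l₁, h.l₁_apply hq0 hq1 p r, h.l₁_apply hq0 hq1 i j] at hc
  simpa only [map_add, map_smul, inner_add_left, inner_add_right, inner_smul_left, inner_smul_right,
    Complex.conj_conj, Complex.conj_ofReal] using hc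

/-- The matrix entries of `m₂ l₂ = l₂ m₂`. -/
theorem m₂_l₂_entry (h : JointGrid q α₀ A₁ A₂ N₁ N₂ k₁ l₁ k₂ l₂ m₂ Ψ) (hq0 : 0 < q) (hq1 : q < 1)
    (i j p r : ℤ) :
    starRingEnd ℂ (inner ℂ (Ψ p (r - 1)) (m₂ (Ψ p r))) * inner ℂ (Ψ p (r - 1)) (l₂ (Ψ i j))
      + (diagEntry q (sinhq q α₀) (coshq q (N₁ + 1)) (-sinhq q (2 * p + (α₀ - N₁ - N₂)))
          (coshq q (N₂ + 1)) (2 * r + (α₀ - N₂)) : ℂ) * inner ℂ (Ψ p r) (l₂ (Ψ i j))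
      + inner ℂ (Ψ p r) (m₂ (Ψ p (r + 1))) * inner ℂ (Ψ p (r + 1)) (l₂ (Ψ i j)) =
    inner ℂ (Ψ i (j - 1)) (m₂ (Ψ i j)) * inner ℂ (Ψ p r) (l₂ (Ψ i (j - 1)))
      + (diagEntry q (sinhq q α₀) (coshq q (N₁ + 1)) (-sinhq q (2 * i + (α₀ - N₁ - N₂)))
          (coshq q (N₂ + 1)) (2 * j + (α₀ - N₂)) : ℂ) * inner ℂ (Ψ p r) (l₂ (Ψ i j))
      + starRingEnd ℂ (inner ℂ (Ψ i j) (m₂ (Ψ i (j + 1)))) * inner ℂ (Ψ p r)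
        (l₂ (Ψ i (j + 1))) := by
  have hc := congrArg (inner ℂ (Ψ p r)) (h.comm_m₂_l₂ (Ψ i j))
  rw [← h.symm_m₂, h.m₂_apply hq0 hq1 p r, h.m₂_apply hq0 hq1 i j] at hc
  simpa only [map_add, map_smul, inner_add_left, inner_add_right, inner_smul_left, inner_smul_right,
    Complex.conj_conj, Complex.conj_ofReal] using hc

theorem l₂_entry_row_of_ne (h : JointGrid q α₀ A₁ A₂ N₁ N₂ k₁ l₁ k₂ l₂ m₂ Ψ) (hq0 : 0 < q)
    (hq1 : q < 1) {i i' : ℤ} (hi : i' ≠ i) (j : ℤ) : inner ℂ (Ψ i' j) (l₂ (Ψ i j)) =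
      (facB q (sinhq q α₀) (coshq q (N₂ + 1)) (2 * j + (α₀ - N₂)) : ℂ) * inner ℂ (Ψ i' j)
        (l₁ (Ψ i j)) := by
  rw [h.l₂_entry_row hq0 hq1, h.orth _ _ _ _ (Or.inl hi), mul_zero, add_zero]

theorem l₂_entry_col_of_ne (h : JointGrid q α₀ A₁ A₂ N₁ N₂ k₁ l₁ k₂ l₂ m₂ Ψ) (hq0 : 0 < q)
    (hq1 : q < 1) (i : ℤ) {j j' : ℤ} (hj : j' ≠ j) : inner ℂ (Ψ i j') (l₂ (Ψ i j)) =
      (facD q A₁ A₂ (2 * i + (α₀ - N₁ - N₂)) : ℂ) * inner ℂ (Ψ i j') (m₂ (Ψ i j)) := by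
  rw [h.l₂_entry_col hq0 hq1, h.orth _ _ _ _ (Or.inr hj), mul_zero, add_zero]

/-- The corner entries of `l₂` (for `r = j ± 1`) from the entry of `l₁ l₂ = l₂ l₁` between opposite
corners of a square. -/
theorem l₂_corner_l₁ (h : JointGrid q α₀ A₁ A₂ N₁ N₂ k₁ l₁ k₂ l₂ m₂ Ψ) (hq0 : 0 < q) (hq1 : q < 1)
    (i : ℤ) {j r : ℤ} (hr : r ≠ j) :
    inner ℂ (Ψ (i - 1) r) (l₂ (Ψ i j)) *
      ((diagEntry q (sinhq q (2 * r + (α₀ - N₂))) A₁ A₂ (coshq q (N₁ + 1))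
          (2 * (i - 1 : ℤ) + (α₀ - N₁ - N₂)) -
        diagEntry q (sinhq q (2 * j + (α₀ - N₂))) A₁ A₂ (coshq q (N₁ + 1))
          (2 * i + (α₀ - N₁ - N₂)) : ℝ) : ℂ) =
    (facD q A₁ A₂ (2 * (i - 1 : ℤ) + (α₀ - N₁ - N₂)) : ℂ) *
        (inner ℂ (Ψ (i - 1) j) (l₁ (Ψ i j)) * inner ℂ (Ψ (i - 1) r) (m₂ (Ψ (i - 1) j)))
      - (facD q A₁ A₂ (2 * i + (α₀ - N₁ - N₂)) : ℂ) *
        (inner ℂ (Ψ (i - 1) r) (l₁ (Ψ i r)) * inner ℂ (Ψ i r) (m₂ (Ψ i j))) := by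
  have := h.l₁_l₂_entry hq0 hq1 i j (i - 1) r
  rw [h.l₂_entry_eq_zero hq0 hq1 (i := i) (i' := i - 1 - 1) (Or.inl (by omega)),
    h.l₂_entry_eq_zero hq0 hq1 (i := i + 1) (i' := i - 1) (Or.inl (by omega)),
    sub_add_cancel, h.l₂_entry_col_of_ne hq0 hq1 i hr, h.l₂_entry_col_of_ne hq0 hq1 (i - 1) hr]
      at this
  push_cast at this ⊢
  linear_combination this

/-- The counterpart of `l₂_corner_l₁` for `m₂ l₂ = l₂ m₂`. -/
theorem l₂_corner_m₂ (h : JointGrid q α₀ A₁ A₂ N₁ N₂ k₁ l₁ k₂ l₂ m₂ Ψ) (hq0 : 0 < q) (hq1 : q < 1)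
    (i j : ℤ) :
    inner ℂ (Ψ (i - 1) (j - 1)) (l₂ (Ψ i j)) *
      ((diagEntry q (sinhq q α₀) (coshq q (N₁ + 1)) (-sinhq q (2 * (i - 1 : ℤ) + (α₀ - N₁ - N₂)))
          (coshq q (N₂ + 1)) (2 * (j - 1 : ℤ) + (α₀ - N₂)) -
        diagEntry q (sinhq q α₀) (coshq q (N₁ + 1)) (-sinhq q (2 * i + (α₀ - N₁ - N₂)))
          (coshq q (N₂ + 1)) (2 * j + (α₀ - N₂)) : ℝ) : ℂ) =
    (facB q (sinhq q α₀) (coshq q (N₂ + 1)) (2 * (j - 1 : ℤ) + (α₀ - N₂)) : ℂ) *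
        (inner ℂ (Ψ (i - 1) (j - 1)) (l₁ (Ψ i (j - 1))) * inner ℂ (Ψ i (j - 1)) (m₂ (Ψ i j)))
      - (facB q (sinhq q α₀) (coshq q (N₂ + 1)) (2 * j + (α₀ - N₂)) : ℂ) *
        (inner ℂ (Ψ (i - 1) j) (l₁ (Ψ i j)) * inner ℂ (Ψ (i - 1) (j - 1)) (m₂ (Ψ (i - 1) j))) := by
  have := h.m₂_l₂_entry hq0 hq1 i j (i - 1) (j - 1)
  rw [h.l₂_entry_eq_zero hq0 hq1 (j := j) (j' := j - 1 - 1) (Or.inr (by omega)),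
    h.l₂_entry_eq_zero hq0 hq1 (j := j + 1) (j' := j - 1) (Or.inr (by omega)),
    sub_add_cancel, h.l₂_entry_row_of_ne hq0 hq1 (by omega : i - 1 ≠ i),
    h.l₂_entry_row_of_ne hq0 hq1 (by omega : i - 1 ≠ i)] at this
  push_cast at this ⊢
  linear_combination this

/-- The entry of `l₁ l₂ = l₂ l₁` between labels at distance two in the row direction relates the
corner entries of `l₂` in adjacent squares. -/
theorem l₂_corner_transport (h : JointGrid q α₀ A₁ A₂ N₁ N₂ k₁ l₁ k₂ l₂ m₂ Ψ) (hq0 : 0 < q)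
    (hq1 : q < 1) (i j : ℤ) :
    inner ℂ (Ψ (i - 1 - 1) (j - 1)) (l₁ (Ψ (i - 1) (j - 1))) * inner ℂ (Ψ (i - 1) (j - 1))
      (l₂ (Ψ i j)) =
    inner ℂ (Ψ (i - 1) j) (l₁ (Ψ i j)) * inner ℂ (Ψ (i - 1 - 1) (j - 1)) (l₂ (Ψ (i - 1) j)) := by
  have := h.l₁_l₂_entry hq0 hq1 i j (i - 1 - 1) (j - 1)
  rw [h.l₂_entry_eq_zero hq0 hq1 (i := i) (i' := i - 1 - 1) (Or.inl (by omega)),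
    h.l₂_entry_eq_zero hq0 hq1 (i := i) (i' := i - 1 - 1 - 1) (Or.inl (by omega)),
    h.l₂_entry_eq_zero hq0 hq1 (i := i + 1) (i' := i - 1 - 1) (Or.inl (by omega)), sub_add_cancel]
      at this
  linear_combination this

/-- The product of the entries of `l₁` and `m₂` along the path from `(i, j)` to `(i - 1, j - 1)`
which is horizontal first, plus a negative multiple (inside the grid) of the corner entry of `l₂`.
It turns out to vanish. -/
def defectHV (N₁ N₂ : ℕ) (q : ℝ) (l₁ l₂ m₂ : Module.End ℂ E) (Ψ : ℤ → ℤ → E) (i j : ℤ) : ℂ :=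
  inner ℂ (Ψ (i - 1) j) (l₁ (Ψ i j)) * inner ℂ (Ψ (i - 1) (j - 1)) (m₂ (Ψ (i - 1) j))
    + inner ℂ (Ψ (i - 1) (j - 1)) (l₂ (Ψ i j)) *
      ((coshq q (2 * (i - j : ℤ) - N₁ - 1) - coshq q (N₁ + 1) : ℝ) : ℂ)

/-- The analogue of `defectHV` for the path which is vertical first. -/
def defectVH (N₁ N₂ : ℕ) (q : ℝ) (l₁ l₂ m₂ : Module.End ℂ E) (Ψ : ℤ → ℤ → E) (i j : ℤ) : ℂ :=
  inner ℂ (Ψ (i - 1) (j - 1)) (l₁ (Ψ i (j - 1))) * inner ℂ (Ψ i (j - 1)) (m₂ (Ψ i j))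
    + inner ℂ (Ψ (i - 1) (j - 1)) (l₂ (Ψ i j)) *
      ((coshq q (2 * (i - j : ℤ) - N₁ + 1) - coshq q (N₁ + 1) : ℝ) : ℂ)

/-- The relation of `l₂_corner_l₁` in terms of the defects. -/
theorem defects_l₁ (h : JointGrid q α₀ A₁ A₂ N₁ N₂ k₁ l₁ k₂ l₂ m₂ Ψ) (hq0 : 0 < q) (hq1 : q < 1)
    (i j : ℤ) :
    (facD q A₁ A₂ (2 * (i - 1 : ℤ) + (α₀ - N₁ - N₂)) : ℂ) * defectHV N₁ N₂ q l₁ l₂ m₂ Ψ i j =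
    (facD q A₁ A₂ (2 * i + (α₀ - N₁ - N₂)) : ℂ) * defectVH N₁ N₂ q l₁ l₂ m₂ Ψ i j := by
  have h1 := h.l₂_corner_l₁ hq0 hq1 i (by omega : j - 1 ≠ j)
  have h2 := diag_l1_diff hq0 A₁ A₂ (coshq q (N₁ + 1)) (2 * i + (α₀ - N₁ - N₂)) (2 * j + (α₀ - N₂))
  rw [show (2 * j + (α₀ - N₂) - 2 : ℝ) = 2 * (j - 1 : ℤ) + (α₀ - N₂) by push_cast; ring,
    show (2 * i + (α₀ - N₁ - N₂) - 2 : ℝ) = 2 * (i - 1 : ℤ) + (α₀ - N₁ - N₂) by push_cast; ring]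
      at h2
  rw [h2] at h1
  rw [show (2 * i + (α₀ - N₁ - N₂) - (2 * j + (α₀ - N₂)) - 1 : ℝ) = 2 * (i - j : ℤ) - N₁ -
    1 by push_cast; ring, show (2 * i + (α₀ - N₁ - N₂) - (2 * j + (α₀ - N₂)) + 1 : ℝ) =
    2 * (i - j : ℤ) - N₁ + 1 by push_cast; ring] at h1
  rw [defectHV, defectVH]
  push_cast at h1 ⊢
  linear_combination -h1

/-- The relation of `l₂_corner_m₂` in terms of the defects. -/
theorem defects_m₂ (h : JointGrid q α₀ A₁ A₂ N₁ N₂ k₁ l₁ k₂ l₂ m₂ Ψ) (hq0 : 0 < q) (hq1 : q < 1)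
    (i j : ℤ) :
    (facB q (sinhq q α₀) (coshq q (N₂ + 1)) (2 * j + (α₀ - N₂)) : ℂ) *
      defectHV N₁ N₂ q l₁ l₂ m₂ Ψ i j =
    (facB q (sinhq q α₀) (coshq q (N₂ + 1)) (2 * (j - 1 : ℤ) + (α₀ - N₂)) : ℂ) *
      defectVH N₁ N₂ q l₁ l₂ m₂ Ψ i j := by
  have h1 := h.l₂_corner_m₂ hq0 hq1 i j
  have h2 := diag_m2_diff hq0 (sinhq q α₀) (coshq q (N₂ + 1)) (coshq q (N₁ + 1))
    (2 * i + (α₀ - N₁ - N₂)) (2 * j + (α₀ - N₂))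
  rw [show (2 * j + (α₀ - N₂) - 2 : ℝ) = 2 * (j - 1 : ℤ) + (α₀ - N₂) by push_cast; ring,
    show (2 * i + (α₀ - N₁ - N₂) - 2 : ℝ) = 2 * (i - 1 : ℤ) + (α₀ - N₁ - N₂) by push_cast; ring]
      at h2
  rw [h2] at h1
  rw [show (2 * i + (α₀ - N₁ - N₂) - (2 * j + (α₀ - N₂)) - 1 : ℝ) = 2 * (i - j : ℤ) - N₁ -
    1 by push_cast; ring, show (2 * i + (α₀ - N₁ - N₂) - (2 * j + (α₀ - N₂)) + 1 : ℝ) =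
    2 * (i - j : ℤ) - N₁ + 1 by push_cast; ring] at h1
  rw [defectHV, defectVH]
  push_cast at h1 ⊢
  linear_combination h1

/-- Adjacent squares in a row share the coefficient of the corner entry, so that
`l₂_corner_transport` carries the defects from one to the other. -/
theorem defects_transport (h : JointGrid q α₀ A₁ A₂ N₁ N₂ k₁ l₁ k₂ l₂ m₂ Ψ) (hq0 : 0 < q)
    (hq1 : q < 1) (i j : ℤ) :
    inner ℂ (Ψ (i - 1 - 1) (j - 1)) (l₁ (Ψ (i - 1) (j - 1))) * defectHV N₁ N₂ q l₁ l₂ m₂ Ψ i j =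
    inner ℂ (Ψ (i - 1) j) (l₁ (Ψ i j)) * defectVH N₁ N₂ q l₁ l₂ m₂ Ψ (i - 1) j := by
  have h1 := h.l₂_corner_transport hq0 hq1 i j
  rw [defectHV, defectVH, show (2 * (i - 1 - j : ℤ) - N₁ + 1 : ℝ) = 2 * (i - j : ℤ) - N₁ -
    1 by push_cast; ring]
  linear_combination ((coshq q (2 * (i - j : ℤ) - N₁ - 1) - coshq q (N₁ + 1) : ℝ) : ℂ) * h1

end JointGrid

/-! ### Positivity around plaquettes -/

/-- The factor of the squared entry of `l₁` which depends on the column only; the other factor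
vanishes at the ends of the rows only. -/
def columnFactor (A₁ A₂ t : ℝ) : ℝ := t ^ 2 - A₁ * A₂ * t + A₁ ^ 2 - A₂ ^ 2 + 4

/-- If `facD` vanishes at `x` and `columnFactor` has a root to the right of `x`, then
`columnFactor` is not positive to the left of `x`: of the roots `α₁ ± α₂`, the smaller one is at
most `x - 1`. -/
theorem columnFactor_nonpos_of_root_right {q : ℝ} (hq0 : 0 < q) (hq1 : q < 1) {α₁ α₂ x y : ℝ}
    (hx : facD q (sinhq q α₁) (coshq q α₂) x = 0) (hxy : x + 1 ≤ y)
    (hy : columnFactor (sinhq q α₁) (coshq q α₂) (sinhq q y) = 0) :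
    columnFactor (sinhq q α₁) (coshq q α₂) (sinhq q (x - 1)) ≤ 0 := by
  have hs := sinhq_strictAnti hq0 hq1
  have hx' : coshq q 1 * sinhq q α₁ - coshq q α₂ * sinhq q x = 0 := by
    rw [facD, div_eq_zero_iff] at hx
    exact hx.resolve_right (mul_pos (coshq_pos hq0 _) (coshq_pos hq0 _)).ne'
  -- Here `α₁ + a` is the root on the right, `a = ± α₂`, and `hx'` reads
  -- `sinh_q (x + a) + sinh_q (x - a) = sinh_q (α₁ + 1) + sinh_q (α₁ - 1)`.
  have main : ∀ a : ℝ, coshq q a = coshq q α₂ → y = α₁ + a →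
      columnFactor (sinhq q α₁) (coshq q α₂) (sinhq q (x - 1)) ≤ 0 := by
    rintro a ha rfl
    have e1 := sinhq_mul_coshq hq0 x a
    have e2 := sinhq_mul_coshq hq0 α₁ 1
    rw [ha] at e1
    have h1 : sinhq q (α₁ - 1) ≤ sinhq q (x - a) := hs.antitone (by linarith)
    have h2 : sinhq q (x + a) ≤ sinhq q (α₁ + 1) := by linarith
    have h3 : α₁ + 1 ≤ x + a := hs.le_iff_ge.1 h2
    rw [columnFactor, ← ha, quad_factor hq0]
    refine mul_nonpos_of_nonneg_of_nonpos (sub_nonneg.2 (hs.antitone (by linarith)))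
      (sub_nonpos.2 (hs.antitone (by linarith)))
  rw [columnFactor, quad_factor hq0, mul_eq_zero, sub_eq_zero, sub_eq_zero] at hy
  rcases hy with hy | hy
  · exact main α₂ rfl (hs.injective hy)
  · exact main (-α₂) (coshq_neg q α₂) (by rw [hs.injective hy]; ring)

/-- The mirror image of `columnFactor_nonpos_of_root_right`. -/
theorem columnFactor_nonpos_of_root_left {q : ℝ} (hq0 : 0 < q) (hq1 : q < 1) {α₁ α₂ x y : ℝ}
    (hx : facD q (sinhq q α₁) (coshq q α₂) x = 0) (hxy : y ≤ x - 1)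
    (hy : columnFactor (sinhq q α₁) (coshq q α₂) (sinhq q y) = 0) :
    columnFactor (sinhq q α₁) (coshq q α₂) (sinhq q (x + 1)) ≤ 0 := by
  have hneg : ∀ t, columnFactor (sinhq q (-α₁)) (coshq q α₂) (-t) = columnFactor (sinhq q α₁)
    (coshq q α₂) t := by
    intro t; rw [columnFactor, columnFactor, sinhq_neg]; ring
  have := columnFactor_nonpos_of_root_right hq0 hq1 (α₁ := -α₁) (α₂ := α₂) (x := -x)
    (y := -y) ?_ (by linarith) ?_
  · rwa [show -x - 1 = -(x + 1) by ring, sinhq_neg q (x + 1), hneg] at this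
  · rw [facD, div_eq_zero_iff] at hx ⊢
    left
    have := hx.resolve_right (mul_pos (coshq_pos hq0 _) (coshq_pos hq0 _)).ne'
    rw [sinhq_neg, sinhq_neg]
    linarith
  · rw [sinhq_neg q y, hneg]; exact hy

theorem columnFactor_neg_of_between {A₁ A₂ r t s : ℝ} (hr : columnFactor A₁ A₂ r = 0)
    (hs : columnFactor A₁ A₂ s = 0) (h1 : r < t) (h2 : t < s) : columnFactor A₁ A₂ t < 0 := by
  have h3 : (r - s) * (r + s - A₁ * A₂) = 0 := by
    rw [columnFactor] at hr hs
    linear_combination hr - hs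
  have h4 : r + s - A₁ * A₂ = 0 := (mul_eq_zero.1 h3).resolve_left (by linarith : r - s < 0).ne
  have h5 : columnFactor A₁ A₂ t = (t - r) * (t - s) := by
    rw [columnFactor] at hr ⊢; linear_combination hr + (t - r) * h4
  rw [h5]
  exact mul_neg_of_pos_of_neg (by linarith) (by linarith)

namespace JointGrid
variable {E : Type*} [NormedAddCommGroup E] [InnerProductSpace ℂ E]
    {q α₀ α₁ α₂ A₁ A₂ : ℝ} {N₁ N₂ : ℕ} {k₁ l₁ k₂ l₂ m₂ : Module.End ℂ E} {Ψ : ℤ → ℤ → E}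

/-- In the interior of a row, the squared entry of `l₁` is a positive multiple of `columnFactor`.
-/
theorem exists_normSq_l₁_eq (h : JointGrid q α₀ A₁ A₂ N₁ N₂ k₁ l₁ k₂ l₂ m₂ Ψ) (hq0 : 0 < q)
    (hq1 : q < 1) {i j : ℤ} (hj : 0 ≤ j ∧ j ≤ N₂) (h1 : j + 1 ≤ i) (h2 : i ≤ j + N₁) :
    ∃ κ > 0, Complex.normSq (inner ℂ (Ψ (i - 1) j) (l₁ (Ψ i j))) =
      κ * columnFactor A₁ A₂ (sinhq q (2 * i + (α₀ - N₁ - N₂) - 1)) := by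
  have hs := sinhq_strictAnti hq0 hq1
  have e : ∀ x, 0 < coshq q x := coshq_pos hq0
  have i1 : (j : ℝ) + 1 ≤ i := by exact_mod_cast h1
  have i2 : (i : ℝ) ≤ j + N₁ := by exact_mod_cast h2
  rw [h.normSq_l₁ hq0 hq1 hj (by omega) (by omega), offDiagSq, quad_factor hq0]
  set y : ℝ := 2 * i + (α₀ - N₁ - N₂)
  refine ⟨(sinhq q (y - 1) - sinhq q (2 * j + (α₀ - N₂) + (N₁ + 1))) *
    (sinhq q (2 * j + (α₀ - N₂) - (N₁ + 1)) - sinhq q (y - 1)) /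
    (coshq q (y - 1) ^ 2 * coshq q y * coshq q (y - 2)), ?_, ?_⟩
  · refine div_pos (mul_pos (sub_pos.2 (hs ?_)) (sub_pos.2 (hs ?_)))
      (mul_pos (mul_pos (pow_pos (e _) 2) (e _)) (e _))
    · simp only [y]; linarith
    · simp only [y]; linarith
  · rw [columnFactor]; ring

/-- Squared moduli are nonnegative: this is the constraint which the mere existence of the
representation puts on the parameters. -/
theorem columnFactor_nonneg (h : JointGrid q α₀ A₁ A₂ N₁ N₂ k₁ l₁ k₂ l₂ m₂ Ψ) (hq0 : 0 < q)
    (hq1 : q < 1) {i j : ℤ} (hj : 0 ≤ j ∧ j ≤ N₂) (h1 : j + 1 ≤ i) (h2 : i ≤ j + N₁) :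
    0 ≤ columnFactor A₁ A₂ (sinhq q (2 * i + (α₀ - N₁ - N₂) - 1)) := by
  obtain ⟨κ, hκ, hl⟩ := h.exists_normSq_l₁_eq hq0 hq1 hj h1 h2
  have := Complex.normSq_nonneg (inner ℂ (Ψ (i - 1) j) (l₁ (Ψ i j)))
  rw [hl] at this
  exact nonneg_of_mul_nonneg_right this hκ

theorem l₁_entry_ne_zero (h : JointGrid q α₀ A₁ A₂ N₁ N₂ k₁ l₁ k₂ l₂ m₂ Ψ) (hq0 : 0 < q)
    (hq1 : q < 1) {i j : ℤ} (hj : 0 ≤ j ∧ j ≤ N₂) (h1 : j + 1 ≤ i) (h2 : i ≤ j + N₁)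
    (hH : columnFactor A₁ A₂ (sinhq q (2 * i + (α₀ - N₁ - N₂) - 1)) ≠ 0) :
    inner ℂ (Ψ (i - 1) j) (l₁ (Ψ i j)) ≠ 0 := by
  obtain ⟨κ, hκ, hl⟩ := h.exists_normSq_l₁_eq hq0 hq1 hj h1 h2
  intro h0
  rw [h0, map_zero] at hl
  exact mul_ne_zero hκ.ne' hH hl.symm

theorem l₁_entry_eq_zero_of_columnFactor (h : JointGrid q α₀ A₁ A₂ N₁ N₂ k₁ l₁ k₂ l₂ m₂ Ψ)
    (hq0 : 0 < q) (hq1 : q < 1) {i j : ℤ} (hj : 0 ≤ j ∧ j ≤ N₂) (h1 : j + 1 ≤ i) (h2 : i ≤ j + N₁)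
    (hH : columnFactor A₁ A₂ (sinhq q (2 * i + (α₀ - N₁ - N₂) - 1)) = 0) :
    inner ℂ (Ψ (i - 1) j) (l₁ (Ψ i j)) = 0 := by
  obtain ⟨κ, hκ, hl⟩ := h.exists_normSq_l₁_eq hq0 hq1 hj h1 h2
  rwa [hH, mul_zero, Complex.normSq_eq_zero] at hl

/-- Propagation of the vanishing of the defects from the left end `i = j` of the squares between
the rows `j - 1` and `j`. -/
theorem defects_eq_zero_of_left (h : JointGrid q α₀ A₁ A₂ N₁ N₂ k₁ l₁ k₂ l₂ m₂ Ψ) (hq0 : 0 < q)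
    (hq1 : q < 1) {i j : ℤ} (hij : j ≤ i) (hBD : ∀ i' : ℤ, j ≤ i' → i' ≤ i →
      facB q (sinhq q α₀) (coshq q (N₂ + 1)) (2 * (j - 1 : ℤ) + (α₀ - N₂)) ≠ 0 ∨
      facD q A₁ A₂ (2 * i' + (α₀ - N₁ - N₂)) ≠ 0)
    (hl : ∀ i' : ℤ, j ≤ i' → i' < i → inner ℂ (Ψ (i' - 1) (j - 1)) (l₁ (Ψ i' (j - 1))) ≠ 0) :
    defectHV N₁ N₂ q l₁ l₂ m₂ Ψ i j = 0 ∧ defectVH N₁ N₂ q l₁ l₂ m₂ Ψ i j = 0 := by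
  have step : ∀ i' : ℤ, (facB q (sinhq q α₀) (coshq q (N₂ + 1)) (2 * (j - 1 : ℤ) + (α₀ - N₂)) ≠ 0 ∨
      facD q A₁ A₂ (2 * i' + (α₀ - N₁ - N₂)) ≠ 0) → defectHV N₁ N₂ q l₁ l₂ m₂ Ψ i' j = 0 →
      defectVH N₁ N₂ q l₁ l₂ m₂ Ψ i' j = 0 := by
    intro i' hi' hP
    rcases hi' with hi' | hi'
    · have := h.defects_m₂ hq0 hq1 i' j
      rw [hP, mul_zero] at this
      exact (mul_eq_zero.1 this.symm).resolve_left (Complex.ofReal_ne_zero.2 hi')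
    · have := h.defects_l₁ hq0 hq1 i' j
      rw [hP, mul_zero] at this
      exact (mul_eq_zero.1 this.symm).resolve_left (Complex.ofReal_ne_zero.2 hi')
  induction i, hij using Int.leInduction with
  | base =>
    have hP : defectHV N₁ N₂ q l₁ l₂ m₂ Ψ j j = 0 := by
      rw [defectHV, h.zero (j - 1) j (by omega), show (2 * (j - j : ℤ) - N₁ - 1 : ℝ) =
        -(N₁ + 1) by push_cast; ring, coshq_neg]
      simp
    exact ⟨hP, step j (hBD j le_rfl le_rfl) hP⟩
  | succ i hi ih =>
    obtain ⟨_, hR⟩ := ih (fun i' h1 h2 => hBD i' h1 (by omega))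
      (fun i' h1 h2 => hl i' h1 (by omega))
    have hP : defectHV N₁ N₂ q l₁ l₂ m₂ Ψ (i + 1) j = 0 := by
      have := h.defects_transport hq0 hq1 (i + 1) j
      rw [add_sub_cancel_right, hR, mul_zero] at this
      exact (mul_eq_zero.1 this).resolve_left (hl i hi (by omega))
    exact ⟨hP, step _ (hBD _ (by omega) le_rfl) hP⟩

/-- Propagation of the vanishing of the defects from the right end `i = j + N₁`. -/
theorem defects_eq_zero_of_right (h : JointGrid q α₀ A₁ A₂ N₁ N₂ k₁ l₁ k₂ l₂ m₂ Ψ) (hq0 : 0 < q)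
    (hq1 : q < 1) {i j : ℤ} (hij : i ≤ j + N₁) (hBD : ∀ i' : ℤ, i ≤ i' → i' ≤ j + N₁ →
      facB q (sinhq q α₀) (coshq q (N₂ + 1)) (2 * j + (α₀ - N₂)) ≠ 0 ∨
      facD q A₁ A₂ (2 * (i' - 1 : ℤ) + (α₀ - N₁ - N₂)) ≠ 0)
    (hl : ∀ i' : ℤ, i < i' → i' ≤ j + N₁ → inner ℂ (Ψ (i' - 1) j) (l₁ (Ψ i' j)) ≠ 0) :
    defectHV N₁ N₂ q l₁ l₂ m₂ Ψ i j = 0 ∧ defectVH N₁ N₂ q l₁ l₂ m₂ Ψ i j = 0 := by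
  have step : ∀ i' : ℤ, (facB q (sinhq q α₀) (coshq q (N₂ + 1)) (2 * j + (α₀ - N₂)) ≠ 0 ∨
      facD q A₁ A₂ (2 * (i' - 1 : ℤ) + (α₀ - N₁ - N₂)) ≠ 0) → defectVH N₁ N₂ q l₁ l₂ m₂ Ψ i' j = 0 →
      defectHV N₁ N₂ q l₁ l₂ m₂ Ψ i' j = 0 := by
    intro i' hi' hR
    rcases hi' with hi' | hi'
    · have := h.defects_m₂ hq0 hq1 i' j
      rw [hR, mul_zero] at this
      exact (mul_eq_zero.1 this).resolve_left (Complex.ofReal_ne_zero.2 hi')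
    · have := h.defects_l₁ hq0 hq1 i' j
      rw [hR, mul_zero] at this
      exact (mul_eq_zero.1 this).resolve_left (Complex.ofReal_ne_zero.2 hi')
  induction i, hij using Int.leInductionDown with
  | base =>
    have hR : defectVH N₁ N₂ q l₁ l₂ m₂ Ψ (j + N₁) j = 0 := by
      rw [defectVH, h.zero (j + N₁) (j - 1) (by omega),
        show (2 * (j + N₁ - j : ℤ) - N₁ + 1 : ℝ) = N₁ + 1 by push_cast; ring]
      simp
    exact ⟨step _ (hBD _ le_rfl le_rfl) hR, hR⟩
  | pred i hi ih =>
    obtain ⟨hP, _⟩ := ih (fun i' h1 h2 => hBD i' (by omega) h2)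
      (fun i' h1 h2 => hl i' (by omega) h2)
    have hR : defectVH N₁ N₂ q l₁ l₂ m₂ Ψ (i - 1) j = 0 := by
      have := h.defects_transport hq0 hq1 i j
      rw [hP, mul_zero] at this
      exact (mul_eq_zero.1 this.symm).resolve_left (hl i (by omega) hi)
    exact ⟨step _ (hBD _ le_rfl (by omega)) hR, hR⟩

/-- `facB` has at most one zero. -/
theorem facB_ne_zero_or {q : ℝ} (hq0 : 0 < q) (hq1 : q < 1) {A₀ A : ℝ} (hA : A ≠ 0) {x y : ℝ}
    (hxy : x ≠ y) :
    facB q A₀ A x ≠ 0 ∨ facB q A₀ A y ≠ 0 := by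
  by_contra hc
  push Not at hc
  have e : ∀ x, coshq q (x - 1) * coshq q (x + 1) ≠ 0 := fun x => (mul_pos (coshq_pos hq0 _)
    (coshq_pos hq0 _)).ne'
  have h1 := (div_eq_zero_iff.1 hc.1).resolve_right (e x)
  have h2 := (div_eq_zero_iff.1 hc.2).resolve_right (e y)
  have h3 : A₀ * (sinhq q x - sinhq q y) = 0 := by linear_combination h1 - h2
  have h4 : A₀ = 0 := (mul_eq_zero.1 h3).resolve_right
    (sub_ne_zero.2 fun hs => hxy ((sinhq_strictAnti hq0 hq1).injective hs))
  rw [h4, zero_mul, zero_add] at h1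
  exact mul_ne_zero (coshq_pos hq0 1).ne' hA h1

/-- The defects vanish at every square in which the entries of `l₁` do not. A zero of
`columnFactor` or a simultaneous zero of `facB` and `facD` blocks the propagation from one side,
but not from both: `columnFactor` is a nonnegative quadratic on the grid, with no two zeros that
enclose a label of the grid. -/
theorem defects_eq_zero (h : JointGrid q α₀ (sinhq q α₁) (coshq q α₂) N₁ N₂ k₁ l₁ k₂ l₂ m₂ Ψ)
    (hq0 : 0 < q) (hq1 : q < 1) {i j : ℤ} (hj : 1 ≤ j ∧ j ≤ N₂) (h1 : j + 1 ≤ i)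
    (h2 : i + 1 ≤ j + N₁) (hH : columnFactor (sinhq q α₁) (coshq q α₂)
    (sinhq q (2 * i + (α₀ - N₁ - N₂) - 1)) ≠ 0) :
    defectHV N₁ N₂ q l₁ l₂ m₂ Ψ i j = 0 ∧ defectVH N₁ N₂ q l₁ l₂ m₂ Ψ i j = 0 := by
  have hs := sinhq_strictAnti hq0 hq1
  set H : ℤ → ℝ := fun i => columnFactor (sinhq q α₁) (coshq q α₂)
    (sinhq q (2 * i + (α₀ - N₁ - N₂) - 1)) with hHdef
  have hlt : ∀ {a b : ℤ}, a < b → sinhq q (2 * b + (α₀ - N₁ - N₂) - 1) < sinhq q (2 * a +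
    (α₀ - N₁ - N₂) - 1) := by
    intro a b hab
    have : (a : ℝ) < b := by exact_mod_cast hab
    exact hs (by linarith)
  have hB := facB_ne_zero_or hq0 hq1 (A₀ := sinhq q α₀) (coshq_pos hq0 (N₂ + 1)).ne'
    (x := 2 * (j - 1 : ℤ) + (α₀ - N₂)) (y := 2 * j + (α₀ - N₂)) (by push_cast; linarith)
  have right_of_root : ∀ a b : ℤ, facD q (sinhq q α₁) (coshq q α₂) (2 * a + (α₀ - N₁ - N₂)) = 0 →
    a < b →
      H b = 0 → H a ≤ 0 := by
    intro a b hD hab hb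
    have : (a : ℝ) + 1 ≤ b := by exact_mod_cast hab
    exact columnFactor_nonpos_of_root_right hq0 hq1 hD (by linarith) hb
  have left_of_root : ∀ a b : ℤ, facD q (sinhq q α₁) (coshq q α₂)
    (2 * (a - 1 : ℤ) + (α₀ - N₁ - N₂)) = 0 → b < a →
      H b = 0 → H a ≤ 0 := by
    intro a b hD hab hb
    have h3 : (b : ℝ) + 1 ≤ a := by exact_mod_cast hab
    have := columnFactor_nonpos_of_root_left hq0 hq1 hD (by push_cast; linarith) hb
    rwa [show (2 * (a - 1 : ℤ) + (α₀ - N₁ - N₂) + 1 : ℝ) = 2 * a + (α₀ - N₁ - N₂) -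
      1 by push_cast; ring] at this
  have nonnegL : ∀ i' : ℤ, j ≤ i' → i' ≤ i → 0 ≤ H i' := fun i' h3 h4 =>
    h.columnFactor_nonneg hq0 hq1 (j := j - 1) (by omega) (by omega) (by omega)
  have nonnegR : ∀ i' : ℤ, i ≤ i' → i' ≤ j + N₁ → 0 ≤ H i' := fun i' h3 h4 =>
    h.columnFactor_nonneg hq0 hq1 (j := j) (by omega) (by omega) (by omega)
  -- Without zeros of `H` on the left, the left end serves as starting point unless `facB` and
  -- `facD` vanish together; then `facD = 0` excludes zeros of `H` on the right. With a zero on the left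
  -- there is none on the right, and `facB`, `facD` do not vanish together.
  by_cases hL : ∀ i' : ℤ, j ≤ i' → i' < i → H i' ≠ 0
  · have left := fun hBD => h.defects_eq_zero_of_left hq0 hq1 (i := i) (j := j) (by omega) hBD
      (fun i' h3 h4 => h.l₁_entry_ne_zero hq0 hq1 (by omega) (by omega) (by omega) (hL i' h3 h4))
    by_cases hc : ∀ i' : ℤ, j ≤ i' → i' ≤ i →
      facB q (sinhq q α₀) (coshq q (N₂ + 1)) (2 * (j - 1 : ℤ) + (α₀ - N₂)) ≠ 0 ∨
      facD q (sinhq q α₁) (coshq q α₂) (2 * i' + (α₀ - N₁ - N₂)) ≠ 0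
    · exact left hc
    · push Not at hc
      obtain ⟨i₀, h3, h4, hB0, hD0⟩ := hc
      have hi₀ : 0 < H i₀ := lt_of_le_of_ne (nonnegL i₀ h3 h4) (by
        rcases h4.lt_or_eq with h5 | h5
        · exact (hL i₀ h3 h5).symm
        · rw [h5]; exact hH.symm)
      refine h.defects_eq_zero_of_right hq0 hq1 (by omega)
        (fun _ _ _ => Or.inl (hB.resolve_left (not_not.2 hB0))) fun i' h5 h6 => ?_
      refine h.l₁_entry_ne_zero hq0 hq1 (by omega) (by omega) (by omega) fun hz => ?_
      exact absurd (right_of_root i₀ i' hD0 (by omega) hz) (not_le.2 hi₀)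
  · push Not at hL
    obtain ⟨iL, h3, h4, hiL⟩ := hL
    have hR : ∀ i' : ℤ, i < i' → i' ≤ j + N₁ → H i' ≠ 0 := by
      intro i' h5 h6 hz
      exact absurd (columnFactor_neg_of_between hz hiL (hlt h5) (hlt h4))
        (not_lt.2 (nonnegL i (by omega) le_rfl))
    refine h.defects_eq_zero_of_right hq0 hq1 (by omega) ?_ fun i' h5 h6 =>
      h.l₁_entry_ne_zero hq0 hq1 (by omega) (by omega) (by omega) (hR i' h5 h6)
    intro i' h5 h6
    by_contra hc
    push Not at hc
    have hi' : 0 < H i' := lt_of_le_of_ne (nonnegR i' h5 h6) (by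
        rcases h5.lt_or_eq with h7 | h7
        · exact (hR i' h7 h6).symm
        · rw [← h7]; exact hH.symm)
    exact absurd (left_of_root i' iL hc.2 (by omega) hiL) (not_le.2 hi')

/-- The two products of entries of `l₁` and `m₂` along the paths from `(i, j)` to `(i - 1, j - 1)`
have the same phase. -/
theorem exists_plaquette (h : JointGrid q α₀ (sinhq q α₁) (coshq q α₂) N₁ N₂ k₁ l₁ k₂ l₂ m₂ Ψ)
    (hq0 : 0 < q) (hq1 : q < 1) {i j : ℤ} (hj : 1 ≤ j ∧ j ≤ N₂) (h1 : j + 1 ≤ i)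
    (h2 : i + 1 ≤ j + N₁) :
    ∃ κ : ℝ, 0 < κ ∧
      inner ℂ (Ψ (i - 1) j) (l₁ (Ψ i j)) * inner ℂ (Ψ (i - 1) (j - 1)) (m₂ (Ψ (i - 1) j)) =
      (κ : ℂ) * (inner ℂ (Ψ (i - 1) (j - 1)) (l₁ (Ψ i (j - 1))) * inner ℂ (Ψ i (j - 1))
        (m₂ (Ψ i j))) := by
  have hs := sinhq_strictAnti hq0 hq1
  have h0 : sinhq q 0 = 0 := by simp [sinhq]
  have i1 : (j : ℝ) + 1 ≤ i := by exact_mod_cast h1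
  have i2 : (i : ℝ) + 1 ≤ j + N₁ := by exact_mod_cast h2
  have neg : ∀ x : ℝ, 0 < x → sinhq q x < 0 := fun x hx => h0 ▸ hs hx
  have pos : ∀ x : ℝ, x < 0 → 0 < sinhq q x := fun x hx => by have := hs hx; rwa [h0] at this
  have e1 : coshq q (2 * (i - j : ℤ) - N₁ + 1) - coshq q (N₁ + 1) < 0 := by
    have := sinhq_mul_sinhq hq0 ((i : ℝ) - j + 1) (i - j - N₁)
    rw [show ((i : ℝ) - j + 1) + (i - j - N₁) = 2 * (i - j : ℤ) - N₁ + 1 by push_cast; ring,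
      show ((i : ℝ) - j + 1) - (i - j - N₁) = N₁ + 1 by ring] at this
    rw [← this]
    exact mul_neg_of_neg_of_pos (neg _ (by linarith)) (pos _ (by linarith))
  have e2 : coshq q (2 * (i - j : ℤ) - N₁ - 1) - coshq q (N₁ + 1) < 0 := by
    have := sinhq_mul_sinhq hq0 ((i : ℝ) - j) (i - j - N₁ - 1)
    rw [show ((i : ℝ) - j) + (i - j - N₁ - 1) = 2 * (i - j : ℤ) - N₁ - 1 by push_cast; ring,
      show ((i : ℝ) - j) - (i - j - N₁ - 1) = N₁ + 1 by ring] at this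
    rw [← this]
    exact mul_neg_of_neg_of_pos (neg _ (by linarith)) (pos _ (by linarith))
  refine ⟨_, div_pos_of_neg_of_neg e2 e1, ?_⟩
  by_cases hH : columnFactor (sinhq q α₁) (coshq q α₂) (sinhq q (2 * i + (α₀ - N₁ - N₂) - 1)) = 0
  · rw [h.l₁_entry_eq_zero_of_columnFactor hq0 hq1 (by omega) (by omega) (by omega) hH,
      h.l₁_entry_eq_zero_of_columnFactor hq0 hq1 (j := j - 1) (by omega) (by omega) (by omega) hH]
    simp
  · obtain ⟨hP, hR⟩ := h.defects_eq_zero hq0 hq1 hj h1 h2 hH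
    rw [defectHV] at hP
    rw [defectVH] at hR
    have e1' := Complex.ofReal_ne_zero.2 e1.ne
    rw [Complex.ofReal_div, div_mul_eq_mul_div, eq_div_iff e1']
    linear_combination ((coshq q (2 * (i - j : ℤ) - N₁ + 1) - coshq q (N₁ + 1) : ℝ) : ℂ) * hP
      - ((coshq q (2 * (i - j : ℤ) - N₁ - 1) - coshq q (N₁ + 1) : ℝ) : ℂ) * hR

end JointGrid

/-! ### Choice of phases -/

/-- The weights `f j` on the edges `(j - 1, j)` of a path can be made nonnegative by unit phases at
its vertices. -/
theorem exists_phases (f : ℤ → ℂ) (hf : ∀ j ≤ 0, f j = 0) :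
    ∃ u : ℤ → ℂ, (∀ j, starRingEnd ℂ (u j) * u j = 1) ∧
      ∀ j, 0 ≤ starRingEnd ℂ (u (j - 1)) * u j * f j := by
  have key : ∀ z : ℂ, ∃ s : ℂ, starRingEnd ℂ s * s = 1 ∧ 0 ≤ s * z := by
    intro z
    by_cases hz : z = 0
    · exact ⟨1, by simp, by simp [hz]⟩
    · have hn : (‖z‖ : ℂ) ≠ 0 := by simpa using hz
      refine ⟨starRingEnd ℂ z / ‖z‖, ?_, ?_⟩
      · rw [map_div₀, Complex.conj_conj, Complex.conj_ofReal, div_mul_div_comm, Complex.mul_conj',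
          sq, div_self (mul_ne_zero hn hn)]
      · rw [div_mul_eq_mul_div, Complex.conj_mul', sq, mul_div_assoc, div_self hn, mul_one]
        exact Complex.zero_le_real.2 (norm_nonneg z)
  choose s hs hs' using key
  let g : ℕ → ℂ := fun n => Nat.rec 1 (fun n g => g * s (f ((n : ℤ) + 1))) n
  have hg : ∀ n, starRingEnd ℂ (g n) * g n = 1 := by
    intro n
    induction n with
    | zero => simp [g]
    | succ n ih =>
      have : g (n + 1) = g n * s (f ((n : ℤ) + 1)) := rfl
      rw [this, map_mul]
      linear_combination starRingEnd ℂ (s (f ((n : ℤ) + 1))) * s (f ((n : ℤ) + 1)) * ih +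
        hs (f ((n : ℤ) + 1))
  refine ⟨fun j => g j.toNat, fun j => hg _, fun j => ?_⟩
  rcases le_or_gt j 0 with hj | hj
  · simp [hf j hj]
  · obtain ⟨n, rfl⟩ : ∃ n : ℕ, j = (n : ℤ) + 1 := ⟨(j - 1).toNat, by omega⟩
    have e1 : ((n : ℤ) + 1 - 1).toNat = n := by omega
    have e2 : ((n : ℤ) + 1).toNat = n + 1 := by omega
    have e3 : g (n + 1) = g n * s (f ((n : ℤ) + 1)) := rfl
    dsimp only
    rw [e1, e2, e3, ← mul_assoc, hg, one_mul]
    exact hs' _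

/-- If the horizontal weights `l` and the vertical weights `m` of the grid have the same phase
along the two paths of each square, and the vertical ones do not vanish, then unit phases at the
vertices make all of them nonnegative. -/
theorem exists_grid_phases (N₁ N₂ : ℕ) (l m : ℤ → ℤ → ℂ)
    (hl : ∀ i j, ¬ (InRange N₁ N₂ i j ∧ InRange N₁ N₂ (i - 1) j) → l i j = 0)
    (hm : ∀ i j, ¬ (InRange N₁ N₂ i j ∧ InRange N₁ N₂ i (j - 1)) → m i j = 0)
    (hm' : ∀ i j, InRange N₁ N₂ i j → InRange N₁ N₂ i (j - 1) → m i j ≠ 0)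
    (hp : ∀ i j : ℤ, 1 ≤ j ∧ j ≤ N₂ → j + 1 ≤ i → i + 1 ≤ j + N₁ →
      ∃ κ : ℝ, 0 < κ ∧ l i j * m (i - 1) j = κ * (l i (j - 1) * m i j)) :
    ∃ u : ℤ → ℤ → ℂ, (∀ i j, starRingEnd ℂ (u i j) * u i j = 1) ∧
      (∀ i j, 0 ≤ starRingEnd ℂ (u (i - 1) j) * u i j * l i j) ∧
      (∀ i j, 0 ≤ starRingEnd ℂ (u i (j - 1)) * u i j * m i j) := by
  choose u hu hum using fun i => exists_phases (m i) (fun j hj => hm i j (by omega))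
  set l' : ℤ → ℤ → ℂ := fun i j => starRingEnd ℂ (u (i - 1) j) * u i j * l i j with hl'
  set m' : ℤ → ℤ → ℂ := fun i j => starRingEnd ℂ (u i (j - 1)) * u i j * m i j with hm'd
  have hune : ∀ i j, u i j ≠ 0 := fun i j h0 => by simpa [h0] using hu i j
  have hm'pos : ∀ i j, InRange N₁ N₂ i j → InRange N₁ N₂ i (j - 1) → 0 < m' i j := by
    intro i j h1 h2
    refine lt_of_le_of_ne (hum i j) (Ne.symm ?_)
    refine mul_ne_zero (mul_ne_zero ?_ (hune _ _)) (hm' i j h1 h2)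
    simpa using hune i (j - 1)
  have hp' : ∀ i j : ℤ, 1 ≤ j ∧ j ≤ N₂ → j + 1 ≤ i → i + 1 ≤ j + N₁ →
      ∃ r : ℝ, 0 ≤ r ∧ l' i j = r * l' i (j - 1) := by
    intro i j h0 h1 h2
    obtain ⟨κ, hκ, h⟩ := hp i j h0 h1 h2
    have p1 := hm'pos (i - 1) j (by omega) (by omega)
    have p2 := hm'pos i j (by omega) (by omega)
    obtain ⟨x, hx, hx'⟩ : ∃ x : ℝ, 0 < x ∧ (x : ℂ) = m' (i - 1) j :=
      ⟨_, (Complex.pos_iff.1 p1).1, Complex.ext rfl (Complex.pos_iff.1 p1).2⟩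
    obtain ⟨y, hy, hy'⟩ : ∃ y : ℝ, 0 < y ∧ (y : ℂ) = m' i j :=
      ⟨_, (Complex.pos_iff.1 p2).1, Complex.ext rfl (Complex.pos_iff.1 p2).2⟩
    refine ⟨κ * y / x, by positivity, ?_⟩
    have e : l' i j * m' (i - 1) j = κ * (l' i (j - 1) * m' i j) := by
      simp only [hl', hm'd]
      linear_combination (u i j * starRingEnd ℂ (u (i - 1) (j - 1))) * h
        + (u i j * starRingEnd ℂ (u (i - 1) (j - 1)) * l i j * m (i - 1) j) * hu (i - 1) j
        - (u i j * starRingEnd ℂ (u (i - 1) (j - 1)) * κ * l i (j - 1) * m i j) * hu i (j - 1)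
    rw [← hx', ← hy'] at e
    have hx0 : (x : ℂ) ≠ 0 := Complex.ofReal_ne_zero.2 hx.ne'
    push_cast
    field_simp
    linear_combination e
  -- Once the vertical weights are nonnegative, the horizontal ones between two columns share
  -- a phase, which a single phase per column removes.
  have hcol : ∀ i j : ℤ, ∃ r : ℝ, 0 ≤ r ∧ l' i j = r * l' i (max 0 (i - N₁)) := by
    intro i j
    by_cases hj : InRange N₁ N₂ i j ∧ InRange N₁ N₂ (i - 1) j
    · obtain ⟨h1, h2⟩ := hj
      have h3 : j ≤ min (N₂ : ℤ) (i - 1) := by omega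
      have h4 : max 0 (i - N₁) ≤ j := by omega
      clear h1 h2
      induction j, h4 using Int.leInduction with
      | base => exact ⟨1, zero_le_one, by simp⟩
      | succ j hj ih =>
        obtain ⟨r, hr, e⟩ := ih (by omega)
        obtain ⟨r', hr', e'⟩ := hp' i (j + 1) (by omega) (by omega) (by omega)
        refine ⟨r' * r, mul_nonneg hr' hr, ?_⟩
        rw [e', add_sub_cancel_right, e]
        push_cast; ring
    · exact ⟨0, le_rfl, by simp [hl', hl i j hj]⟩
  obtain ⟨v, hv, hvl⟩ := exists_phases (fun i => l' i (max 0 (i - N₁))) (fun i hi => by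
    simp [hl', hl i (max 0 (i - N₁)) (by omega)])
  refine ⟨fun i j => v i * u i j, fun i j => ?_, fun i j => ?_, fun i j => ?_⟩
  · rw [map_mul]; linear_combination starRingEnd ℂ (u i j) * u i j * hv i + hu i j
  · obtain ⟨r, hr, e⟩ := hcol i j
    have : starRingEnd ℂ (v (i - 1) * u (i - 1) j) * (v i * u i j) * l i j =
        r * (starRingEnd ℂ (v (i - 1)) * v i * l' i (max 0 (i - N₁))) := by
      rw [map_mul]
      simp only [hl'] at e ⊢
      linear_combination (starRingEnd ℂ (v (i - 1)) * v i) * e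
    rw [this]
    exact mul_nonneg (Complex.zero_le_real.2 hr) (hvl i)
  · have : starRingEnd ℂ (v i * u i (j - 1)) * (v i * u i j) * m i j =
        starRingEnd ℂ (u i (j - 1)) * u i j * m i j := by
      rw [map_mul]
      linear_combination (starRingEnd ℂ (u i (j - 1)) * u i j * m i j) * hv i
    rw [this]
    exact hum i j

theorem inner_smul_smul {E : Type*} [NormedAddCommGroup E] [InnerProductSpace ℂ E] (a b : ℂ)
    (x y : E) :
    inner ℂ (a • x) (b • y) = starRingEnd ℂ a * b * inner ℂ x y := by
  rw [inner_smul_left, inner_smul_right, mul_assoc]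

theorem _root_.Orthonormal.exists_orthonormalBasis {ι V : Type*}
    [Fintype ι] [Nonempty ι] [NormedAddCommGroup V]
    [InnerProductSpace ℂ V] {v : ι → V} (hv : Orthonormal ℂ v)
    (hc : Fintype.card ι = Module.finrank ℂ V) : ∃ b : OrthonormalBasis ι ℂ V, ⇑b = v := by
  exact ⟨(basisOfOrthonormalOfCardEqFinrank hv hc).toOrthonormalBasis (by simpa using hv), by simp⟩

section
variable {V₁ V₂ : Type*} [NormedAddCommGroup V₁] [InnerProductSpace ℂ V₁]
  [NormedAddCommGroup V₂] [InnerProductSpace ℂ V₂] {N₁ N₂ : ℕ}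

/-- A change of the phases of joint vectors comes from a change of the orthonormal bases of `V₁`.
-/
theorem exists_rescaled_jointVec (ψ₂ : OrthonormalBasis (Fin (N₂ + 1)) ℂ V₂)
    (ψ₁ : Fin (N₂ + 1) → OrthonormalBasis (Fin (N₁ + 1)) ℂ V₁) {u : ℤ → ℤ → ℂ}
    (hu : ∀ i j, starRingEnd ℂ (u i j) * u i j = 1) :
    ∃ ψ₁' : Fin (N₂ + 1) → OrthonormalBasis (Fin (N₁ + 1)) ℂ V₁,
      ∀ i j, jointVec ψ₂ ψ₁' i j = u i j • jointVec ψ₂ ψ₁ i j := by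
  have : ∀ k : Fin (N₂ + 1), ∃ b : OrthonormalBasis (Fin (N₁ + 1)) ℂ V₁,
      ⇑b = fun i : Fin (N₁ + 1) => u ((k : ℤ) + i) k • ψ₁ k i := by
    intro k
    refine Orthonormal.exists_orthonormalBasis ?_ (Module.finrank_eq_card_basis (ψ₁ k).toBasis).symm
    rw [orthonormal_iff_ite]
    intro a b
    rw [inner_smul_left, inner_smul_right, orthonormal_iff_ite.1 (ψ₁ k).orthonormal]
    split_ifs with hab
    · subst hab; rw [mul_one, hu]
    · simp
  choose ψ₁' hψ using this
  refine ⟨ψ₁', fun i j => ?_⟩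
  by_cases hr : InRange N₁ N₂ i j
  · rw [jointVec, jointVec, dif_pos hr, dif_pos hr, hψ, TensorProduct.smul_tmul']
    have e1 : ((j.toNat : ℕ) : ℤ) = j := by omega
    have e2 : ((i - j).toNat : ℤ) = i - j := by omega
    simp only [e1, e2, add_sub_cancel]
  · rw [jointVec, jointVec, dif_neg hr, dif_neg hr, smul_zero]

/-- The phases of any joint eigenbasis can be normalized. -/
theorem JointGrid.exists_isJointEigenbasis {q α₀ α₁ α₂ : ℝ}
    {k₁ l₁ k₂ l₂ m₂ : Module.End ℂ (V₁ ⊗[ℂ] V₂)}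
    (ψ₂ : OrthonormalBasis (Fin (N₂ + 1)) ℂ V₂)
    (ψ₁ : Fin (N₂ + 1) → OrthonormalBasis (Fin (N₁ + 1)) ℂ V₁)
    (h : JointGrid q α₀ (sinhq q α₁) (coshq q α₂) N₁ N₂ k₁ l₁ k₂ l₂ m₂ (jointVec ψ₂ ψ₁))
    (hq0 : 0 < q) (hq1 : q < 1) :
    ∃ ψ₁' : Fin (N₂ + 1) → OrthonormalBasis (Fin (N₁ + 1)) ℂ V₁,
      IsJointEigenbasis q α₀ k₁ l₁ k₂ m₂ ψ₂ ψ₁' := by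
  obtain ⟨u, hu, hul, hum⟩ := exists_grid_phases N₁ N₂
    (fun i j => inner ℂ (jointVec ψ₂ ψ₁ (i - 1) j) (l₁ (jointVec ψ₂ ψ₁ i j)))
    (fun i j => inner ℂ (jointVec ψ₂ ψ₁ i (j - 1)) (m₂ (jointVec ψ₂ ψ₁ i j)))
    (fun i j hij => by
      rcases not_and_or.1 hij with hh | hh
      · simp only [h.zero _ _ hh, map_zero, inner_zero_right]
      · simp only [h.zero _ _ hh, inner_zero_left])
    (fun i j hij => by
      rcases not_and_or.1 hij with hh | hh
      · simp only [h.zero _ _ hh, map_zero, inner_zero_right]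
      · simp only [h.zero _ _ hh, inner_zero_left])
    (fun i j h1 h2 => h.m₂_entry_ne_zero hq0 hq1 h1 h2)
    (fun i j h0 h1 h2 => h.exists_plaquette hq0 hq1 h0 h1 h2)
  obtain ⟨ψ₁', hψ⟩ := exists_rescaled_jointVec ψ₂ ψ₁ hu
  refine ⟨ψ₁', ?_, ?_, ?_, ?_⟩
  · intro i j
    rw [hψ, map_smul, h.eigen_k₁, smul_comm, eig, lab₂]
    congr 3; ring_nf
  · intro i j
    rw [hψ, map_smul, h.eigen_k₂, smul_comm, eig, lab₁]
    congr 3; ring_nf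
  · intro i j
    rw [hψ, hψ, map_smul]
    exact (hul i j).trans_eq (inner_smul_smul (E := V₁ ⊗[ℂ] V₂) (u (i - 1) j) (u i j) _ _).symm
  · intro i j
    rw [hψ, hψ, map_smul]
    exact (hum i j).trans_eq (inner_smul_smul (E := V₁ ⊗[ℂ] V₂) (u i (j - 1)) (u i j) _ _).symm

end

/-! ### From representations to operator identities -/

section
variable {A B : Type*} [Ring A] [Algebra ℂ A] [Ring B] [Algebra ℂ B]

theorem map_const (f : A →ₐ[ℂ] B) (r : ℝ) : f (const A r) = const B r := f.commutes _

theorem map_awMap_fst (f : A →ₐ[ℂ] B) (q : ℝ) (K L A₀ A₁ A₂ A₃ A₄ A₅ : A) :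
    f (awMap q K L A₀ A₁ A₂ A₃ A₄ A₅).1 =
      (awMap q (f K) (f L) (f A₀) (f A₁) (f A₂) (f A₃) (f A₄) (f A₅)).1 := by
  simp only [awMap, map_sub, map_add, map_smul, map_mul, map_pow]

theorem map_awMap_snd (f : A →ₐ[ℂ] B) (q : ℝ) (K L A₀ A₁ A₂ A₃ A₄ A₅ : A) :
    f (awMap q K L A₀ A₁ A₂ A₃ A₄ A₅).2 =
      (awMap q (f K) (f L) (f A₀) (f A₁) (f A₂) (f A₃) (f A₄) (f A₅)).2 := by
  simp only [awMap, map_sub, map_add, map_smul, map_mul, map_pow]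

end

section
variable {E : Type*} [NormedAddCommGroup E] [InnerProductSpace ℂ E]

theorem const_end_apply (r : ℝ) (v : E) : const (Module.End ℂ E) r v = (r : ℂ) • v := rfl

theorem awMap_fst_apply (q : ℝ) (K L A₀ A₁ A₂ A₃ A₄ A₅ : Module.End ℂ E) (v : E) :
    (awMap q K L A₀ A₁ A₂ A₃ A₄ A₅).1 v =
      ((coshq q 2 : ℂ) • K (L (K v)) - K (K (L v)) - L (K (K v)))
      - (((sinhq q 1 ^ 2 : ℝ) : ℂ) • (A₀ (A₁ (K v)) - A₂ (A₃ (K v)))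
          - ((coshq q 1 ^ 2 : ℝ) : ℂ) • A₅ (L v)
          + (coshq q 1 : ℂ) • (A₁ (A₃ (A₅ v)) + ((sinhq q 1 ^ 2 : ℝ) : ℂ) • A₀ (A₂ v))) := rfl

theorem awMap_snd_apply (q : ℝ) (K L A₀ A₁ A₂ A₃ A₄ A₅ : Module.End ℂ E) (v : E) :
    (awMap q K L A₀ A₁ A₂ A₃ A₄ A₅).2 v =
      ((coshq q 2 : ℂ) • L (K (L v)) - L (L (K v)) - K (L (L v)))
      - (((sinhq q 1 ^ 2 : ℝ) : ℂ) • (A₀ (A₁ (L v)) - A₂ (A₃ (L v)))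
          - ((coshq q 1 ^ 2 : ℝ) : ℂ) • A₄ (K v)
          + (coshq q 1 : ℂ) • (A₀ (A₃ (A₄ v)) + ((sinhq q 1 ^ 2 : ℝ) : ℂ) • A₁ (A₂ v))) := rfl

/-- A representation of the rank two algebra gives operators with the relations of `Pentagon`. -/
theorem AW2.pentagon {q A₀ A₁ A₂ AN₁ AN₂ : ℝ}
    (ρ : AW2 q A₀ A₁ A₂ AN₁ AN₂ (sinhq q 1 ^ 2) (sinhq q 1 ^ 2) →ₐ[ℂ] Module.End ℂ E)
    (hk₁ : (ρ (AW2.gen q A₀ A₁ A₂ AN₁ AN₂ _ _ .K1r)).IsSymmetric)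
    (hl₁ : (ρ (AW2.gen q A₀ A₁ A₂ AN₁ AN₂ _ _ .L1l)).IsSymmetric)
    (hk₂ : (ρ (AW2.gen q A₀ A₁ A₂ AN₁ AN₂ _ _ .K2)).IsSymmetric)
    (hl₂ : (ρ (AW2.gen q A₀ A₁ A₂ AN₁ AN₂ _ _ .L2)).IsSymmetric)
    (hm₂ : (ρ (AW2.gen q A₀ A₁ A₂ AN₁ AN₂ _ _ .M2)).IsSymmetric) :
    Pentagon q A₀ A₁ A₂ AN₁ AN₂ (ρ (AW2.gen q A₀ A₁ A₂ AN₁ AN₂ _ _ .K1r))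
      (ρ (AW2.gen q A₀ A₁ A₂ AN₁ AN₂ _ _ .L1l)) (ρ (AW2.gen q A₀ A₁ A₂ AN₁ AN₂ _ _ .K2))
      (ρ (AW2.gen q A₀ A₁ A₂ AN₁ AN₂ _ _ .L2)) (ρ (AW2.gen q A₀ A₁ A₂ AN₁ AN₂ _ _ .M2)) := by
  set f := ρ.comp (RingQuot.mkAlgHom ℂ (AW2Rel q A₀ A₁ A₂ AN₁ AN₂ (sinhq q 1 ^ 2) (sinhq q 1 ^ 2)))
    with hf
  have hx : ∀ g : AW2Gen, ρ (AW2.gen q A₀ A₁ A₂ AN₁ AN₂ _ _ g) = f g.x := fun g => rfl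
  have hc : ∀ r, f (cst r) = const (Module.End ℂ E) r := fun r => map_const f r
  have hrel : ∀ {x y}, AW2Rel q A₀ A₁ A₂ AN₁ AN₂ (sinhq q 1 ^ 2) (sinhq q 1 ^ 2) x y → f x = f y :=
    fun h => congrArg ρ (RingQuot.mkAlgHom_rel ℂ h)
  have comm : ∀ {g h : AW2Gen}, AW2Comm g h → ∀ v, f g.x (f h.x v) = f h.x (f g.x v) := by
    intro g h hgh v
    have := DFunLike.congr_fun (hrel (AW2Rel.comm g h hgh)) v
    rwa [map_mul, map_mul] at this
  have fst : ∀ {K L B₀ B₁ B₂ B₃ B₄ B₅}, AW2Rows A₀ A₁ A₂ AN₁ AN₂ (sinhq q 1 ^ 2) (sinhq q 1 ^ 2)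
      (sinhq q 1 ^ 2) K L B₀ B₁ B₂ B₃ B₄ B₅ → ∀ v,
      (awMap q (f K) (f L) (f B₀) (f B₁) (f B₂) (f B₃) (f B₄) (f B₅)).1 v = 0 := by
    intro K L B₀ B₁ B₂ B₃ B₄ B₅ h v
    rw [← map_awMap_fst, hrel (AW2Rel.fst _ _ _ _ _ _ _ _ h), map_zero, LinearMap.zero_apply]
  have snd : ∀ {K L B₀ B₁ B₂ B₃ B₄ B₅}, AW2Rows A₀ A₁ A₂ AN₁ AN₂ (sinhq q 1 ^ 2) (sinhq q 1 ^ 2)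
      (sinhq q 1 ^ 2) K L B₀ B₁ B₂ B₃ B₄ B₅ → ∀ v,
      (awMap q (f K) (f L) (f B₀) (f B₁) (f B₂) (f B₃) (f B₄) (f B₅)).2 v = 0 := by
    intro K L B₀ B₁ B₂ B₃ B₄ B₅ h v
    rw [← map_awMap_snd, hrel (AW2Rel.snd _ _ _ _ _ _ _ _ h), map_zero, LinearMap.zero_apply]
  simp only [hx] at hk₁ hl₁ hk₂ hl₂ hm₂ ⊢
  refine ⟨hk₁, hl₁, hk₂, hl₂, hm₂, comm .K1r_K2, fun v => (comm .L1l_K1r v).symm,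
    fun v => (comm .M2_K2 v).symm, comm .L1l_L2, comm .M2_L2, fun v => ?_, fun v => ?_, fun v => ?_,
    fun v => ?_, fun v => ?_, fun v => ?_⟩
  · have := fst .K2_L2 v
    simp only [awMap_fst_apply, hc, const_end_apply, map_smul] at this
    push_cast at this ⊢
    refine sub_eq_zero.1 (Eq.trans ?_ this)
    module
  · have := fst .K1r_L2 v
    simp only [awMap_fst_apply, hc, const_end_apply, map_smul] at this
    push_cast at this ⊢
    refine sub_eq_zero.1 (Eq.trans ?_ this)
    module
  · have := fst .K2_L1l v
    simp only [awMap_fst_apply, hc, const_end_apply, map_smul] at this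
    push_cast at this ⊢
    refine sub_eq_zero.1 (Eq.trans ?_ this)
    module
  · have := snd .K2_L1l v
    simp only [awMap_snd_apply, hc, const_end_apply, map_smul] at this
    push_cast at this ⊢
    refine sub_eq_zero.1 (Eq.trans ?_ this)
    module
  · have := fst .K1r_M2 v
    simp only [awMap_fst_apply, hc, const_end_apply, map_smul, map_neg, LinearMap.neg_apply] at this
    push_cast at this ⊢
    refine sub_eq_zero.1 (Eq.trans ?_ this)
    module
  · have := snd .K1r_M2 v
    simp only [awMap_snd_apply, hc, const_end_apply, map_smul, map_neg, LinearMap.neg_apply] at this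
    push_cast at this ⊢
    refine sub_eq_zero.1 (Eq.trans ?_ this)
    module

end

/-! ### Existence of a joint eigenbasis -/

/-- An orthogonal family of nonzero vectors of the right cardinality can be normalized to a basis.
-/
theorem exists_orthonormalBasis_smul {ι V : Type*} [Fintype ι] [Nonempty ι] [NormedAddCommGroup V]
    [InnerProductSpace ℂ V] (hc : Fintype.card ι = Module.finrank ℂ V) {x : ι → V}
      (h0 : ∀ i, x i ≠ 0)
    (h : ∀ i j, i ≠ j → inner ℂ (x i) (x j) = 0) :
    ∃ (b : OrthonormalBasis ι ℂ V) (c : ι → ℂ), ∀ i, b i = c i • x i := by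
  have : Orthonormal ℂ fun i => ((‖x i‖ : ℂ)⁻¹) • x i := by
    refine ⟨fun i => ?_, fun i j hij => ?_⟩
    · exact norm_smul_inv_norm (h0 i)
    · simp only [inner_smul_left, inner_smul_right, h i j hij, mul_zero]
  obtain ⟨b, hb⟩ := this.exists_orthonormalBasis hc
  exact ⟨b, _, fun i => congrFun hb i⟩

theorem exists_eigenbasis {ι V : Type*} [Fintype ι] [Nonempty ι] [NormedAddCommGroup V]
    [InnerProductSpace ℂ V] (hc : Fintype.card ι = Module.finrank ℂ V) {T : Module.End ℂ V}
    (hT : T.IsSymmetric) {r : ι → ℝ} (hr : Function.Injective r)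
    (he : ∀ i, T.HasEigenvalue (r i : ℂ)) :
    ∃ b : OrthonormalBasis ι ℂ V, ∀ i, T (b i) = (r i : ℂ) • b i := by
  choose x hx using fun i => (he i).exists_hasEigenvector
  obtain ⟨b, c, hb⟩ := exists_orthonormalBasis_smul hc (fun i => (hx i).2) fun i j hij =>
    inner_eq_zero_of_eigenvectors hT (hr.ne hij) (hx i).apply_eq_smul (hx j).apply_eq_smul
  exact ⟨b, fun i => by rw [hb, map_smul, (hx i).apply_eq_smul, smul_comm]⟩

section
variable {V₁ V₂ : Type*} [NormedAddCommGroup V₁] [InnerProductSpace ℂ V₁]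
  [NormedAddCommGroup V₂] [InnerProductSpace ℂ V₂] {N₁ N₂ : ℕ}

theorem isSymmetric_of_map_id_left [Nontrivial V₁] {T : Module.End ℂ V₂}
    (h : (TensorProduct.map (LinearMap.id : V₁ →ₗ[ℂ] V₁) T).IsSymmetric) : T.IsSymmetric := by
  obtain ⟨x, hx⟩ := exists_ne (0 : V₁)
  intro y z
  have := h (x ⊗ₜ y) (x ⊗ₜ z)
  simp only [TensorProduct.map_tmul, LinearMap.id_apply, TensorProduct.inner_tmul] at this
  exact mul_left_cancel₀ (inner_self_ne_zero.2 hx) this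

theorem isSymmetric_of_map_id_right [Nontrivial V₂] {T : Module.End ℂ V₁}
    (h : (TensorProduct.map T (LinearMap.id : V₂ →ₗ[ℂ] V₂)).IsSymmetric) : T.IsSymmetric := by
  obtain ⟨x, hx⟩ := exists_ne (0 : V₂)
  intro y z
  have := h (y ⊗ₜ x) (z ⊗ₜ x)
  simp only [TensorProduct.map_tmul, LinearMap.id_apply, TensorProduct.inner_tmul] at this
  exact mul_right_cancel₀ (inner_self_ne_zero.2 hx) this

/-- `jointVec` with its labels in range, in terms of indices in `Fin`. -/
theorem jointVec_eq (ψ₂ : OrthonormalBasis (Fin (N₂ + 1)) ℂ V₂)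
    (ψ₁ : Fin (N₂ + 1) → OrthonormalBasis (Fin (N₁ + 1)) ℂ V₁) {i j : ℤ} (h : InRange N₁ N₂ i j) :
    ∃ (a : Fin (N₁ + 1)) (b : Fin (N₂ + 1)), (a : ℤ) = i - j ∧ (b : ℤ) = j ∧
      jointVec ψ₂ ψ₁ i j = ψ₁ b a ⊗ₜ[ℂ] ψ₂ b :=
  ⟨⟨(i - j).toNat, by omega⟩, ⟨j.toNat, by omega⟩, by simp; omega, by simp; omega, dif_pos h⟩

/-- In a row of joint eigenvectors of `l₁` and `k₁`, `(l₁, k₂)` is an Askey--Wilson chain. -/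
theorem AWChain.of_pentagon {q α₀ α₁ A₂ : ℝ}
    {E : Type*} [NormedAddCommGroup E] [InnerProductSpace ℂ E]
    {k₁ l₁ k₂ l₂ m₂ : Module.End ℂ E} {Ψ : ℤ → ℤ → E} (hg : IsGrid N₁ N₂ Ψ)
    (h : Pentagon q (sinhq q α₀) (sinhq q α₁) A₂ (coshq q (N₁ + 1))
      (coshq q (N₂ + 1)) k₁ l₁ k₂ l₂ m₂)
    (hq0 : 0 < q) (hq1 : q < 1)
    (hk₁ : ∀ i j : ℤ, k₁ (Ψ i j) = (sinhq q (2 * j + (α₀ - N₂)) : ℂ) • Ψ i j) {j : ℤ}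
    (hj : 0 ≤ j ∧ j ≤ N₂)
    (hl₁ : ∀ i : ℤ, l₁ (Ψ i j) = (sinhq q (2 * i + (α₁ - N₁ - 2 * j)) : ℂ) • Ψ i j) :
    AWChain q (α₁ - N₁ - 2 * j) 1 (sinhq q α₁)
      (sinhq q (2 * j + (α₀ - N₂))) A₂ (coshq q (N₁ + 1)) l₁ k₂
      (fun i => Ψ i j) j (j + N₁) where
  toIsChain := hg.row hj
  symmK := h.symm_l₁
  symmL := h.symm_k₂
  eigen := hl₁
  span n := hg.mem_span_row fun i' j' hne =>
    inner_eq_zero_of_eigenvectors h.symm_k₁ (JointGrid.eig_ne hq0 hq1 _ hne) (hk₁ i' j')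
      (by rw [h.comm_k₁_k₂, hk₁, map_smul])
  rel₁ n := by
    have := h.l₁_k₂ (Ψ n j)
    simp only [hl₁, hk₁, map_smul] at this ⊢
    push_cast at this ⊢
    refine sub_eq_zero.1 (Eq.trans ?_ (sub_eq_zero.2 this))
    module
  rel₂ n := by
    have := h.k₂_l₁ (Ψ n j)
    simp only [h.comm_k₁_k₂, hl₁, hk₁, map_smul] at this ⊢
    push_cast at this ⊢
    refine sub_eq_zero.1 (Eq.trans ?_ (sub_eq_zero.2 this))
    module

/-- Existence of a joint eigenbasis. For each eigenvector `ψ₂ b` of `T₂`, the operator `k₂` has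
`N₁ + 1` distinct eigenvalues on `V₁ ⊗ ψ₂ b`, and its eigenvectors there are of the form
`x ⊗ ψ₂ b`. -/
theorem Pentagon.exists_jointGrid {q α₀ α₁ α₂ : ℝ} {k₁ l₁ k₂ l₂ m₂ : Module.End ℂ (V₁ ⊗[ℂ] V₂)}
    (h : Pentagon q (sinhq q α₀) (sinhq q α₁) (coshq q α₂) (coshq q (N₁ + 1))
      (coshq q (N₂ + 1)) k₁ l₁ k₂ l₂ m₂)
    (hq0 : 0 < q) (hq1 : q < 1)
    (hV₁ : Module.finrank ℂ V₁ = N₁ + 1) (hV₂ : Module.finrank ℂ V₂ = N₂ + 1)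
    {T₁ : Module.End ℂ V₁} {T₂ : Module.End ℂ V₂}
    (hl₁ : l₁ = TensorProduct.map T₁ LinearMap.id) (hk₁ : k₁ = TensorProduct.map LinearMap.id T₂)
    (hT₁ : ∀ k : ℕ, k ≤ N₁ → T₁.HasEigenvalue (sinhq q (2 * k + (α₁ - N₁)) : ℂ))
    (hT₂ : ∀ k : ℕ, k ≤ N₂ → T₂.HasEigenvalue (sinhq q (2 * k + (α₀ - N₂)) : ℂ)) :
    ∃ (ψ₂ : OrthonormalBasis (Fin (N₂ + 1)) ℂ V₂)
      (ψ₁ : Fin (N₂ + 1) → OrthonormalBasis (Fin (N₁ + 1)) ℂ V₁),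
      JointGrid q α₀ (sinhq q α₁) (coshq q α₂) N₁ N₂ k₁ l₁ k₂ l₂ m₂ (jointVec ψ₂ ψ₁) := by
  have : Nontrivial V₁ := Module.nontrivial_of_finrank_pos (R := ℂ) (by omega)
  have : Nontrivial V₂ := Module.nontrivial_of_finrank_pos (R := ℂ) (by omega)
  have inj : ∀ (N : ℕ) (ω : ℝ), Function.Injective fun k : Fin (N + 1) => sinhq q (2 * (k : ℕ) +
    ω) := by
    intro N ω a b hab
    have := (sinhq_strictAnti hq0 hq1).injective hab
    exact Fin.ext (by exact_mod_cast (by linarith : ((a : ℕ) : ℝ) = (b : ℕ)))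
  obtain ⟨φ, hφ⟩ := exists_eigenbasis (ι := Fin (N₁ + 1)) (by simp [hV₁])
    (isSymmetric_of_map_id_right (hl₁ ▸ h.symm_l₁)) (inj N₁ (α₁ - N₁)) fun k => hT₁ k (by omega)
  obtain ⟨ψ₂, hψ₂⟩ := exists_eigenbasis (ι := Fin (N₂ + 1)) (by simp [hV₂])
    (isSymmetric_of_map_id_left (hk₁ ▸ h.symm_k₁)) (inj N₂ (α₀ - N₂)) fun k => hT₂ k (by omega)
  have eig₁ : ∀ (ψ₁ : Fin (N₂ + 1) → OrthonormalBasis (Fin (N₁ + 1)) ℂ V₁) (i j : ℤ),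
      k₁ (jointVec ψ₂ ψ₁ i j) = (sinhq q (2 * j + (α₀ - N₂)) : ℂ) • jointVec ψ₂ ψ₁ i j := by
    intro ψ₁ i j
    by_cases hr : InRange N₁ N₂ i j
    · obtain ⟨a, b, -, hb, e⟩ := jointVec_eq ψ₂ ψ₁ hr
      rw [e, hk₁, TensorProduct.map_tmul, hψ₂, LinearMap.id_apply, TensorProduct.tmul_smul, ← hb]
      simp
    · rw [jointVec, dif_neg hr, map_zero, smul_zero]
  have eig₂ : ∀ i j : ℤ, l₁ (jointVec ψ₂ (fun _ => φ) i j) =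
      (sinhq q (2 * i + (α₁ - N₁ - 2 * j)) : ℂ) • jointVec ψ₂ (fun _ => φ) i j := by
    intro i j
    by_cases hr : InRange N₁ N₂ i j
    · obtain ⟨a, b, ha, hb, e⟩ := jointVec_eq ψ₂ (fun _ => φ) hr
      have ha' : ((a : ℕ) : ℝ) = i - j := by exact_mod_cast congrArg (Int.cast : ℤ → ℝ) ha
      rw [e, hl₁, TensorProduct.map_tmul, hφ, LinearMap.id_apply, TensorProduct.smul_tmul', ha',
        show (2 * (i - j) + (α₁ - N₁) : ℝ) = 2 * i + (α₁ - N₁ - 2 * j) by ring]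
    · rw [jointVec, dif_neg hr, map_zero, smul_zero]
  have key : ∀ (b : Fin (N₂ + 1)) (a : Fin (N₁ + 1)), ∃ x : V₁, x ≠ 0 ∧
      k₂ (x ⊗ₜ ψ₂ b) = (sinhq q (2 * (a : ℕ) + (2 * (b : ℕ) + (α₀ - N₁ - N₂))) :
        ℂ) • (x ⊗ₜ[ℂ] ψ₂ b) := by
    intro b a
    have hb : (0 : ℤ) ≤ (b : ℕ) ∧ ((b : ℕ) : ℤ) ≤ N₂ := by omega
    have hch := AWChain.of_pentagon (jointVec_isGrid ψ₂ fun _ => φ) h hq0 hq1 (eig₁ _) hb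
      (fun i => eig₂ i _)
    obtain ⟨w, hw0, hw⟩ := hch.exists_eigenvector hq0 hq1 (by ring) (k := N₁ - a) (by omega)
    have hmem : ∑ n ∈ Finset.Icc ((b : ℕ) : ℤ) ((b : ℕ) + N₁), w n • jointVec ψ₂ (fun _ => φ) n (b :
      ℕ) ∈
        LinearMap.range ((TensorProduct.mk ℂ V₁ V₂).flip (ψ₂ b)) := by
      refine Submodule.sum_mem _ fun n hn => Submodule.smul_mem _ _ ?_
      rw [Finset.mem_Icc] at hn
      obtain ⟨a', b', -, hb', e⟩ := jointVec_eq ψ₂ (fun _ => φ) (i := n) (j := (b : ℕ)) (by omega)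
      have : b' = b := Fin.ext (by exact_mod_cast hb')
      exact ⟨φ a', by rw [e, this]; rfl⟩
    obtain ⟨x, hx⟩ := hmem
    rw [LinearMap.flip_apply, TensorProduct.mk_apply] at hx
    rw [← hx] at hw0 hw
    -- The index `k = N₁ - a` makes the eigenvalue increase with the label.
    refine ⟨x, fun h0 => hw0 (by rw [h0, TensorProduct.zero_tmul]), ?_⟩
    rw [hw]
    have : ((N₁ - a : ℕ) : ℝ) = N₁ - (a : ℕ) := Nat.cast_sub (by omega)
    rw [this]
    congr 3
    push_cast; ring
  choose x hx0 hx using key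
  have hb : ∀ b, ∃ (φ' : OrthonormalBasis (Fin (N₁ + 1)) ℂ V₁) (c : Fin (N₁ + 1) → ℂ), ∀ a, φ' a =
    c a • x b a := by
    intro b
    refine exists_orthonormalBasis_smul (by simp [hV₁]) (hx0 b) fun a a' ha => ?_
    have := inner_eq_zero_of_eigenvectors h.symm_k₂ ((inj N₁ _).ne ha) (hx b a) (hx b a')
    rwa [TensorProduct.inner_tmul, inner_self_eq_norm_sq_to_K, ψ₂.norm_eq_one, RCLike.ofReal_one,
      one_pow, mul_one] at this
  choose ψ₁ c hψ₁ using hb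
  refine ⟨ψ₂, ψ₁, ⟨h, jointVec_isGrid ψ₂ ψ₁, eig₁ ψ₁, fun i j => ?_⟩⟩
  by_cases hr : InRange N₁ N₂ i j
  · obtain ⟨a, b, ha, hb, e⟩ := jointVec_eq ψ₂ ψ₁ hr
    have ha' : ((a : ℕ) : ℝ) = i - j := by exact_mod_cast congrArg (Int.cast : ℤ → ℝ) ha
    have hb' : ((b : ℕ) : ℝ) = j := by exact_mod_cast congrArg (Int.cast : ℤ → ℝ) hb
    rw [e, hψ₁, ← TensorProduct.smul_tmul', map_smul, hx, smul_comm, ha', hb',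
        show (2 * (i - j) + (2 * j + (α₀ - N₁ - N₂)) : ℝ) = 2 * i + (α₀ - N₁ - N₂) by ring]
  · rw [jointVec, dif_neg hr, map_zero, smul_zero]

end

/-! ### Comparison with the stated coefficients -/

theorem coshq_neg_sub_one (q : ℝ) (N : ℕ) : coshq q (-(N : ℝ) - 1) = coshq q (N + 1) := by
  rw [show (-(N : ℝ) - 1) = -(N + 1) by ring, coshq_neg]

theorem aSq_eq {q : ℝ} (hq0 : 0 < q) (a b c d n : ℝ) :
    aSq q ![a, b, c, d] n =
      offDiagSq q 1 (sinhq q a) (sinhq q b) (coshq q c) (coshq q d) (2 * n + a) := by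
  have h1 := quad_factor hq0 a d (sinhq q (2 * n + a - 1))
  have h2 := quad_factor hq0 b c (sinhq q (2 * n + a - 1))
  simp only [aSq, pRoot, offDiagSq, Fin.prod_univ_four, Matrix.cons_val, one_mul]
  rw [h1, ← add_sub_assoc, h2]
  ring

theorem aTildeSq_eq {q : ℝ} (hq0 : 0 < q) (a b c d n : ℝ) :
    aTildeSq q ![a, b, c, d] n =
      offDiagSq q (-1) (sinhq q a) (coshq q b) (sinhq q c) (coshq q d) (2 * n + a) := by
  have h := aSq_eq hq0 a (-c) b d n
  simp only [aTildeSq, Matrix.cons_val]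
  rw [h, sinhq_neg]
  simp only [offDiagSq]
  ring

section
variable {q : ℝ} (N₁ N₂ : ℕ) (α₀ α₁ α₂ : ℝ) (i j : ℤ)

theorem eig_lab₁ : eig q α₀ (lab₁ N₁ N₂ i) = sinhq q (2 * i + (α₀ - N₁ - N₂)) := by
  rw [eig, lab₁]; congr 1; ring

theorem eig_lab₂ : eig q α₀ (lab₂ N₂ j) = sinhq q (2 * j + (α₀ - N₂)) := by
  rw [eig, lab₂]; congr 1; ring

theorem lab₁_sub_one : lab₁ N₁ N₂ i - 1 = lab₁ N₁ N₂ (i - 1) := by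
  simp only [lab₁]; push_cast; ring

theorem lab₂_sub_one : lab₂ N₂ j - 1 = lab₂ N₂ (j - 1) := by
  simp only [lab₂]; push_cast; ring

theorem lab₂_add_one : lab₂ N₂ j + 1 = lab₂ N₂ (j + 1) := by
  simp only [lab₂]; push_cast; ring

theorem aL_eq (hq0 : 0 < q) : aL q N₁ α₀ α₁ α₂ (lab₁ N₁ N₂ i) (lab₂ N₂ j) =
    √(offDiagSq q 1 (sinhq q (2 * j + (α₀ - N₂))) (sinhq q α₁) (coshq q α₂) (coshq q (N₁ + 1))
      (2 * i + (α₀ - N₁ - N₂))) := by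
  rw [aL, aCoef, alphaL, aSq_eq hq0, coshq_neg_sub_one, lab₁, lab₂]
  ring_nf

theorem bL_eq : bL q N₁ α₀ α₁ α₂ (lab₁ N₁ N₂ i) (lab₂ N₂ j) =
    diagEntry q (sinhq q (2 * j + (α₀ - N₂))) (sinhq q α₁) (coshq q α₂) (coshq q (N₁ + 1))
      (2 * i + (α₀ - N₁ - N₂)) := by
  simp only [bL, bCoef, alphaL, Matrix.cons_val, coshq_neg_sub_one, lab₁, lab₂, bForm, eig,
    diagEntry]
  ring_nf

theorem aM_eq (hq0 : 0 < q) : aM q N₁ N₂ α₀ (lab₁ N₁ N₂ i) (lab₂ N₂ j) =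
    √(offDiagSq q (-1) (sinhq q α₀) (coshq q (N₁ + 1)) (-sinhq q (2 * i + (α₀ - N₁ - N₂)))
      (coshq q (N₂ + 1)) (2 * j + (α₀ - N₂))) := by
  rw [aM, aTilde, alphaM, aTildeSq_eq hq0, coshq_neg_sub_one, coshq_neg_sub_one, lab₁, lab₂,
    ← sinhq_neg]
  ring_nf

theorem bM_eq : bM q N₁ N₂ α₀ (lab₁ N₁ N₂ i) (lab₂ N₂ j) =
    diagEntry q (sinhq q α₀) (coshq q (N₁ + 1)) (-sinhq q (2 * i + (α₀ - N₁ - N₂)))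
      (coshq q (N₂ + 1)) (2 * j + (α₀ - N₂)) := by
  simp only [bM, bTilde, alphaM, Matrix.cons_val, coshq_neg_sub_one, ← sinhq_neg, lab₁, lab₂, bForm,
    eig, diagEntry]
  ring_nf

theorem coefB_eq : coefB q N₁ N₂ α₀ α₁ α₂ (lab₁ N₁ N₂ i) (lab₂ N₂ j) =
    aL q N₁ α₀ α₁ α₂ (lab₁ N₁ N₂ i) (lab₂ N₂ j) *
      facB q (sinhq q α₀) (coshq q (N₂ + 1)) (2 * j + (α₀ - N₂)) := by
  rw [coefB, facB, eig_lab₂, coshq_neg_sub_one, ← mul_div_assoc, lab₂]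
  ring_nf

theorem coefD_eq : coefD q N₁ N₂ α₀ α₁ α₂ (lab₁ N₁ N₂ i) (lab₂ N₂ j) =
    aM q N₁ N₂ α₀ (lab₁ N₁ N₂ i) (lab₂ N₂ j) *
      facD q (sinhq q α₁) (coshq q α₂) (2 * i + (α₀ - N₁ - N₂)) := by
  rw [coefD, facD, eig_lab₁, ← mul_div_assoc, lab₁]
  ring_nf

end

namespace JointGrid
variable {E : Type*} [NormedAddCommGroup E] [InnerProductSpace ℂ E]
    {q α₀ α₁ α₂ : ℝ} {N₁ N₂ : ℕ} {k₁ l₁ k₂ l₂ m₂ : Module.End ℂ E} {Ψ : ℤ → ℤ → E}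

theorem l₂_entry_symm {A₁ A₂ : ℝ} (h : JointGrid q α₀ A₁ A₂ N₁ N₂ k₁ l₁ k₂ l₂ m₂ Ψ) (i j p r : ℤ) :
    inner ℂ (Ψ p r) (l₂ (Ψ i j)) = star (inner ℂ (Ψ i j) (l₂ (Ψ p r))) := by
  rw [← h.symm_l₂]; exact (inner_conj_symm _ _).symm

/-- `l₂` moves each label by at most one. -/
theorem l₂_apply {A₁ A₂ : ℝ} (h : JointGrid q α₀ A₁ A₂ N₁ N₂ k₁ l₁ k₂ l₂ m₂ Ψ) (hq0 : 0 < q)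
    (hq1 : q < 1) (i j : ℤ) : l₂ (Ψ i j) =
      inner ℂ (Ψ (i - 1) (j - 1)) (l₂ (Ψ i j)) • Ψ (i - 1) (j - 1)
      + inner ℂ (Ψ (i - 1) j) (l₂ (Ψ i j)) • Ψ (i - 1) j
      + inner ℂ (Ψ (i - 1) (j + 1)) (l₂ (Ψ i j)) • Ψ (i - 1) (j + 1)
      + inner ℂ (Ψ i (j - 1)) (l₂ (Ψ i j)) • Ψ i (j - 1)
      + inner ℂ (Ψ i j) (l₂ (Ψ i j)) • Ψ i j
      + inner ℂ (Ψ i (j + 1)) (l₂ (Ψ i j)) • Ψ i (j + 1)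
      + inner ℂ (Ψ (i + 1) (j - 1)) (l₂ (Ψ i j)) • Ψ (i + 1) (j - 1)
      + inner ℂ (Ψ (i + 1) j) (l₂ (Ψ i j)) • Ψ (i + 1) j
      + inner ℂ (Ψ (i + 1) (j + 1)) (l₂ (Ψ i j)) • Ψ (i + 1) (j + 1) := by
  refine h.toIsGrid.ext fun p r hpr => ?_
  simp only [inner_add_right, inner_smul_right, h.toIsGrid.inner_eq hpr]
  by_cases hp : p < i - 1 ∨ i + 1 < p
  · rw [h.l₂_entry_eq_zero hq0 hq1 (Or.inl (by omega))]
    simp only [show p ≠ i - 1 by omega, show p ≠ i by omega, show p ≠ i + 1 by omega, false_and,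
      if_false, mul_zero, add_zero]
  by_cases hr : r < j - 1 ∨ j + 1 < r
  · rw [h.l₂_entry_eq_zero hq0 hq1 (Or.inr (by omega))]
    simp only [show r ≠ j - 1 by omega, show r ≠ j by omega, show r ≠ j + 1 by omega, and_false,
      if_false, mul_zero, add_zero]
  have hp' : p = i - 1 ∨ p = i ∨ p = i + 1 := by omega
  have hr' : r = j - 1 ∨ r = j ∨ r = j + 1 := by omega
  have d : ∀ n : ℤ, n ≠ n + 1 ∧ n ≠ n - 1 ∧ n - 1 ≠ n ∧ n + 1 ≠ n ∧ n - 1 ≠ n + 1 ∧ n + 1 ≠ n - 1 :=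
    fun n => by omega
  rcases hp' with rfl | rfl | rfl <;> rcases hr' with rfl | rfl | rfl <;> simp [d]

theorem eq_sqrt_normSq {z : ℂ} (hz : 0 ≤ z) : z = (√(Complex.normSq z) : ℝ) := by
  rw [Complex.normSq_eq_norm_sq, Real.sqrt_sq (norm_nonneg z)]
  exact (RCLike.norm_of_nonneg' hz).symm

/-- The range includes `i = j` and `i = j + N₁ + 1`, where `aL` vanishes. This makes the formulas
for the corner entries of `l₂` valid at the boundary of the grid. -/
theorem l₁_entry_eq (h : JointGrid q α₀ (sinhq q α₁) (coshq q α₂) N₁ N₂ k₁ l₁ k₂ l₂ m₂ Ψ)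
    (hq0 : 0 < q) (hq1 : q < 1) (hl : ∀ i j, 0 ≤ inner ℂ (Ψ (i - 1) j) (l₁ (Ψ i j)))
    {i j : ℤ} (hj : 0 ≤ j ∧ j ≤ N₂) (h1 : j ≤ i) (h2 : i ≤ j + N₁ + 1) :
    inner ℂ (Ψ (i - 1) j) (l₁ (Ψ i j)) = (aL q N₁ α₀ α₁ α₂ (lab₁ N₁ N₂ i) (lab₂ N₂ j) : ℂ) := by
  rw [aL_eq _ _ _ _ _ _ _ hq0, ← h.normSq_l₁ hq0 hq1 hj h1 h2]
  exact eq_sqrt_normSq (hl i j)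

/-- As in `l₁_entry_eq`, the range includes the pairs of labels of which only one belongs to the
column. -/
theorem m₂_entry_eq (h : JointGrid q α₀ (sinhq q α₁) (coshq q α₂) N₁ N₂ k₁ l₁ k₂ l₂ m₂ Ψ)
    (hq0 : 0 < q) (hq1 : q < 1) (hm : ∀ i j, 0 ≤ inner ℂ (Ψ i (j - 1)) (m₂ (Ψ i j)))
    {i j : ℤ} (h1 : max 0 (i - N₁) ≤ j) (h2 : j ≤ min (N₂ : ℤ) i + 1) :
    inner ℂ (Ψ i (j - 1)) (m₂ (Ψ i j)) = (aM q N₁ N₂ α₀ (lab₁ N₁ N₂ i) (lab₂ N₂ j) : ℂ) := by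
  rw [aM_eq _ _ _ _ _ hq0, ← h.normSq_m₂ hq0 hq1 h1 h2]
  exact eq_sqrt_normSq (hm i j)

theorem l₂_entry_eq_coefB (h : JointGrid q α₀ (sinhq q α₁) (coshq q α₂) N₁ N₂ k₁ l₁ k₂ l₂ m₂ Ψ)
    (hq0 : 0 < q) (hq1 : q < 1) (hl : ∀ i j, 0 ≤ inner ℂ (Ψ (i - 1) j) (l₁ (Ψ i j)))
    {i j : ℤ} (hj : 0 ≤ j ∧ j ≤ N₂) (h1 : j ≤ i) (h2 : i ≤ j + N₁ + 1) :
    inner ℂ (Ψ (i - 1) j) (l₂ (Ψ i j)) = (coefB q N₁ N₂ α₀ α₁ α₂ (lab₁ N₁ N₂ i) (lab₂ N₂ j) :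
      ℂ) := by
  rw [h.l₂_entry_row_of_ne hq0 hq1 (by omega), h.l₁_entry_eq hq0 hq1 hl hj h1 h2, coefB_eq,
    Complex.ofReal_mul, mul_comm]

theorem l₂_entry_eq_coefD (h : JointGrid q α₀ (sinhq q α₁) (coshq q α₂) N₁ N₂ k₁ l₁ k₂ l₂ m₂ Ψ)
    (hq0 : 0 < q) (hq1 : q < 1) (hm : ∀ i j, 0 ≤ inner ℂ (Ψ i (j - 1)) (m₂ (Ψ i j)))
    {i j : ℤ} (h1 : max 0 (i - N₁) ≤ j) (h2 : j ≤ min (N₂ : ℤ) i + 1) :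
    inner ℂ (Ψ i (j - 1)) (l₂ (Ψ i j)) = (coefD q N₁ N₂ α₀ α₁ α₂ (lab₁ N₁ N₂ i) (lab₂ N₂ j) :
      ℂ) := by
  rw [h.l₂_entry_col_of_ne hq0 hq1 _ (by omega), h.m₂_entry_eq hq0 hq1 hm h1 h2, coefD_eq,
    Complex.ofReal_mul, mul_comm]

theorem l₂_entry_eq_coefE (h : JointGrid q α₀ (sinhq q α₁) (coshq q α₂) N₁ N₂ k₁ l₁ k₂ l₂ m₂ Ψ)
    (hq0 : 0 < q) (hq1 : q < 1) {i j : ℤ} (hij : InRange N₁ N₂ i j) :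
    inner ℂ (Ψ i j) (l₂ (Ψ i j)) = (coefE q N₁ N₂ α₀ α₁ α₂ (lab₁ N₁ N₂ i) (lab₂ N₂ j) : ℂ) := by
  have hm : inner ℂ (Ψ i j) (m₂ (Ψ i j)) = (bM q N₁ N₂ α₀ (lab₁ N₁ N₂ i) (lab₂ N₂ j) : ℂ) := by
    rw [h.m₂_apply hq0 hq1]
    simp only [inner_add_right, inner_smul_right, h.norm i j hij, h.orth i j i (j - 1) (by omega),
      h.orth i j i (j + 1) (by omega), bM_eq]
    simp
  rw [h.l₂_entry_col hq0 hq1, hm, h.norm i j hij, coefE, eig_lab₁]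
  simp only [facB, facD, lab₁]
  push_cast
  ring_nf

theorem l₂_entry_eq_coefA (h : JointGrid q α₀ (sinhq q α₁) (coshq q α₂) N₁ N₂ k₁ l₁ k₂ l₂ m₂ Ψ)
    (hq0 : 0 < q) (hq1 : q < 1) (hl : ∀ i j, 0 ≤ inner ℂ (Ψ (i - 1) j) (l₁ (Ψ i j)))
    (hm : ∀ i j, 0 ≤ inner ℂ (Ψ i (j - 1)) (m₂ (Ψ i j))) {i j : ℤ} (hij : InRange N₁ N₂ i j)
    (hij' : InRange N₁ N₂ (i - 1) (j - 1))
    (hden : denA q N₁ α₀ α₁ α₂ (lab₁ N₁ N₂ i) (lab₂ N₂ j) ≠ 0) :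
    inner ℂ (Ψ (i - 1) (j - 1)) (l₂ (Ψ i j)) =
      (coefA q N₁ N₂ α₀ α₁ α₂ (lab₁ N₁ N₂ i) (lab₂ N₂ j) : ℂ) := by
  have key := h.l₂_corner_l₁ hq0 hq1 i (by omega : j - 1 ≠ j)
  rw [h.l₁_entry_eq hq0 hq1 hl (i := i) (j := j) (by omega) (by omega) (by omega),
    h.l₁_entry_eq hq0 hq1 hl (i := i) (j := j - 1) (by omega) (by omega) (by omega),
    h.m₂_entry_eq hq0 hq1 hm (i := i) (j := j) (by omega) (by omega),
    h.m₂_entry_eq hq0 hq1 hm (i := i - 1) (j := j) (by omega) (by omega), ← bL_eq, ← bL_eq] at key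
  rw [coefA, denA, lab₁_sub_one, lab₂_sub_one, coefD_eq, coefD_eq, Complex.ofReal_div, eq_div_iff,
    key]
  · push_cast; ring
  · rwa [denA, lab₁_sub_one, lab₂_sub_one, ← Complex.ofReal_ne_zero] at hden

theorem l₂_entry_eq_coefC (h : JointGrid q α₀ (sinhq q α₁) (coshq q α₂) N₁ N₂ k₁ l₁ k₂ l₂ m₂ Ψ)
    (hq0 : 0 < q) (hq1 : q < 1) (hl : ∀ i j, 0 ≤ inner ℂ (Ψ (i - 1) j) (l₁ (Ψ i j)))
    (hm : ∀ i j, 0 ≤ inner ℂ (Ψ i (j - 1)) (m₂ (Ψ i j))) {i j : ℤ} (hij : InRange N₁ N₂ i j)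
    (hij' : InRange N₁ N₂ (i - 1) (j + 1))
    (hden : denC q N₁ α₀ α₁ α₂ (lab₁ N₁ N₂ i) (lab₂ N₂ j) ≠ 0) :
    inner ℂ (Ψ (i - 1) (j + 1)) (l₂ (Ψ i j)) =
      (coefC q N₁ N₂ α₀ α₁ α₂ (lab₁ N₁ N₂ i) (lab₂ N₂ j) : ℂ) := by
  have hm' : ∀ i : ℤ, max 0 (i - N₁) ≤ j + 1 → j + 1 ≤ min (N₂ : ℤ) i + 1 →
      inner ℂ (Ψ i (j + 1)) (m₂ (Ψ i j)) = (aM q N₁ N₂ α₀ (lab₁ N₁ N₂ i) (lab₂ N₂ (j + 1)) :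
        ℂ) := by
    intro i h1 h2
    have := h.m₂_entry_eq hq0 hq1 hm (i := i) (j := j + 1) h1 h2
    rw [add_sub_cancel_right] at this
    rw [← h.symm_m₂, ← inner_conj_symm, this, Complex.conj_ofReal]
  have key := h.l₂_corner_l₁ hq0 hq1 i (by omega : j + 1 ≠ j)
  rw [h.l₁_entry_eq hq0 hq1 hl (i := i) (j := j) (by omega) (by omega) (by omega),
    h.l₁_entry_eq hq0 hq1 hl (i := i) (j := j + 1) (by omega) (by omega) (by omega),
    hm' i (by omega) (by omega), hm' (i - 1) (by omega) (by omega), ← bL_eq, ← bL_eq] at key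
  rw [coefC, denC, lab₁_sub_one, lab₂_add_one, coefD_eq, coefD_eq, Complex.ofReal_div, eq_div_iff,
    key]
  · push_cast; ring
  · rwa [denC, lab₁_sub_one, lab₂_add_one, ← Complex.ofReal_ne_zero] at hden

end JointGrid

/-! ### The nine-term action of `L₂` -/

/-- The coefficients `a` and `c` are the corner entries of `l₂`, and are given the value of the
formula where the labels are out of range and there is no such entry. -/
theorem JointGrid.exists_nine_term {E : Type*} [NormedAddCommGroup E] [InnerProductSpace ℂ E]
    {q α₀ α₁ α₂ : ℝ} {N₁ N₂ : ℕ} {k₁ l₁ k₂ l₂ m₂ : Module.End ℂ E} {Ψ : ℤ → ℤ → E}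
    (h : JointGrid q α₀ (sinhq q α₁) (coshq q α₂) N₁ N₂ k₁ l₁ k₂ l₂ m₂ Ψ)
    (hq0 : 0 < q) (hq1 : q < 1) (hl : ∀ i j, 0 ≤ inner ℂ (Ψ (i - 1) j) (l₁ (Ψ i j)))
    (hm : ∀ i j, 0 ≤ inner ℂ (Ψ i (j - 1)) (m₂ (Ψ i j))) :
    ∃ a b c d e : ℤ → ℤ → ℂ,
      (∀ i j : ℤ, InRange N₁ N₂ i j → l₂ (Ψ i j) =
        a i j • Ψ (i - 1) (j - 1) + b i j • Ψ (i - 1) j + c i j • Ψ (i - 1) (j + 1)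
        + d i j • Ψ i (j - 1) + e i j • Ψ i j + d i (j + 1) • Ψ i (j + 1)
        + star (c (i + 1) (j - 1)) • Ψ (i + 1) (j - 1) + b (i + 1) j • Ψ (i + 1) j
        + star (a (i + 1) (j + 1)) • Ψ (i + 1) (j + 1)) ∧
      (∀ i j : ℤ, denA q N₁ α₀ α₁ α₂ (lab₁ N₁ N₂ i) (lab₂ N₂ j) ≠ 0 →
        a i j = coefA q N₁ N₂ α₀ α₁ α₂ (lab₁ N₁ N₂ i) (lab₂ N₂ j)) ∧
      (∀ i j : ℤ, b i j = coefB q N₁ N₂ α₀ α₁ α₂ (lab₁ N₁ N₂ i) (lab₂ N₂ j)) ∧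
      (∀ i j : ℤ, denC q N₁ α₀ α₁ α₂ (lab₁ N₁ N₂ i) (lab₂ N₂ j) ≠ 0 →
        c i j = coefC q N₁ N₂ α₀ α₁ α₂ (lab₁ N₁ N₂ i) (lab₂ N₂ j)) ∧
      (∀ i j : ℤ, d i j = coefD q N₁ N₂ α₀ α₁ α₂ (lab₁ N₁ N₂ i) (lab₂ N₂ j)) ∧
      (∀ i j : ℤ, e i j = coefE q N₁ N₂ α₀ α₁ α₂ (lab₁ N₁ N₂ i) (lab₂ N₂ j)) := by
  refine ⟨fun i j => if InRange N₁ N₂ i j ∧ InRange N₁ N₂ (i - 1) (j - 1) then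
      inner ℂ (Ψ (i - 1) (j - 1)) (l₂ (Ψ i j))
      else coefA q N₁ N₂ α₀ α₁ α₂ (lab₁ N₁ N₂ i) (lab₂ N₂ j),
    fun i j => coefB q N₁ N₂ α₀ α₁ α₂ (lab₁ N₁ N₂ i) (lab₂ N₂ j),
    fun i j => if InRange N₁ N₂ i j ∧ InRange N₁ N₂ (i - 1) (j + 1) then
      inner ℂ (Ψ (i - 1) (j + 1)) (l₂ (Ψ i j))
      else coefC q N₁ N₂ α₀ α₁ α₂ (lab₁ N₁ N₂ i) (lab₂ N₂ j),
    fun i j => coefD q N₁ N₂ α₀ α₁ α₂ (lab₁ N₁ N₂ i) (lab₂ N₂ j),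
    fun i j => coefE q N₁ N₂ α₀ α₁ α₂ (lab₁ N₁ N₂ i) (lab₂ N₂ j),
    fun i j hij => ?_, fun i j hden => ?_, fun _ _ => rfl, fun i j hden => ?_, fun _ _ => rfl,
      fun _ _ => rfl⟩
  · have smul_congr : ∀ {p r : ℤ} {z w : ℂ}, (InRange N₁ N₂ p r → z = w) → z • Ψ p r =
      w • Ψ p r := by
      intro p r z w hzw
      by_cases hr : InRange N₁ N₂ p r
      · rw [hzw hr]
      · rw [h.zero _ _ hr, smul_zero, smul_zero]
    have star_ofReal : ∀ x : ℝ, star (x : ℂ) = x := Complex.conj_ofReal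
    have add_congr : ∀ {v w v' w' : E}, v = v' → w = w' → v + w = v' + w' := congrArg₂ (· + ·)
    rw [h.l₂_apply hq0 hq1 i j]
    refine add_congr (add_congr (add_congr (add_congr (add_congr (add_congr (add_congr (add_congr
      (smul_congr fun hr => ?_) (smul_congr fun hr => ?_)) (smul_congr fun hr => ?_))
      (smul_congr fun hr => ?_)) (smul_congr fun hr => ?_)) (smul_congr fun hr => ?_))
      (smul_congr fun hr => ?_)) (smul_congr fun hr => ?_)) (smul_congr fun hr => ?_)
    · exact (if_pos ⟨hij, hr⟩).symm
    · exact h.l₂_entry_eq_coefB hq0 hq1 hl (by omega) (by omega) (by omega)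
    · exact (if_pos ⟨hij, hr⟩).symm
    · exact h.l₂_entry_eq_coefD hq0 hq1 hm (by omega) (by omega)
    · exact h.l₂_entry_eq_coefE hq0 hq1 hij
    · have := h.l₂_entry_eq_coefD hq0 hq1 hm (i := i) (j := j + 1) (by omega) (by omega)
      rw [add_sub_cancel_right] at this
      rw [h.l₂_entry_symm, this, star_ofReal]
    · simp only [add_sub_cancel_right, sub_add_cancel]
      rw [if_pos ⟨hr, hij⟩]
      exact h.l₂_entry_symm _ _ _ _
    · have := h.l₂_entry_eq_coefB hq0 hq1 hl (i := i + 1) (j := j) (by omega) (by omega) (by omega)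
      rw [add_sub_cancel_right] at this
      rw [h.l₂_entry_symm, this, star_ofReal]
    · simp only [add_sub_cancel_right]
      rw [if_pos ⟨hr, hij⟩]
      exact h.l₂_entry_symm _ _ _ _
  · dsimp only
    split_ifs with hr
    · exact h.l₂_entry_eq_coefA hq0 hq1 hl hm hr.1 hr.2 hden
    · rfl
  · dsimp only
    split_ifs with hr
    · exact h.l₂_entry_eq_coefC hq0 hq1 hl hm hr.1 hr.2 hden
    · rfl

end AskeyWilson

end

theorem mainTheorem3 (q : ℝ) (hq0 : 0 < q) (hq1 : q < 1) (N₁ N₂ : ℕ) (α₀ α₁ α₂ : ℝ)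
    {V₁ V₂ : Type*} [NormedAddCommGroup V₁] [InnerProductSpace ℂ V₁]
    [NormedAddCommGroup V₂] [InnerProductSpace ℂ V₂]
    (hV₁ : Module.finrank ℂ V₁ = N₁ + 1) (hV₂ : Module.finrank ℂ V₂ = N₂ + 1)
    -- the two rank one representations, with the prescribed spectra of `L₁` and `K₁`
    (π₁ : AskeyWilson.AW3p q α₀ α₁ α₂ N₁ →ₐ[ℂ] Module.End ℂ V₁)
    (π₂ : AskeyWilson.AW3p q α₀ α₁ α₂ N₂ →ₐ[ℂ] Module.End ℂ V₂)
    (hspecL : ∀ k : ℕ, k ≤ N₁ →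
      (π₁ (AskeyWilson.AW3p.gen q α₀ α₁ α₂ N₁ .L)).HasEigenvalue
        (AskeyWilson.eig q α₁ ((k : ℝ) - (N₁ : ℝ) / 2) : ℂ))
    (hspecK : ∀ k : ℕ, k ≤ N₂ →
      (π₂ (AskeyWilson.AW3p.gen q α₀ α₁ α₂ N₂ .K)).HasEigenvalue
        (AskeyWilson.eig q α₀ ((k : ℝ) - (N₂ : ℝ) / 2) : ℂ))
    -- the representation of the rank two algebra, extending the tensor product of `π₁` and `π₂`
    (ρ : AskeyWilson.AW2p q α₀ α₁ α₂ N₁ N₂ →ₐ[ℂ] Module.End ℂ (V₁ ⊗[ℂ] V₂))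
    (hK1l : ρ (AskeyWilson.AW2p.gen q α₀ α₁ α₂ N₁ N₂ .K1l) =
      TensorProduct.map (π₁ (AskeyWilson.AW3p.gen q α₀ α₁ α₂ N₁ .K)) LinearMap.id)
    (hL1l : ρ (AskeyWilson.AW2p.gen q α₀ α₁ α₂ N₁ N₂ .L1l) =
      TensorProduct.map (π₁ (AskeyWilson.AW3p.gen q α₀ α₁ α₂ N₁ .L)) LinearMap.id)
    (hK1r : ρ (AskeyWilson.AW2p.gen q α₀ α₁ α₂ N₁ N₂ .K1r) =
      TensorProduct.map LinearMap.id (π₂ (AskeyWilson.AW3p.gen q α₀ α₁ α₂ N₂ .K)))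
    (hL1r : ρ (AskeyWilson.AW2p.gen q α₀ α₁ α₂ N₁ N₂ .L1r) =
      TensorProduct.map LinearMap.id (π₂ (AskeyWilson.AW3p.gen q α₀ α₁ α₂ N₂ .L)))
    -- `1 ⊗ K₁`, `L₁ ⊗ 1`, `K₂`, `L₂`, `M₂` are self-adjoint
    (hsK1r : (ρ (AskeyWilson.AW2p.gen q α₀ α₁ α₂ N₁ N₂ .K1r)).IsSymmetric)
    (hsL1l : (ρ (AskeyWilson.AW2p.gen q α₀ α₁ α₂ N₁ N₂ .L1l)).IsSymmetric)
    (hsK2 : (ρ (AskeyWilson.AW2p.gen q α₀ α₁ α₂ N₁ N₂ .K2)).IsSymmetric)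
    (hsL2 : (ρ (AskeyWilson.AW2p.gen q α₀ α₁ α₂ N₁ N₂ .L2)).IsSymmetric)
    (hsM2 : (ρ (AskeyWilson.AW2p.gen q α₀ α₁ α₂ N₁ N₂ .M2)).IsSymmetric) :
    -- a normalized joint eigenbasis exists
    (∃ (ψ₂ : OrthonormalBasis (Fin (N₂ + 1)) ℂ V₂)
        (ψ₁ : Fin (N₂ + 1) → OrthonormalBasis (Fin (N₁ + 1)) ℂ V₁),
        AskeyWilson.IsJointEigenbasis q α₀
          (ρ (AskeyWilson.AW2p.gen q α₀ α₁ α₂ N₁ N₂ .K1r))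
          (ρ (AskeyWilson.AW2p.gen q α₀ α₁ α₂ N₁ N₂ .L1l))
          (ρ (AskeyWilson.AW2p.gen q α₀ α₁ α₂ N₁ N₂ .K2))
          (ρ (AskeyWilson.AW2p.gen q α₀ α₁ α₂ N₁ N₂ .M2)) ψ₂ ψ₁) ∧
    -- on every such basis `L₂` is a 9-term operator with the stated coefficients
    (∀ (ψ₂ : OrthonormalBasis (Fin (N₂ + 1)) ℂ V₂)
        (ψ₁ : Fin (N₂ + 1) → OrthonormalBasis (Fin (N₁ + 1)) ℂ V₁),
        AskeyWilson.IsJointEigenbasis q α₀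
          (ρ (AskeyWilson.AW2p.gen q α₀ α₁ α₂ N₁ N₂ .K1r))
          (ρ (AskeyWilson.AW2p.gen q α₀ α₁ α₂ N₁ N₂ .L1l))
          (ρ (AskeyWilson.AW2p.gen q α₀ α₁ α₂ N₁ N₂ .K2))
          (ρ (AskeyWilson.AW2p.gen q α₀ α₁ α₂ N₁ N₂ .M2)) ψ₂ ψ₁ →
        ∃ a b c d e : ℤ → ℤ → ℂ,
          (∀ i j : ℤ, AskeyWilson.InRange N₁ N₂ i j →
            ρ (AskeyWilson.AW2p.gen q α₀ α₁ α₂ N₁ N₂ .L2) (AskeyWilson.jointVec ψ₂ ψ₁ i j) =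
              a i j • AskeyWilson.jointVec ψ₂ ψ₁ (i - 1) (j - 1)
              + b i j • AskeyWilson.jointVec ψ₂ ψ₁ (i - 1) j
              + c i j • AskeyWilson.jointVec ψ₂ ψ₁ (i - 1) (j + 1)
              + d i j • AskeyWilson.jointVec ψ₂ ψ₁ i (j - 1)
              + e i j • AskeyWilson.jointVec ψ₂ ψ₁ i j
              + d i (j + 1) • AskeyWilson.jointVec ψ₂ ψ₁ i (j + 1)
              + star (c (i + 1) (j - 1)) • AskeyWilson.jointVec ψ₂ ψ₁ (i + 1) (j - 1)
              + b (i + 1) j • AskeyWilson.jointVec ψ₂ ψ₁ (i + 1) j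
              + star (a (i + 1) (j + 1)) • AskeyWilson.jointVec ψ₂ ψ₁ (i + 1) (j + 1)) ∧
          (∀ i j : ℤ,
            AskeyWilson.denA q N₁ α₀ α₁ α₂
                (AskeyWilson.lab₁ N₁ N₂ i) (AskeyWilson.lab₂ N₂ j) ≠ 0 →
              a i j = AskeyWilson.coefA q N₁ N₂ α₀ α₁ α₂
                (AskeyWilson.lab₁ N₁ N₂ i) (AskeyWilson.lab₂ N₂ j)) ∧
          (∀ i j : ℤ, b i j = AskeyWilson.coefB q N₁ N₂ α₀ α₁ α₂
            (AskeyWilson.lab₁ N₁ N₂ i) (AskeyWilson.lab₂ N₂ j)) ∧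
          (∀ i j : ℤ,
            AskeyWilson.denC q N₁ α₀ α₁ α₂
                (AskeyWilson.lab₁ N₁ N₂ i) (AskeyWilson.lab₂ N₂ j) ≠ 0 →
              c i j = AskeyWilson.coefC q N₁ N₂ α₀ α₁ α₂
                (AskeyWilson.lab₁ N₁ N₂ i) (AskeyWilson.lab₂ N₂ j)) ∧
          (∀ i j : ℤ, d i j = AskeyWilson.coefD q N₁ N₂ α₀ α₁ α₂
            (AskeyWilson.lab₁ N₁ N₂ i) (AskeyWilson.lab₂ N₂ j)) ∧
          (∀ i j : ℤ, e i j = AskeyWilson.coefE q N₁ N₂ α₀ α₁ α₂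
            (AskeyWilson.lab₁ N₁ N₂ i) (AskeyWilson.lab₂ N₂ j))) := by

  have pent : AskeyWilson.Pentagon q (AskeyWilson.sinhq q α₀) (AskeyWilson.sinhq q α₁)
      (AskeyWilson.coshq q α₂) (AskeyWilson.coshq q (N₁ + 1)) (AskeyWilson.coshq q (N₂ + 1))
      (ρ (AskeyWilson.AW2p.gen q α₀ α₁ α₂ N₁ N₂ .K1r))
      (ρ (AskeyWilson.AW2p.gen q α₀ α₁ α₂ N₁ N₂ .L1l))
      (ρ (AskeyWilson.AW2p.gen q α₀ α₁ α₂ N₁ N₂ .K2))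
      (ρ (AskeyWilson.AW2p.gen q α₀ α₁ α₂ N₁ N₂ .L2))
      (ρ (AskeyWilson.AW2p.gen q α₀ α₁ α₂ N₁ N₂ .M2)) := by
    rw [← AskeyWilson.coshq_neg_sub_one, ← AskeyWilson.coshq_neg_sub_one]
    exact AskeyWilson.AW2.pentagon ρ hsK1r hsL1l hsK2 hsL2 hsM2
  constructor
  · obtain ⟨ψ₂, ψ₁, h⟩ := pent.exists_jointGrid hq0 hq1 hV₁ hV₂ hL1l hK1r
      (fun k hk => by
        convert hspecL k hk using 2
        rw [AskeyWilson.eig]; ring_nf)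
      (fun k hk => by
        convert hspecK k hk using 2
        rw [AskeyWilson.eig]; ring_nf)
    obtain ⟨ψ₁', h'⟩ := AskeyWilson.JointGrid.exists_isJointEigenbasis ψ₂ ψ₁ h hq0 hq1
    exact ⟨ψ₂, ψ₁', h'⟩
  · intro ψ₂ ψ₁ hψ
    have h : AskeyWilson.JointGrid q α₀ _ _ N₁ N₂ _ _ _ _ _ (AskeyWilson.jointVec ψ₂ ψ₁) :=
      ⟨pent, AskeyWilson.jointVec_isGrid ψ₂ ψ₁,
        fun i j => by rw [hψ.eigen_k1, AskeyWilson.eig_lab₂],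
        fun i j => by rw [hψ.eigen_k2, AskeyWilson.eig_lab₁]⟩
    exact h.exists_nine_term hq0 hq1 hψ.phase_l1 hψ.phase_m2
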